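/- For $p,q>0$, $x\ge 0$, $0\le y\le 1$ let $$B_{p,q}(x,y)=e^{-x/2}\sum_{j=0}^\infty \frac{1}{j!}\Bigl(\frac x2\Bigr)^j I_y(p+j,q),\qquad I_y(p,q)=\frac{\Gamma(p+q)}{\Gamma(p)\Gamma(q)}\int_0^y t^{p-1}(1-t)^{q-1}\,dt$$ be the cumulative noncentral beta distribution. Write $p=r\cos^2\theta$, $q=r\sin^2\theta$ with $r=p+q$ and $\theta\in(0,\frac12\pi)$, $\frac12xy=r\xi$, and put $$\phi(t)=\ln t-\sin^2\theta\,\ln(t-1)+\xi t\quad(t>1),\qquad t_0=\frac{\xi-\cos^2\theta+\sqrt{(\cos^2\theta-\xi)^2+4\xi}}{2\xi}$$ (with $t_0=1/\cos^2\theta$ when $\xi=0$), $$y_0=\frac{x+2p}{x+2p+2q},\qquad x_0=2\,\frac{(p+q)y-p}{1-y}.$$ (i) For $\theta\in(0,\frac12\pi)$ and $\xi\ge0$: $t_0>1$, $\phi'(t_0)=0$, and $\phi(t)-\phi(t_0)=\frac12w^2$, $\operatorname{sign}(w)=\operatorname{sign}(t-t_0)$, defines a bijection $t\mapsto w$ of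 $(1,\infty)$ onto $\mathbb R$. Let $t=t(w)$ be its inverse and $$f(w)=\frac{1}{t(1-yt)}\,\frac{dt}{dw}.$$ (ii) If moreover $y\ge0$ and $yt_0<1$ (the saddle point $t_0$ is to the left of the pole $1/y$), then $f(w)=\sum_{k=0}^\infty f_kw^k$ for all $w$ near $0$, where $f_k=f^{(k)}(0)/k!$. With $\phi_k=\phi^{(k)}(t_0)$, $$f_0=\frac{1}{\sqrt{\phi_2}\;t_0(1-yt_0)}=\frac{t_0-1}{(1-yt_0)\sqrt{\sin^2\theta\,t_0^2-(t_0-1)^2}},$$ $$\begin{aligned}f_2=\frac{1}{24\phi_2^{7/2}t_0^3(1-yt_0)^3}\Bigl(&24\phi_2^2+12\phi_2(\phi_3-6y\phi_2)t_0+(72\phi_2^2y^2+5\phi_3^2-36\phi_3y\phi_2-3\phi_4\phi_2)t_0^2\\&+2y(12\phi_3y\phi_2+3\phi_4\phi_2-5\phi_3^2)t_0^3+y^2(5\phi_3^2-3\phi_4\phi_2)t_0^4\Bigr).\end{aligned}$$ (iii) For $0<y<1$ and $x\ge0$: $t_0<1/y$ if and only if $y<y_0$, if and only if $x>x_0$.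 (iv) As $r\to\infty$, $$B_{p,q}(x,y)\sim\frac{e^{-x/2+r\phi(t_0)}y^p(1-y)^q}{\sqrt{2\pi r}}\sum_{k=0}^\infty(-1)^kf_{2k}\frac{2^k(\frac12)_k}{r^k},\qquad \bigl(\tfrac12\bigr)_k=\tfrac12\bigl(\tfrac12+1\bigr)\cdots\bigl(\tfrac12+k-1\bigr),$$ uniformly in the following sense. For all $\delta_1,\delta_2,\delta_3>0$ and every integer $N\ge0$ there are constants $C$ and $R>0$, depending only on $\delta_1,\delta_2,\delta_3,N$, such that for all $r\ge R$, $\theta\in[\delta_1,\frac12\pi-\delta_1]$, $x\ge0$ and $y\in[0,y_0-\delta_3]$ with $t_0\ge1+\delta_2$, $$\Bigl|B_{p,q}(x,y)-P\sum_{k=0}^{N-1}(-1)^kf_{2k}\frac{2^k(\frac12)_k}{r^k}\Bigr|\le C\,\frac{P}{r^{N}},\qquad P=\frac{e^{-x/2+r\phi(t_0)}y^p(1-y)^q}{\sqrt{2\pi r}}.$$ -/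

import Mathlib

open Real Set

namespace NoncentralBeta

noncomputable section

/-- The central beta distribution (regularized incomplete beta function) `I_y(p,q)`. -/
def centralBeta (p q y : ℝ) : ℝ :=
  (∫ t in (0 : ℝ)..y, t ^ (p - 1) * (1 - t) ^ (q - 1)) / ProbabilityTheory.beta p q

/-- The cumulative noncentral beta distribution `B_{p,q}(x,y)`. -/
def noncentralBeta (p q x y : ℝ) : ℝ :=
  exp (-x / 2) * ∑' j : ℕ, (x / 2) ^ j / (j.factorial : ℝ) * centralBeta (p + j) q y

/-- The phase function `φ(t) = ln t - sin²θ ln(t-1) + ξ t`, used for `t > 1`. -/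
def phase (θ ξ t : ℝ) : ℝ :=
  log t - sin θ ^ 2 * log (t - 1) + ξ * t

/-- The positive saddle point `t₀` of `phase θ ξ`; at `ξ = 0` it is the limiting value
`1 / cos²θ`. -/
def saddle (θ ξ : ℝ) : ℝ :=
  if ξ = 0 then 1 / cos θ ^ 2
  else (ξ - cos θ ^ 2 + √((cos θ ^ 2 - ξ) ^ 2 + 4 * ξ)) / (2 * ξ)

/-- The new variable `w`, as a function of `t > 1`: `φ(t) - φ(t₀) = w² / 2` and
`sign w = sign (t - t₀)`. -/
def wOf (θ ξ t : ℝ) : ℝ :=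
  Real.sign (t - saddle θ ξ) * √(2 * (phase θ ξ t - phase θ ξ (saddle θ ξ)))

/-- The inverse substitution: `t` as a function of `w`, with values in `(1, ∞)`. -/
def tOf (θ ξ w : ℝ) : ℝ :=
  Function.invFunOn (wOf θ ξ) (Ioi 1) w

/-- `f(w) = (1 / (t (1 - y t))) dt/dw`. -/
def amplitude (θ ξ y w : ℝ) : ℝ :=
  1 / (tOf θ ξ w * (1 - y * tOf θ ξ w)) * deriv (tOf θ ξ) w

/-- The Maclaurin coefficients `f_k` of `amplitude`. -/
def fCoeff (θ ξ y : ℝ) (k : ℕ) : ℝ :=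
  iteratedDeriv k (amplitude θ ξ y) 0 / (k.factorial : ℝ)

/-- `φ_k`, the `k`th derivative of the phase function at the saddle point. -/
def phaseDeriv (θ ξ : ℝ) (k : ℕ) : ℝ :=
  iteratedDeriv k (phase θ ξ) (saddle θ ξ)

/-- The transition value `y₀` with respect to `y`. -/
def yTransition (p q x : ℝ) : ℝ := (x + 2 * p) / (x + 2 * p + 2 * q)

/-- The transition value `x₀` with respect to `x`. -/
def xTransition (p q y : ℝ) : ℝ := 2 * (((p + q) * y - p) / (1 - y))

/-- The prefactor `e^{-x/2 + r φ(t₀)} y^p (1-y)^q / √(2π r)`, with `r = p + q`. -/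
def prefactor (p q x y θ ξ : ℝ) : ℝ :=
  exp (-x / 2 + (p + q) * phase θ ξ (saddle θ ξ)) * y ^ p * (1 - y) ^ q / √(2 * π * (p + q))

/-- The first `N` terms of the series `∑ (-1)^k f_{2k} 2^k (1/2)_k / r^k`. -/
def partialSeries (θ ξ y r : ℝ) (N : ℕ) : ℝ :=
  ∑ k ∈ Finset.range N,
    (-1) ^ k * fCoeff θ ξ y (2 * k) * (2 ^ k * (ascPochhammer ℝ k).eval (1 / 2)) / r ^ k

end

end NoncentralBeta

/-
On a vertical line `Re u = c` with `0 < c < 1`, the Cauchy integral of `u ^ (-p) * (1 - u) ^ (-q)`,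
as a function of `y < c`, satisfies the first-order equation of the incomplete beta function, and
its jump across the line fixes the constant. Summing over `p + j` exhibits `B_{p,q}(x,y)` as the
integral of `exp (r ψ(u)) / (u - y)` over the line, where `u = 1 / t` and `ψ(u) = φ(1 / u)`.
Along the line through the saddle point `u = 1 / t₀` the maximum of `Re ψ` is at the saddle point,
so only a disc around it matters. On that disc the holomorphic Morse coordinate `W`, with
`ψ(u) = ψ(1 / t₀) + W(u) ^ 2 / 2`, makes the phase exactly quadratic, and the moments of
`exp (r W ^ 2 / 2)` along the image of the line are those along the imaginary axis up to
exponentially small terms. Integrating the Taylor polynomial of the remaining amplitude gives the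
expansion. All estimates depend only on a lower bound for the distances of `1 / t₀` from `0`, `1`
and `y` and on an upper bound for `ξ`, which makes the expansion uniform. On the real axis `W` is
the substitution `w`, up to sign.
-/

namespace NoncentralBeta

section SignedSqrt

open Filter Topology

variable {φ : ℝ → ℝ} {l a t : ℝ}

/-- The Morse coordinate of `φ` at a minimum `a`: the square root of `2 * (φ t - φ a)`, with the
sign of `t - a`. -/
noncomputable def signedSqrt (φ : ℝ → ℝ) (a t : ℝ) : ℝ :=
  Real.sign (t - a) * √(2 * (φ t - φ a))

theorem signedSqrt_self (φ : ℝ → ℝ) (a : ℝ) : signedSqrt φ a a = 0 := by simp [signedSqrt]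

theorem signedSqrt_of_ge (h : a ≤ t) : signedSqrt φ a t = √(2 * (φ t - φ a)) := by
  rcases h.eq_or_lt with rfl | h
  · simp [signedSqrt]
  · rw [signedSqrt, Real.sign_of_pos (sub_pos.2 h), one_mul]

theorem signedSqrt_of_le (h : t ≤ a) : signedSqrt φ a t = -√(2 * (φ t - φ a)) := by
  rcases h.eq_or_lt with rfl | h
  · simp [signedSqrt]
  · rw [signedSqrt, Real.sign_of_neg (sub_neg.2 h), neg_one_mul]

theorem signedSqrt_sq (h : φ a ≤ φ t) : signedSqrt φ a t ^ 2 = 2 * (φ t - φ a) := by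
  have h0 : 0 ≤ 2 * (φ t - φ a) := by linarith
  rcases le_total a t with ht | ht
  · rw [signedSqrt_of_ge ht, sq_sqrt h0]
  · rw [signedSqrt_of_le ht, neg_sq, sq_sqrt h0]

theorem le_of_strictAntiOn_of_strictMonoOn (hanti : StrictAntiOn φ (Ioc l a))
    (hmono : StrictMonoOn φ (Ici a)) (ht : l < t) : φ a ≤ φ t := by
  rcases le_total a t with h | h
  · exact hmono.monotoneOn self_mem_Ici h h
  · exact hanti.antitoneOn ⟨ht, h⟩ ⟨ht.trans_le h, le_rfl⟩ h

theorem strictMonoOn_signedSqrt (hla : l < a) (hanti : StrictAntiOn φ (Ioc l a))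
    (hmono : StrictMonoOn φ (Ici a)) : StrictMonoOn (signedSqrt φ a) (Ioi l) := by
  have hφ {t : ℝ} (ht : l < t) : 0 ≤ 2 * (φ t - φ a) := by
    linarith [le_of_strictAntiOn_of_strictMonoOn hanti hmono ht]
  rw [← Ioc_union_Ici_eq_Ioi hla]
  refine StrictMonoOn.union (c := a) (fun s hs t ht hst => ?_) (fun s hs t ht hst => ?_)
    ⟨⟨hla, le_rfl⟩, fun t ht => ht.2⟩ isLeast_Ici
  · rw [signedSqrt_of_le hs.2, signedSqrt_of_le ht.2, neg_lt_neg_iff]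
    exact sqrt_lt_sqrt (hφ ht.1) (by linarith [hanti hs ht hst])
  · rw [signedSqrt_of_ge hs, signedSqrt_of_ge ht]
    exact sqrt_lt_sqrt (hφ (hla.trans_le hs)) (by linarith [hmono hs ht hst])

theorem surjOn_signedSqrt (hla : l < a) (hcont : ContinuousOn φ (Ioi l))
    (hbot : Tendsto φ (𝓝[>] l) atTop) (htop : Tendsto φ atTop atTop) :
    SurjOn (signedSqrt φ a) (Ioi l) univ := by
  intro w _
  have hw : φ a + w ^ 2 / 2 ∈ Ici (φ a) := mem_Ici.2 (le_add_of_nonneg_right (by positivity))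
  rcases le_total 0 w with h | h
  · obtain ⟨t, ht, hφt⟩ := isPreconnected_Ici.intermediate_value_Ici self_mem_Ici
      (le_principal_iff.2 (Ici_mem_atTop a)) (hcont.mono (Ici_subset_Ioi.2 hla)) htop hw
    refine ⟨t, hla.trans_le ht, ?_⟩
    rw [signedSqrt_of_ge ht, hφt, add_sub_cancel_left, mul_div_cancel₀ _ two_ne_zero, sqrt_sq h]
  · obtain ⟨t, ht, hφt⟩ := isPreconnected_Ioc.intermediate_value_Ici ⟨hla, le_rfl⟩
      (le_principal_iff.2 (Ioc_mem_nhdsGT hla)) (hcont.mono Ioc_subset_Ioi_self) hbot hw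
    refine ⟨t, ht.1, ?_⟩
    rw [signedSqrt_of_le ht.2, hφt, add_sub_cancel_left, mul_div_cancel₀ _ two_ne_zero,
      sqrt_sq_eq_abs, abs_of_nonpos h, neg_neg]

theorem bijOn_signedSqrt (hla : l < a) (hanti : StrictAntiOn φ (Ioc l a))
    (hmono : StrictMonoOn φ (Ici a)) (hcont : ContinuousOn φ (Ioi l))
    (hbot : Tendsto φ (𝓝[>] l) atTop) (htop : Tendsto φ atTop atTop) :
    BijOn (signedSqrt φ a) (Ioi l) univ :=
  ⟨mapsTo_univ _ _, (strictMonoOn_signedSqrt hla hanti hmono).injOn,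
    surjOn_signedSqrt hla hcont hbot htop⟩

end SignedSqrt

section Saddle

open Filter Topology

variable {θ ξ t : ℝ}

theorem cos_sq_pos_of_mem (hθ : θ ∈ Ioo 0 (π / 2)) : 0 < cos θ ^ 2 :=
  pow_pos (cos_pos_of_mem_Ioo ⟨by linarith [hθ.1, pi_pos], hθ.2⟩) 2

theorem sin_sq_pos_of_mem (hθ : θ ∈ Ioo 0 (π / 2)) : 0 < sin θ ^ 2 :=
  pow_pos (sin_pos_of_pos_of_lt_pi hθ.1 (by linarith [hθ.2, pi_pos])) 2

theorem saddle_quadratic (hθ : θ ∈ Ioo 0 (π / 2)) (hξ : 0 ≤ ξ) :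
    ξ * saddle θ ξ ^ 2 + (cos θ ^ 2 - ξ) * saddle θ ξ - 1 = 0 := by
  rcases hξ.eq_or_lt with rfl | hξ
  · rw [saddle, if_pos rfl, zero_mul, zero_add, sub_zero,
      mul_one_div_cancel (cos_sq_pos_of_mem hθ).ne', sub_self]
  · have hsq := sq_sqrt (show 0 ≤ (cos θ ^ 2 - ξ) ^ 2 + 4 * ξ by positivity)
    rw [saddle, if_neg hξ.ne']
    generalize √((cos θ ^ 2 - ξ) ^ 2 + 4 * ξ) = D at *
    field_simp
    linear_combination hsq

theorem one_lt_saddle (hθ : θ ∈ Ioo 0 (π / 2)) (hξ : 0 ≤ ξ) : 1 < saddle θ ξ := by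
  have hs := sin_sq_pos_of_mem hθ
  have hcs := sin_sq_add_cos_sq θ
  rcases hξ.eq_or_lt with rfl | hξ
  · rw [saddle, if_pos rfl, lt_div_iff₀ (cos_sq_pos_of_mem hθ)]
    linarith
  · have hlt : ξ + cos θ ^ 2 < √((cos θ ^ 2 - ξ) ^ 2 + 4 * ξ) :=
      lt_sqrt_of_sq_lt (by nlinarith [mul_pos hξ hs])
    rw [saddle, if_neg hξ.ne', lt_div_iff₀ (by positivity)]
    linarith

theorem saddle_pos (hθ : θ ∈ Ioo 0 (π / 2)) (hξ : 0 ≤ ξ) : 0 < saddle θ ξ :=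
  one_pos.trans (one_lt_saddle hθ hξ)

theorem hasDerivAt_phase (θ ξ : ℝ) (ht : 1 < t) :
    HasDerivAt (phase θ ξ) (1 / t - sin θ ^ 2 / (t - 1) + ξ) t := by
  have hlog := hasDerivAt_log (x := t) (by positivity)
  have hlog_sub := ((hasDerivAt_id t).sub_const 1).log (sub_ne_zero.2 ht.ne')
  convert! (hlog.sub (hlog_sub.const_mul (sin θ ^ 2))).add ((hasDerivAt_id t).const_mul ξ) using 1
  simp only [id, one_div, mul_one, ← div_eq_mul_inv]

theorem continuousOn_phase (θ ξ : ℝ) : ContinuousOn (phase θ ξ) (Ioi 1) :=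
  fun _ ht => (hasDerivAt_phase θ ξ ht).continuousAt.continuousWithinAt

theorem phase_deriv_eq_mul (hθ : θ ∈ Ioo 0 (π / 2)) (hξ : 0 ≤ ξ) (ht : 1 < t) :
    1 / t - sin θ ^ 2 / (t - 1) + ξ =
      (t - saddle θ ξ) * ((ξ * t + 1 / saddle θ ξ) / (t * (t - 1))) := by
  have hsub : t - 1 ≠ 0 := sub_ne_zero.2 ht.ne'
  have hsaddle := (saddle_pos hθ hξ).ne'
  rw [sin_sq]
  field_simp
  linear_combination t * saddle_quadratic hθ hξ

theorem phase_deriv_cofactor_pos (hθ : θ ∈ Ioo 0 (π / 2)) (hξ : 0 ≤ ξ) (ht : 1 < t) :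
    0 < (ξ * t + 1 / saddle θ ξ) / (t * (t - 1)) := by
  have := sub_pos.2 ht
  have := saddle_pos hθ hξ
  positivity

theorem hasDerivAt_phase_saddle (hθ : θ ∈ Ioo 0 (π / 2)) (hξ : 0 ≤ ξ) :
    HasDerivAt (phase θ ξ) 0 (saddle θ ξ) := by
  have h := hasDerivAt_phase θ ξ (one_lt_saddle hθ hξ)
  rwa [phase_deriv_eq_mul hθ hξ (one_lt_saddle hθ hξ), sub_self, zero_mul] at h

theorem strictMonoOn_phase (hθ : θ ∈ Ioo 0 (π / 2)) (hξ : 0 ≤ ξ) :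
    StrictMonoOn (phase θ ξ) (Ici (saddle θ ξ)) := by
  have hsaddle := one_lt_saddle hθ hξ
  refine strictMonoOn_of_deriv_pos (convex_Ici _)
    ((continuousOn_phase θ ξ).mono (Ici_subset_Ioi.2 hsaddle)) fun t ht => ?_
  rw [interior_Ici, mem_Ioi] at ht
  have ht1 := hsaddle.trans ht
  rw [(hasDerivAt_phase θ ξ ht1).deriv, phase_deriv_eq_mul hθ hξ ht1]
  exact mul_pos (sub_pos.2 ht) (phase_deriv_cofactor_pos hθ hξ ht1)

theorem strictAntiOn_phase (hθ : θ ∈ Ioo 0 (π / 2)) (hξ : 0 ≤ ξ) :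
    StrictAntiOn (phase θ ξ) (Ioc 1 (saddle θ ξ)) := by
  refine strictAntiOn_of_deriv_neg (convex_Ioc _ _)
    ((continuousOn_phase θ ξ).mono Ioc_subset_Ioi_self) fun t ht => ?_
  rw [interior_Ioc] at ht
  rw [(hasDerivAt_phase θ ξ ht.1).deriv, phase_deriv_eq_mul hθ hξ ht.1]
  exact mul_neg_of_neg_of_pos (sub_neg.2 ht.2) (phase_deriv_cofactor_pos hθ hξ ht.1)

theorem phase_saddle_le (hθ : θ ∈ Ioo 0 (π / 2)) (hξ : 0 ≤ ξ) (ht : 1 < t) :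
    phase θ ξ (saddle θ ξ) ≤ phase θ ξ t :=
  le_of_strictAntiOn_of_strictMonoOn (strictAntiOn_phase hθ hξ) (strictMonoOn_phase hθ hξ) ht

theorem tendsto_phase_nhdsGT_one (hs : 0 < sin θ ^ 2) (ξ : ℝ) :
    Tendsto (phase θ ξ) (𝓝[>] 1) atTop := by
  have hsub : Tendsto (fun t : ℝ => t - 1) (𝓝[>] 1) (𝓝[>] 0) := by
    refine tendsto_nhdsWithin_iff.2
      ⟨?_, eventually_mem_nhdsWithin.mono fun t ht => mem_Ioi.2 (sub_pos.2 ht)⟩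
    exact ((continuous_sub_right (1 : ℝ)).tendsto' 1 0 (sub_self 1)).mono_left nhdsWithin_le_nhds
  have hlog : Tendsto log (𝓝[>] 1) (𝓝 (log 1)) :=
    (continuousAt_log one_ne_zero).tendsto.mono_left nhdsWithin_le_nhds
  have hlin : Tendsto (fun t => ξ * t) (𝓝[>] 1) (𝓝 (ξ * 1)) :=
    (continuous_const_mul ξ).continuousAt.tendsto.mono_left nhdsWithin_le_nhds
  have hpole : Tendsto (fun t => -(sin θ ^ 2 * log (t - 1))) (𝓝[>] 1) atTop :=
    tendsto_neg_atBot_atTop.comp ((tendsto_log_nhdsGT_zero.comp hsub).const_mul_atBot hs)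
  simpa only [phase, sub_eq_add_neg] using! (hlog.add_atTop hpole).atTop_add hlin

theorem tendsto_phase_atTop (hc : 0 < cos θ ^ 2) (hξ : 0 ≤ ξ) :
    Tendsto (phase θ ξ) atTop atTop := by
  refine tendsto_atTop_mono' _ ?_ (tendsto_log_atTop.const_mul_atTop hc)
  filter_upwards [eventually_gt_atTop 1] with t ht
  have hlog : log (t - 1) ≤ log t := log_le_log (by linarith) (by linarith)
  have := mul_le_mul_of_nonneg_left hlog (sq_nonneg (sin θ))
  have : 0 ≤ ξ * t := by positivity
  rw [cos_sq', phase]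
  linarith

theorem wOf_sq (hθ : θ ∈ Ioo 0 (π / 2)) (hξ : 0 ≤ ξ) (ht : 1 < t) :
    wOf θ ξ t ^ 2 = 2 * (phase θ ξ t - phase θ ξ (saddle θ ξ)) :=
  signedSqrt_sq (phase_saddle_le hθ hξ ht)

theorem bijOn_wOf (hθ : θ ∈ Ioo 0 (π / 2)) (hξ : 0 ≤ ξ) : BijOn (wOf θ ξ) (Ioi 1) univ :=
  bijOn_signedSqrt (one_lt_saddle hθ hξ) (strictAntiOn_phase hθ hξ) (strictMonoOn_phase hθ hξ)
    (continuousOn_phase θ ξ) (tendsto_phase_nhdsGT_one (sin_sq_pos_of_mem hθ) ξ)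
    (tendsto_phase_atTop (cos_sq_pos_of_mem hθ) hξ)

end Saddle

section Transition

variable {θ ξ r p q x y δ : ℝ}

theorem one_sub_mul_saddle_mul (hθ : θ ∈ Ioo 0 (π / 2)) (hξ : 0 ≤ ξ) (y : ℝ) :
    (1 - y * saddle θ ξ) * (ξ + y / saddle θ ξ) = ξ + cos θ ^ 2 * y - y * (ξ + y) := by
  have := (saddle_pos hθ hξ).ne'
  field_simp
  linear_combination -y * saddle_quadratic hθ hξ

theorem yTransition_eq (hr : 0 < r) (hy : 0 < y) (hξ : 0 ≤ ξ) (hp : p = r * cos θ ^ 2)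
    (hq : q = r * sin θ ^ 2) (hx : x * y / 2 = r * ξ) :
    yTransition p q x = (ξ + cos θ ^ 2 * y) / (ξ + y) := by
  have hx' : x = 2 * r * ξ / y := by field_simp; linarith
  have hden : x + 2 * p + 2 * q = 2 * r * (ξ + y) / y := by
    rw [hx', hp, hq, sin_sq]; field_simp; ring
  rw [yTransition, hden, hx', hp]
  have : 0 < ξ + y := by positivity
  field_simp

theorem saddle_lt_one_div_iff_lt_yTransition (hθ : θ ∈ Ioo 0 (π / 2)) (hr : 0 < r)
    (hp : p = r * cos θ ^ 2) (hq : q = r * sin θ ^ 2) (hy : 0 < y) (hξ : 0 ≤ ξ)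
    (hx : x * y / 2 = r * ξ) : saddle θ ξ < 1 / y ↔ y < yTransition p q x := by
  have hpos : 0 < ξ + y / saddle θ ξ := by have := saddle_pos hθ hξ; positivity
  calc saddle θ ξ < 1 / y ↔ 0 < 1 - y * saddle θ ξ := by
        rw [lt_div_iff₀ hy, sub_pos, mul_comm y]
    _ ↔ 0 < (1 - y * saddle θ ξ) * (ξ + y / saddle θ ξ) := (mul_pos_iff_of_pos_right hpos).symm
    _ ↔ y < yTransition p q x := by
        rw [one_sub_mul_saddle_mul hθ hξ, sub_pos, yTransition_eq hr hy hξ hp hq hx,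
          lt_div_iff₀ (by positivity)]

theorem lt_yTransition_iff_xTransition_lt (hpq : 0 < p + q) (hx : 0 ≤ x) (hy : y < 1) :
    y < yTransition p q x ↔ xTransition p q y < x := by
  rw [yTransition, xTransition, lt_div_iff₀ (by linarith), ← mul_div_assoc,
    div_lt_iff₀ (sub_pos.2 hy)]
  constructor <;> intro h <;> linarith

theorem le_one_sub_mul_saddle (hθ : θ ∈ Ioo 0 (π / 2)) (hr : 0 < r)
    (hp : p = r * cos θ ^ 2) (hq : q = r * sin θ ^ 2) (hy : 0 < y) (hξ : 0 ≤ ξ)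
    (hx : x * y / 2 = r * ξ) (hδ : 0 ≤ δ) (hyδ : y ≤ yTransition p q x - δ) :
    δ ≤ 1 - y * saddle θ ξ := by
  have hpos : 0 < ξ + y / saddle θ ξ := by have := saddle_pos hθ hξ; positivity
  have hle : ξ + y / saddle θ ξ ≤ ξ + y := by
    gcongr; exact div_le_self hy.le (one_lt_saddle hθ hξ).le
  rw [yTransition_eq hr hy hξ hp hq hx, le_sub_iff_add_le, le_div_iff₀ (by positivity)] at hyδ
  refine le_of_mul_le_mul_right ?_ hpos
  rw [one_sub_mul_saddle_mul hθ hξ]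
  linarith [mul_le_mul_of_nonneg_left hle hδ]

end Transition

section GaussianPath

open Filter Topology MeasureTheory

theorem pow_mul_exp_neg_le_factorial {x : ℝ} (hx : 0 ≤ x) (n : ℕ) :
    x ^ n * exp (-x) ≤ n.factorial := by
  have h := pow_div_factorial_le_exp x hx n
  rw [div_le_iff₀ (by positivity)] at h
  rwa [exp_neg, ← div_eq_mul_inv, div_le_iff₀ (exp_pos x), mul_comm]

theorem exp_neg_mul_le_inv_pow {η r : ℝ} (hη : 0 < η) (hr : 0 < r) (n : ℕ) :
    exp (-(r * η)) ≤ n.factorial / η ^ n / r ^ n := by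
  rw [div_div, ← mul_pow, mul_comm η, le_div_iff₀' (by positivity)]
  exact pow_mul_exp_neg_le_factorial (by positivity) n

theorem norm_exp_mul_sq_div_two (r : ℝ) (z : ℂ) :
    ‖Complex.exp (r * z ^ 2 / 2)‖ = exp (r * (z ^ 2).re / 2) := by
  rw [Complex.norm_exp, show (r : ℂ) * z ^ 2 / 2 = ((r / 2 : ℝ) : ℂ) * z ^ 2 by push_cast; ring,
    Complex.re_ofReal_mul, div_mul_eq_mul_div]

theorem re_sq_eq (z : ℂ) : (z ^ 2).re = z.re ^ 2 - z.im ^ 2 := by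
  rw [sq, Complex.mul_re, sq, sq]

theorem exists_primitive_exp_mul_sq (r : ℝ) :
    ∃ E : ℂ → ℂ, ∀ z, HasDerivAt E (Complex.exp (r * z ^ 2 / 2)) z := by
  have hd : Differentiable ℂ fun z : ℂ => Complex.exp (r * z ^ 2 / 2) := by fun_prop
  obtain ⟨E, hE⟩ := hd.isExactOn_univ
  exact ⟨E, fun z => hE z (mem_univ z)⟩

theorem norm_primitive_sub_im_le {E : ℂ → ℂ} {r : ℝ} (hr : 0 ≤ r)
    (hE : ∀ z, HasDerivAt E (Complex.exp (r * z ^ 2 / 2)) z) (b : ℂ) :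
    ‖E b - E (b.im * Complex.I)‖ ≤ |b.re| * exp (r * (b ^ 2).re / 2) := by
  have hbound : ∀ z ∈ segment ℝ (b.im * Complex.I) b,
      ‖Complex.exp (r * z ^ 2 / 2)‖ ≤ exp (r * (b ^ 2).re / 2) := by
    rw [segment_eq_image]
    rintro _ ⟨s, ⟨hs0, hs1⟩, rfl⟩
    have hre : ((1 - s) • ((b.im : ℂ) * Complex.I) + s • b).re = s * b.re := by simp
    have him : ((1 - s) • ((b.im : ℂ) * Complex.I) + s • b).im = b.im := by simp; ring
    rw [norm_exp_mul_sq_div_two, re_sq_eq, re_sq_eq, hre, him, mul_pow]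
    gcongr
    exact mul_le_of_le_one_left (sq_nonneg _) (pow_le_one₀ hs0 hs1)
  have hsub : b - b.im * Complex.I = b.re := by apply Complex.ext <;> simp
  have h := (convex_segment _ _).norm_image_sub_le_of_norm_hasDerivWithin_le
    (fun z _ => (hE z).hasDerivWithinAt) hbound (left_mem_segment ℝ _ _) (right_mem_segment ℝ _ _)
  rw [hsub, Complex.norm_real, norm_eq_abs] at h
  exact h.trans_eq (mul_comm _ _)

theorem primitive_sub_on_imaginary_axis {E : ℂ → ℂ} {r : ℝ}
    (hE : ∀ z, HasDerivAt E (Complex.exp (r * z ^ 2 / 2)) z) (β β' : ℝ) :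
    E (β * Complex.I) - E (β' * Complex.I) =
      Complex.I * ((∫ s in β'..β, exp (-(r / 2) * s ^ 2) : ℝ) : ℂ) := by
  have hderiv (s : ℝ) : HasDerivAt (fun s : ℝ => E (s * Complex.I))
      (Complex.I * ((exp (-(r / 2) * s ^ 2) : ℝ) : ℂ)) s := by
    have hline : HasDerivAt (fun s : ℝ => (s : ℂ) * Complex.I) (1 * Complex.I) s :=
      (hasDerivAt_id _).ofReal_comp.mul_const _
    convert! (hE (s * Complex.I)).comp s hline using 1
    rw [one_mul, mul_comm, mul_pow, Complex.I_sq]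
    push_cast
    congr 2
    ring
  rw [← intervalIntegral.integral_eq_sub_of_hasDerivAt (fun s _ => hderiv s)
    (Continuous.intervalIntegrable (by fun_prop) _ _), intervalIntegral.integral_const_mul,
    intervalIntegral.integral_ofReal]

theorem abs_intervalIntegral_gaussian_sub_le {b η β β' : ℝ} (hb : 0 < b) (hβ : 0 < β)
    (hβ' : β' < 0) (hηβ : η ≤ β ^ 2) (hηβ' : η ≤ β' ^ 2) :
    |(∫ s in β'..β, exp (-b * s ^ 2)) - √(π / b)| ≤ √(π / (b / 2)) * exp (-(b / 2 * η)) := by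
  have hint : Integrable fun s : ℝ => exp (-b * s ^ 2) := integrable_exp_neg_mul_sq hb
  have hint' : Integrable fun s : ℝ => exp (-(b / 2) * s ^ 2) :=
    integrable_exp_neg_mul_sq (half_pos hb)
  rw [intervalIntegral.integral_of_le (by linarith), ← integral_gaussian,
    ← integral_add_compl (measurableSet_Ioc (a := β') (b := β)) hint, sub_add_cancel_left, abs_neg,
    abs_of_nonneg (integral_nonneg fun _ => (exp_pos _).le)]
  calc ∫ s in (Ioc β' β)ᶜ, exp (-b * s ^ 2)
      ≤ ∫ s in (Ioc β' β)ᶜ, exp (-(b / 2) * s ^ 2) * exp (-(b / 2 * η)) := by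
        refine setIntegral_mono_on hint.integrableOn (hint'.mul_const _).integrableOn
          measurableSet_Ioc.compl fun s hs => ?_
        have hs2 : η ≤ s ^ 2 := by
          rw [mem_compl_iff, mem_Ioc, not_and_or, not_lt, not_le] at hs
          rcases hs with hs | hs <;> nlinarith
        rw [← exp_add, exp_le_exp]
        linarith [mul_le_mul_of_nonneg_left hs2 (half_pos hb).le]
    _ ≤ ∫ s : ℝ, exp (-(b / 2) * s ^ 2) * exp (-(b / 2 * η)) :=
        setIntegral_le_integral (hint'.mul_const _) (Eventually.of_forall fun s => by positivity)
    _ = √(π / (b / 2)) * exp (-(b / 2 * η)) := by rw [integral_mul_const, integral_gaussian]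

/-- The moments of `exp (r z² / 2)` along the imaginary axis, given by the recursion that
integration by parts yields. -/
noncomputable def gaussMoment (r : ℝ) : ℕ → ℂ
  | 0 => Complex.I * √(2 * π / r)
  | 1 => 0
  | k + 2 => -((k + 1) / r) * gaussMoment r k

theorem gaussMoment_odd (r : ℝ) (k : ℕ) : gaussMoment r (2 * k + 1) = 0 := by
  induction k with
  | zero => rw [mul_zero, zero_add, gaussMoment]
  | succ k ih => rw [show 2 * (k + 1) + 1 = (2 * k + 1) + 2 by ring, gaussMoment, ih, mul_zero]

theorem gaussMoment_even (r : ℝ) (k : ℕ) : gaussMoment r (2 * k) =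
    Complex.I * √(2 * π / r) *
      (((-1) ^ k * (2 ^ k * (ascPochhammer ℝ k).eval (1 / 2)) / r ^ k : ℝ) : ℂ) := by
  induction k with
  | zero => simp [gaussMoment]
  | succ k ih =>
    rw [show 2 * (k + 1) = 2 * k + 2 by ring, gaussMoment, ih, ascPochhammer_succ_eval]
    push_cast
    field_simp
    ring

/-- The terms of even index of `∑ c k * gaussMoment r k`, with the factor `I` of the moments (the
direction of the path) removed. -/
noncomputable def evenGaussSum (r : ℝ) (c : ℕ → ℂ) (N : ℕ) : ℂ :=
  √(2 * π / r) * ∑ k ∈ Finset.range N, c (2 * k) *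
    (((-1) ^ k * (2 ^ k * (ascPochhammer ℝ k).eval (1 / 2)) / r ^ k : ℝ) : ℂ)

theorem sum_range_two_mul_gaussMoment (r : ℝ) (c : ℕ → ℂ) (N : ℕ) :
    ∑ k ∈ Finset.range (2 * N), c k * gaussMoment r k = Complex.I * evenGaussSum r c N := by
  rw [evenGaussSum, ← mul_assoc]
  induction N with
  | zero => simp only [mul_zero, Finset.range_zero, Finset.sum_empty]
  | succ N ih =>
    rw [show 2 * (N + 1) = 2 * N + 1 + 1 by ring, Finset.sum_range_succ, Finset.sum_range_succ, ih,
      Finset.sum_range_succ, gaussMoment_odd, gaussMoment_even]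
    ring

/-- A continuously differentiable path `γ` on `[-ρ, ρ]` that crosses `0` inside the sector
`Re z² < 0` from the lower to the upper half plane. The bound `M` controls its speed. -/
structure IsSaddlePath (ρ M : ℝ) (γ : ℝ → ℂ) : Prop where
  pos : 0 < ρ
  differentiableAt : ∀ v ∈ Icc (-ρ) ρ, DifferentiableAt ℝ γ v
  continuousOn_deriv : ContinuousOn (deriv γ) (Icc (-ρ) ρ)
  re_sq_le : ∀ v ∈ Icc (-ρ) ρ, (γ v ^ 2).re ≤ -(v ^ 2 / 2)
  norm_le : ∀ v ∈ Icc (-ρ) ρ, ‖γ v‖ ≤ M * |v|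
  norm_deriv_le : ∀ v ∈ Icc (-ρ) ρ, ‖deriv γ v‖ ≤ M
  im_pos : 0 < (γ ρ).im
  im_neg : (γ (-ρ)).im < 0

/-- The integral of `exp (r z² / 2) G` along the path `γ`, where `G` is given as a function of the
parameter of the path. -/
noncomputable def pathIntegral (ρ r : ℝ) (γ G : ℝ → ℂ) : ℂ :=
  ∫ v in (-ρ)..ρ, Complex.exp (r * γ v ^ 2 / 2) * G v * deriv γ v

/-- The moments of `exp (r z² / 2)` along the path `γ`. -/
noncomputable def pathMoment (ρ r : ℝ) (γ : ℝ → ℂ) (k : ℕ) : ℂ :=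
  pathIntegral ρ r γ fun v => γ v ^ k

namespace IsSaddlePath

variable {ρ M r : ℝ} {γ : ℝ → ℂ}

theorem nonneg_bound (h : IsSaddlePath ρ M γ) : 0 ≤ M :=
  (norm_nonneg _).trans (h.norm_deriv_le ρ ⟨by linarith [h.pos], le_rfl⟩)

theorem continuousOn (h : IsSaddlePath ρ M γ) : ContinuousOn γ (Icc (-ρ) ρ) :=
  fun v hv => (h.differentiableAt v hv).continuousAt.continuousWithinAt

theorem intervalIntegrable (h : IsSaddlePath ρ M γ) (r : ℝ) {G : ℝ → ℂ}
    (hG : ContinuousOn G (Icc (-ρ) ρ)) :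
    IntervalIntegrable (fun v => Complex.exp (r * γ v ^ 2 / 2) * G v * deriv γ v)
      volume (-ρ) ρ := by
  have := h.continuousOn
  have := h.continuousOn_deriv
  exact ContinuousOn.intervalIntegrable_of_Icc (by linarith [h.pos]) (by fun_prop)

theorem norm_end_le (h : IsSaddlePath ρ M γ) : ∀ b ∈ ({γ ρ, γ (-ρ)} : Set ℂ), ‖b‖ ≤ M * ρ := by
  rintro _ (rfl | rfl)
  · simpa only [abs_of_pos h.pos] using h.norm_le ρ ⟨by linarith [h.pos], le_rfl⟩
  · simpa only [abs_neg, abs_of_pos h.pos] using h.norm_le (-ρ) ⟨le_rfl, by linarith [h.pos]⟩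

theorem re_sq_end_le (h : IsSaddlePath ρ M γ) :
    ∀ b ∈ ({γ ρ, γ (-ρ)} : Set ℂ), (b ^ 2).re ≤ -(ρ ^ 2 / 2) := by
  rintro _ (rfl | rfl)
  · exact h.re_sq_le ρ ⟨by linarith [h.pos], le_rfl⟩
  · simpa only [neg_sq] using h.re_sq_le (-ρ) ⟨le_rfl, by linarith [h.pos]⟩

theorem half_sq_le_im_sq_end (h : IsSaddlePath ρ M γ) :
    ∀ b ∈ ({γ ρ, γ (-ρ)} : Set ℂ), ρ ^ 2 / 2 ≤ b.im ^ 2 := by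
  intro b hb
  have := h.re_sq_end_le b hb
  rw [re_sq_eq] at this
  linarith [sq_nonneg b.re]

theorem norm_pow_mul_exp_end_le (h : IsSaddlePath ρ M γ) (hr : 0 ≤ r) (k : ℕ) :
    ∀ b ∈ ({γ ρ, γ (-ρ)} : Set ℂ), ‖b ^ k * Complex.exp (r * b ^ 2 / 2)‖ ≤
      (M * ρ) ^ k * exp (-(r * (ρ ^ 2 / 8))) := by
  intro b hb
  have hb' := h.norm_end_le b hb
  have hMρ : 0 ≤ M * ρ := (norm_nonneg b).trans hb'
  rw [norm_mul, norm_pow, norm_exp_mul_sq_div_two]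
  gcongr
  nlinarith [mul_le_mul_of_nonneg_left (h.re_sq_end_le b hb) hr, mul_nonneg hr (sq_nonneg ρ)]

theorem pathMoment_zero_eq_sub (h : IsSaddlePath ρ M γ) {E : ℂ → ℂ}
    (hE : ∀ z, HasDerivAt E (Complex.exp (r * z ^ 2 / 2)) z) :
    pathMoment ρ r γ 0 = E (γ ρ) - E (γ (-ρ)) := by
  have hint := h.intervalIntegrable r (continuousOn_const (c := 1))
  simp only [mul_one] at hint
  simp only [pathMoment, pathIntegral, pow_zero, mul_one]
  refine intervalIntegral.integral_eq_sub_of_hasDerivAt (f := E ∘ γ) (fun v hv => ?_) hint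
  rw [uIcc_of_le (by linarith [h.pos])] at hv
  exact (hE _).comp v (h.differentiableAt v hv).hasDerivAt

theorem norm_primitive_end_sub_im_le (h : IsSaddlePath ρ M γ) (hr : 0 ≤ r) {E : ℂ → ℂ}
    (hE : ∀ z, HasDerivAt E (Complex.exp (r * z ^ 2 / 2)) z) :
    ∀ b ∈ ({γ ρ, γ (-ρ)} : Set ℂ),
      ‖E b - E (b.im * Complex.I)‖ ≤ M * ρ * exp (-(r * (ρ ^ 2 / 8))) := by
  intro b hb
  have hb' := h.norm_end_le b hb
  have hMρ : 0 ≤ M * ρ := (norm_nonneg b).trans hb'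
  refine (norm_primitive_sub_im_le hr hE b).trans ?_
  gcongr
  · exact (Complex.abs_re_le_norm b).trans hb'
  · nlinarith [mul_le_mul_of_nonneg_left (h.re_sq_end_le b hb) hr, mul_nonneg hr (sq_nonneg ρ)]

theorem norm_pathMoment_zero_sub_le (h : IsSaddlePath ρ M γ) (hr : 1 ≤ r) :
    ‖pathMoment ρ r γ 0 - gaussMoment r 0‖ ≤
      (2 * (M * ρ) + √(4 * π)) * exp (-(r * (ρ ^ 2 / 8))) := by
  have hr0 : 0 < r := one_pos.trans_le hr
  obtain ⟨E, hE⟩ := exists_primitive_exp_mul_sq r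
  have htop := h.norm_primitive_end_sub_im_le hr0.le hE (γ ρ) (.inl rfl)
  have hbot := h.norm_primitive_end_sub_im_le hr0.le hE (γ (-ρ)) (.inr rfl)
  set J := ∫ s in (γ (-ρ)).im..(γ ρ).im, exp (-(r / 2) * s ^ 2) with hJ
  have hgauss : ‖Complex.I * J - gaussMoment r 0‖ ≤ √(4 * π) * exp (-(r * (ρ ^ 2 / 8))) := by
    have := abs_intervalIntegral_gaussian_sub_le (half_pos hr0) h.im_pos h.im_neg
      (h.half_sq_le_im_sq_end _ (.inl rfl)) (h.half_sq_le_im_sq_end _ (.inr rfl))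
    rw [gaussMoment, ← mul_sub, norm_mul, Complex.norm_I, one_mul, ← Complex.ofReal_sub,
      Complex.norm_real, norm_eq_abs, show 2 * π / r = π / (r / 2) by field_simp]
    refine this.trans ?_
    rw [show π / (r / 2 / 2) = 4 * π / r by field_simp; ring,
      show r / 2 / 2 * (ρ ^ 2 / 2) = r * (ρ ^ 2 / 8) by ring]
    gcongr
    exact div_le_self (by positivity) hr
  have hdecomp : pathMoment ρ r γ 0 - gaussMoment r 0 =
      (E (γ ρ) - E ((γ ρ).im * Complex.I)) - (E (γ (-ρ)) - E ((γ (-ρ)).im * Complex.I)) +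
        (Complex.I * J - gaussMoment r 0) := by
    rw [h.pathMoment_zero_eq_sub hE, hJ, ← primitive_sub_on_imaginary_axis hE]
    ring
  rw [hdecomp]
  linarith [norm_add_le ((E (γ ρ) - E ((γ ρ).im * Complex.I)) -
    (E (γ (-ρ)) - E ((γ (-ρ)).im * Complex.I))) (Complex.I * J - gaussMoment r 0),
    norm_sub_le (E (γ ρ) - E ((γ ρ).im * Complex.I)) (E (γ (-ρ)) - E ((γ (-ρ)).im * Complex.I))]

theorem mul_pathMoment_add_mul_pathMoment (h : IsSaddlePath ρ M γ) (r : ℝ) (k : ℕ) :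
    k * pathMoment ρ r γ (k - 1) + r * pathMoment ρ r γ (k + 1) =
      γ ρ ^ k * Complex.exp (r * γ ρ ^ 2 / 2) -
        γ (-ρ) ^ k * Complex.exp (r * γ (-ρ) ^ 2 / 2) := by
  have hc := h.continuousOn
  have hint (j : ℕ) : IntervalIntegrable
      (fun v => Complex.exp (r * γ v ^ 2 / 2) * γ v ^ j * deriv γ v) volume (-ρ) ρ :=
    h.intervalIntegrable r (hc.pow j)
  simp only [pathMoment, pathIntegral]
  rw [← intervalIntegral.integral_const_mul, ← intervalIntegral.integral_const_mul,
    ← intervalIntegral.integral_add ((hint _).const_mul _) ((hint _).const_mul _)]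
  refine intervalIntegral.integral_eq_sub_of_hasDerivAt
    (f := fun v => γ v ^ k * Complex.exp (r * γ v ^ 2 / 2)) (fun v hv => ?_)
    (((hint _).const_mul _).add ((hint _).const_mul _))
  rw [uIcc_of_le (by linarith [h.pos])] at hv
  have hγ := (h.differentiableAt v hv).hasDerivAt
  convert! (hγ.pow k).mul (((hγ.pow 2).const_mul (r : ℂ)).div_const 2).cexp using 1
  simp only [Pi.pow_apply, Nat.cast_ofNat, Nat.add_one_sub_one, pow_one]
  ring

theorem norm_exp_mul_pow_mul_le (h : IsSaddlePath ρ M γ) (hr : 0 < r) (n : ℕ) {g : ℂ} {A : ℝ}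
    (hg : ‖g‖ ≤ A) {v : ℝ} (hv : v ∈ Icc (-ρ) ρ) :
    ‖Complex.exp (r * γ v ^ 2 / 2) * (γ v ^ (2 * n) * g) * deriv γ v‖ ≤
      M ^ (2 * n) * A * M * (n.factorial / (1 / 8) ^ n / r ^ n) * exp (-(r / 8) * v ^ 2) := by
  have hM := h.nonneg_bound
  have hA : 0 ≤ A := (norm_nonneg g).trans hg
  have hexp : exp (r * (γ v ^ 2).re / 2) ≤ exp (-(r / 8 * v ^ 2)) * exp (-(r / 8) * v ^ 2) := by
    rw [← exp_add, exp_le_exp]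
    nlinarith [h.re_sq_le v hv]
  have hpow : (v ^ 2) ^ n * exp (-(r / 8 * v ^ 2)) ≤ n.factorial / (1 / 8) ^ n / r ^ n := by
    have := pow_mul_exp_neg_le_factorial (show 0 ≤ r / 8 * v ^ 2 by positivity) n
    rw [div_div, ← mul_pow, le_div_iff₀' (by positivity), ← mul_assoc, ← mul_pow]
    convert! this using 3
    ring
  rw [norm_mul, norm_mul, norm_mul, norm_pow, norm_exp_mul_sq_div_two]
  calc exp (r * (γ v ^ 2).re / 2) * (‖γ v‖ ^ (2 * n) * ‖g‖) * ‖deriv γ v‖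
      ≤ exp (-(r / 8 * v ^ 2)) * exp (-(r / 8) * v ^ 2) * ((M * |v|) ^ (2 * n) * A) * M := by
        gcongr
        · exact h.norm_le v hv
        · exact h.norm_deriv_le v hv
    _ = M ^ (2 * n) * A * M * ((v ^ 2) ^ n * exp (-(r / 8 * v ^ 2))) * exp (-(r / 8) * v ^ 2) := by
        rw [mul_pow, pow_mul |v|, sq_abs]; ring
    _ ≤ _ := by gcongr

theorem norm_pathIntegral_pow_mul_le (h : IsSaddlePath ρ M γ) (hr : 0 < r) (n : ℕ) {G : ℝ → ℂ}
    {A : ℝ} (hG : ∀ v ∈ Icc (-ρ) ρ, ‖G v‖ ≤ A) :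
    ‖pathIntegral ρ r γ fun v => γ v ^ (2 * n) * G v‖ ≤
      M ^ (2 * n) * M * (n.factorial / (1 / 8) ^ n) * √(8 * π) * A / (√r * r ^ n) := by
  have hM := h.nonneg_bound
  have hρ := h.pos
  have hA : 0 ≤ A := (norm_nonneg _).trans (hG ρ ⟨by linarith, le_rfl⟩)
  set c := M ^ (2 * n) * A * M * (n.factorial / (1 / 8) ^ n / r ^ n) with hc
  have hint : Integrable fun v : ℝ => exp (-(r / 8) * v ^ 2) :=
    integrable_exp_neg_mul_sq (by positivity)
  calc ‖pathIntegral ρ r γ fun v => γ v ^ (2 * n) * G v‖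
      ≤ ∫ v in (-ρ)..ρ, c * exp (-(r / 8) * v ^ 2) := by
        refine intervalIntegral.norm_integral_le_of_norm_le (by linarith)
          (Eventually.of_forall fun v hv => ?_) (hint.const_mul c).intervalIntegrable
        have hv := Ioc_subset_Icc_self hv
        exact h.norm_exp_mul_pow_mul_le hr n (hG v hv) hv
    _ ≤ ∫ v : ℝ, c * exp (-(r / 8) * v ^ 2) := by
        rw [intervalIntegral.integral_of_le (by linarith)]
        exact setIntegral_le_integral (hint.const_mul _)
          (Eventually.of_forall fun s => by positivity)
    _ = _ := by
        rw [integral_const_mul, integral_gaussian, show π / (r / 8) = 8 * π / r by field_simp,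
          sqrt_div (by positivity), hc]
        field_simp

theorem pathIntegral_sum_add (h : IsSaddlePath ρ M γ) (r : ℝ) (n : ℕ) (a : ℕ → ℂ) {G : ℝ → ℂ}
    (hG : ContinuousOn G (Icc (-ρ) ρ)) :
    (pathIntegral ρ r γ fun v => ∑ k ∈ Finset.range n, a k * γ v ^ k + G v) =
      ∑ k ∈ Finset.range n, a k * pathMoment ρ r γ k + pathIntegral ρ r γ G := by
  have hc := h.continuousOn
  induction n with
  | zero => simp only [Finset.range_zero, Finset.sum_empty, zero_add]
  | succ n ih =>
    have hint : IntervalIntegrable (fun v => Complex.exp (r * γ v ^ 2 / 2) * γ v ^ n * deriv γ v)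
        volume (-ρ) ρ := h.intervalIntegrable r (hc.pow n)
    have hint' := h.intervalIntegrable r
      (G := fun v => ∑ k ∈ Finset.range n, a k * γ v ^ k + G v) (by fun_prop)
    rw [Finset.sum_range_succ, add_right_comm, ← ih, pathMoment, pathIntegral, pathIntegral,
      pathIntegral, ← intervalIntegral.integral_const_mul,
      ← intervalIntegral.integral_add hint' (hint.const_mul (a n))]
    congr 1
    ext v
    rw [Finset.sum_range_succ]
    ring

theorem norm_pathMoment_add_two_sub_le (h : IsSaddlePath ρ M γ) (hr : 1 ≤ r) (k : ℕ) :
    ‖pathMoment ρ r γ (k + 2) - gaussMoment r (k + 2)‖ ≤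
      2 * (M * ρ) ^ (k + 1) * exp (-(r * (ρ ^ 2 / 8))) +
        (k + 1) * ‖pathMoment ρ r γ k - gaussMoment r k‖ := by
  have hr0 : 0 < r := one_pos.trans_le hr
  have hrec := h.mul_pathMoment_add_mul_pathMoment r (k + 1)
  rw [Nat.add_sub_cancel] at hrec
  have htop := h.norm_pow_mul_exp_end_le hr0.le (k + 1) (γ ρ) (.inl rfl)
  have hbot := h.norm_pow_mul_exp_end_le hr0.le (k + 1) (γ (-ρ)) (.inr rfl)
  have hdiff : r * (pathMoment ρ r γ (k + 2) - gaussMoment r (k + 2)) =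
      γ ρ ^ (k + 1) * Complex.exp (r * γ ρ ^ 2 / 2) -
        γ (-ρ) ^ (k + 1) * Complex.exp (r * γ (-ρ) ^ 2 / 2) -
          ((k + 1 : ℕ) : ℂ) * (pathMoment ρ r γ k - gaussMoment r k) := by
    rw [← hrec, gaussMoment]
    push_cast
    have : (r : ℂ) ≠ 0 := Complex.ofReal_ne_zero.2 hr0.ne'
    field_simp
    ring
  calc ‖pathMoment ρ r γ (k + 2) - gaussMoment r (k + 2)‖
      ≤ r * ‖pathMoment ρ r γ (k + 2) - gaussMoment r (k + 2)‖ :=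
        le_mul_of_one_le_left (norm_nonneg _) hr
    _ = ‖r * (pathMoment ρ r γ (k + 2) - gaussMoment r (k + 2))‖ := by
        rw [norm_mul, Complex.norm_real, norm_of_nonneg hr0.le]
    _ ≤ _ := by
        rw [hdiff]
        refine (norm_sub_le _ _).trans (add_le_add ((norm_sub_le _ _).trans ?_) ?_)
        · linarith
        · rw [norm_mul, Complex.norm_natCast, Nat.cast_succ]

theorem norm_pathMoment_one_le (h : IsSaddlePath ρ M γ) (hr : 1 ≤ r) :
    ‖pathMoment ρ r γ 1‖ ≤ 2 * exp (-(r * (ρ ^ 2 / 8))) := by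
  have hr0 : 0 < r := one_pos.trans_le hr
  have hmul : r * pathMoment ρ r γ 1 =
      Complex.exp (r * γ ρ ^ 2 / 2) - Complex.exp (r * γ (-ρ) ^ 2 / 2) := by
    simpa using h.mul_pathMoment_add_mul_pathMoment r 0
  have htop := h.norm_pow_mul_exp_end_le hr0.le 0 (γ ρ) (.inl rfl)
  have hbot := h.norm_pow_mul_exp_end_le hr0.le 0 (γ (-ρ)) (.inr rfl)
  simp only [pow_zero, one_mul] at htop hbot
  calc ‖pathMoment ρ r γ 1‖ ≤ r * ‖pathMoment ρ r γ 1‖ := le_mul_of_one_le_left (norm_nonneg _) hr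
    _ = ‖r * pathMoment ρ r γ 1‖ := by rw [norm_mul, Complex.norm_real, norm_of_nonneg hr0.le]
    _ ≤ _ := by
        rw [hmul]
        linarith [norm_sub_le (Complex.exp (r * γ ρ ^ 2 / 2)) (Complex.exp (r * γ (-ρ) ^ 2 / 2))]

end IsSaddlePath

theorem exists_norm_pathMoment_sub_le {ρ M : ℝ} (hρ : 0 ≤ ρ) (hM : 0 ≤ M) (k : ℕ) :
    ∃ C, 0 ≤ C ∧ ∀ r : ℝ, 1 ≤ r → ∀ γ : ℝ → ℂ, IsSaddlePath ρ M γ →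
      ‖pathMoment ρ r γ k - gaussMoment r k‖ ≤ C * exp (-(r * (ρ ^ 2 / 8))) := by
  induction k using Nat.twoStepInduction with
  | zero => exact ⟨_, by positivity, fun r hr γ h => h.norm_pathMoment_zero_sub_le hr⟩
  | one =>
    refine ⟨2, two_pos.le, fun r hr γ h => ?_⟩
    rw [gaussMoment, sub_zero]
    exact h.norm_pathMoment_one_le hr
  | more k ih _ =>
    obtain ⟨C, hC, hbound⟩ := ih
    refine ⟨2 * (M * ρ) ^ (k + 1) + (k + 1) * C, by positivity, fun r hr γ h => ?_⟩
    rw [add_mul, mul_assoc _ C]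
    refine (h.norm_pathMoment_add_two_sub_le hr k).trans (add_le_add_right ?_ _)
    exact mul_le_mul_of_nonneg_left (hbound r hr γ h) (by positivity)

theorem exp_neg_mul_le_inv_sqrt_mul_pow {η r : ℝ} (hη : 0 < η) (hr : 1 ≤ r) (n : ℕ) :
    exp (-(r * η)) ≤ (n + 1).factorial / η ^ (n + 1) / (√r * r ^ n) := by
  have hr0 : 0 < r := one_pos.trans_le hr
  refine (exp_neg_mul_le_inv_pow hη hr0 (n + 1)).trans ?_
  rw [pow_succ' r]
  gcongr
  exact sqrt_le_iff.2 ⟨hr0.le, le_self_pow₀ hr two_ne_zero⟩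

theorem exists_norm_saddlePath_integral_sub_le {ρ M : ℝ} (hρ : 0 < ρ) (hM : 0 ≤ M) (N : ℕ) :
    ∃ C, 0 ≤ C ∧ ∀ r : ℝ, 1 ≤ r → ∀ γ : ℝ → ℂ, IsSaddlePath ρ M γ →
      ∀ (A : ℝ) (a : ℕ → ℂ) (G : ℝ → ℂ), (∀ k < 2 * N, ‖a k‖ ≤ A) →
        ContinuousOn G (Icc (-ρ) ρ) → (∀ v ∈ Icc (-ρ) ρ, ‖G v‖ ≤ A) →
          ‖(pathIntegral ρ r γ fun v =>
              ∑ k ∈ Finset.range (2 * N), a k * γ v ^ k + γ v ^ (2 * N) * G v) -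
            ∑ k ∈ Finset.range (2 * N), a k * gaussMoment r k‖ ≤ C * A / (√r * r ^ N) := by
  choose D hD hmoment using exists_norm_pathMoment_sub_le (M := M) hρ.le hM
  set F : ℝ := (N + 1).factorial / (ρ ^ 2 / 8) ^ (N + 1)
  refine ⟨(∑ k ∈ Finset.range (2 * N), D k) * F +
    M ^ (2 * N) * M * (N.factorial / (1 / 8) ^ N) * √(8 * π),
    add_nonneg (mul_nonneg (Finset.sum_nonneg fun k _ => hD k) (by positivity)) (by positivity),
    fun r hr γ h A a G ha hGc hG => ?_⟩
  have hr0 : 0 < r := one_pos.trans_le hr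
  have hA : 0 ≤ A := (norm_nonneg _).trans (hG ρ ⟨by linarith, le_rfl⟩)
  have hc := h.continuousOn
  have hterm : ∀ k ∈ Finset.range (2 * N),
      ‖a k * (pathMoment ρ r γ k - gaussMoment r k)‖ ≤ D k * (A * (F / (√r * r ^ N))) := by
    intro k hk
    calc ‖a k * (pathMoment ρ r γ k - gaussMoment r k)‖
        ≤ A * (D k * exp (-(r * (ρ ^ 2 / 8)))) := by
          rw [norm_mul]
          gcongr
          · exact ha k (Finset.mem_range.1 hk)
          · exact hmoment k r hr γ h
      _ ≤ A * (D k * (F / (√r * r ^ N))) := by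
          have := hD k
          gcongr
          exact exp_neg_mul_le_inv_sqrt_mul_pow (by positivity) hr N
      _ = D k * (A * (F / (√r * r ^ N))) := mul_left_comm _ _ _
  rw [h.pathIntegral_sum_add r _ a (by fun_prop), add_sub_right_comm, ← Finset.sum_sub_distrib]
  simp_rw [← mul_sub]
  refine (norm_add_le _ _).trans ((add_le_add (norm_sum_le_of_le _ hterm)
    (h.norm_pathIntegral_pow_mul_le hr0 N hG)).trans_eq ?_)
  rw [← Finset.sum_mul]
  field_simp

end GaussianPath

section CauchyLine

open Filter Topology MeasureTheory

/-- The point `c + i v` of the vertical line `Re u = c`. -/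
noncomputable def vline (c v : ℝ) : ℂ := c + v * Complex.I

/-- The Cauchy integral along the vertical line `Re u = c` of a density `g`, which is given as a
function of the imaginary part and integrated without the factor `1 / (2 * π)`. -/
noncomputable def cauchyLine (c : ℝ) (g : ℝ → ℂ) (y : ℝ) : ℂ :=
  ∫ v, g v * (vline c v - y)⁻¹

variable {c y : ℝ} {g : ℝ → ℂ}

@[simp] theorem vline_re (c v : ℝ) : (vline c v).re = c := by simp [vline]

@[simp] theorem vline_im (c v : ℝ) : (vline c v).im = v := by simp [vline]

@[simp] theorem vline_zero (c : ℝ) : vline c 0 = c := by simp [vline]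

theorem vline_sub_self (c v : ℝ) : vline c v - c = v * Complex.I := add_sub_cancel_left _ _

theorem hasDerivAt_vline (c v : ℝ) : HasDerivAt (vline c) Complex.I v := by
  have h : HasDerivAt (fun v : ℝ => (v : ℂ) * Complex.I) (1 * Complex.I) v :=
    (hasDerivAt_id v).ofReal_comp.mul_const _
  rw [one_mul] at h
  exact h.const_add (c : ℂ)

theorem continuous_vline (c : ℝ) : Continuous (vline c) := by
  unfold vline; fun_prop

theorem vline_mem_slitPlane (hc : 0 < c) (v : ℝ) : vline c v ∈ Complex.slitPlane :=
  .inl (by rwa [vline_re])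

theorem one_sub_vline_mem_slitPlane (hc : c < 1) (v : ℝ) : 1 - vline c v ∈ Complex.slitPlane :=
  .inl (by rwa [Complex.sub_re, Complex.one_re, vline_re, sub_pos])

theorem vline_ne_zero (hc : 0 < c) (v : ℝ) : vline c v ≠ 0 :=
  Complex.slitPlane_ne_zero (vline_mem_slitPlane hc v)

theorem one_sub_vline_ne_zero (hc : c < 1) (v : ℝ) : 1 - vline c v ≠ 0 :=
  Complex.slitPlane_ne_zero (one_sub_vline_mem_slitPlane hc v)

theorem norm_vline (c v : ℝ) : ‖vline c v‖ = √(c ^ 2 + v ^ 2) := by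
  rw [Complex.norm_eq_sqrt_sq_add_sq, vline_re, vline_im]

theorem norm_one_sub_vline (c v : ℝ) : ‖1 - vline c v‖ = √((1 - c) ^ 2 + v ^ 2) := by
  simp [Complex.norm_eq_sqrt_sq_add_sq]

theorem abs_sub_le_norm_vline_sub (c y v : ℝ) : |c - y| ≤ ‖vline c v - y‖ := by
  simpa using Complex.abs_re_le_norm (vline c v - y)

theorem vline_sub_ne_zero (hy : y ≠ c) (v : ℝ) : vline c v - y ≠ 0 :=
  norm_pos_iff.1 ((abs_pos.2 (sub_ne_zero.2 hy.symm)).trans_le (abs_sub_le_norm_vline_sub c y v))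

theorem continuous_inv_vline_sub (hy : y ≠ c) : Continuous fun v => (vline c v - y)⁻¹ :=
  ((continuous_vline c).sub continuous_const).inv₀ (vline_sub_ne_zero hy)

theorem norm_inv_vline_sub_le (hy : y ≠ c) (v : ℝ) : ‖(vline c v - y)⁻¹‖ ≤ |c - y|⁻¹ := by
  rw [norm_inv]
  exact inv_anti₀ (abs_pos.2 (sub_ne_zero.2 hy.symm)) (abs_sub_le_norm_vline_sub c y v)

theorem integrable_mul_inv_vline_sub_pow (hg : Integrable g) (hy : y ≠ c) (n : ℕ) :
    Integrable fun v => g v * (vline c v - y)⁻¹ ^ n := by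
  refine hg.mul_bdd (c := |c - y|⁻¹ ^ n) ((continuous_inv_vline_sub hy).pow n).aestronglyMeasurable
    (Eventually.of_forall fun v => ?_)
  rw [norm_pow]
  exact pow_le_pow_left₀ (norm_nonneg _) (norm_inv_vline_sub_le hy v) n

theorem integrable_mul_inv_vline_sub (hg : Integrable g) (hy : y ≠ c) :
    Integrable fun v => g v * (vline c v - y)⁻¹ := by
  simpa only [pow_one] using integrable_mul_inv_vline_sub_pow hg hy 1

theorem hasDerivAt_cauchyLine (hg : Integrable g) (hy : y ≠ c) :
    HasDerivAt (cauchyLine c g) (∫ v, g v * (vline c v - y)⁻¹ ^ 2) y := by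
  have hd : 0 < |c - y| := abs_pos.2 (sub_ne_zero.2 hy.symm)
  have hball : ∀ x ∈ Metric.ball y (|c - y| / 2), |c - y| / 2 ≤ |c - x| := by
    intro x hx
    rw [Metric.mem_ball, dist_eq] at hx
    linarith [abs_sub_le c x y]
  have hne : ∀ x ∈ Metric.ball y (|c - y| / 2), x ≠ c := by
    rintro x hx rfl
    have := hball x hx
    rw [sub_self, abs_zero] at this
    linarith
  refine (hasDerivAt_integral_of_dominated_loc_of_deriv_le
    (F := fun (x : ℝ) v => g v * (vline c v - x)⁻¹)
    (F' := fun (x : ℝ) v => g v * (vline c v - x)⁻¹ ^ 2)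
    (bound := fun v => ‖g v‖ * ((|c - y| / 2)⁻¹ ^ 2))
    (Metric.ball_mem_nhds y (half_pos hd)) ?_ (integrable_mul_inv_vline_sub hg hy)
    (integrable_mul_inv_vline_sub_pow hg hy 2).aestronglyMeasurable
    (Eventually.of_forall fun v x hx => ?_) (hg.norm.mul_const _)
    (Eventually.of_forall fun v x hx => ?_)).2
  · filter_upwards [Metric.ball_mem_nhds y (half_pos hd)] with x hx
    exact (integrable_mul_inv_vline_sub hg (hne x hx)).aestronglyMeasurable
  · rw [norm_mul, norm_pow]
    gcongr
    exact (norm_inv_vline_sub_le (hne x hx) v).trans (inv_anti₀ (half_pos hd) (hball x hx))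
  · have hsub : HasDerivAt (fun x : ℝ => vline c v - (x : ℂ)) (-1) x := by
      simpa using (hasDerivAt_id x).ofReal_comp.const_sub (vline c v)
    convert! (hsub.inv (vline_sub_ne_zero (hne x hx) v)).const_mul (g v) using 1
    rw [neg_neg, inv_pow, one_div]

theorem tendsto_integral_poisson (hg : Integrable g) (h0 : ContinuousAt g 0) :
    Tendsto (fun ε : ℝ => ∫ v, g v * ((2 * ε / (ε ^ 2 + v ^ 2) : ℝ) : ℂ)) (𝓝[>] 0)
      (𝓝 (2 * π * g 0)) := by
  have hmass : ∫ s : ℝ, π⁻¹ * (1 + s ^ 2)⁻¹ = 1 := by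
    rw [integral_const_mul, integral_univ_inv_one_add_sq, inv_mul_cancel₀ pi_ne_zero]
  have hdecay : Tendsto (fun s : ℝ => ‖s‖ ^ Module.finrank ℝ ℝ * (π⁻¹ * (1 + s ^ 2)⁻¹))
      (Bornology.cobounded ℝ) (𝓝 0) := by
    have hinv : Tendsto (fun s : ℝ => π⁻¹ * ‖s‖⁻¹) (Bornology.cobounded ℝ) (𝓝 (π⁻¹ * 0)) :=
      (tendsto_inv_atTop_zero.comp tendsto_norm_cobounded_atTop).const_mul _
    rw [mul_zero] at hinv
    refine squeeze_zero (fun s => by positivity) (fun s => ?_) hinv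
    rw [Module.finrank_self, pow_one, mul_left_comm]
    gcongr
    rcases eq_or_ne s 0 with rfl | hs
    · simp
    · rw [← div_eq_mul_inv, div_le_iff₀ (by positivity), inv_mul_eq_div,
        le_div_iff₀ (norm_pos_iff.2 hs), ← sq, norm_eq_abs, sq_abs]
      linarith
  have hpeak := (tendsto_integral_comp_smul_smul_of_integrable (fun s => by positivity) hmass
    hdecay hg h0).const_mul (2 * π : ℂ)
  refine (hpeak.comp tendsto_inv_nhdsGT_zero).congr' ?_
  filter_upwards [self_mem_nhdsWithin] with ε hε
  have hε : 0 < ε := hε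
  rw [Function.comp_apply, ← integral_const_mul]
  congr 1
  ext v
  have : 2 * π * (ε⁻¹ * (π⁻¹ * (1 + (ε⁻¹ * v) ^ 2)⁻¹)) = 2 * ε / (ε ^ 2 + v ^ 2) := by
    field_simp
  rw [Module.finrank_self, pow_one, smul_eq_mul, Complex.real_smul, ← this]
  push_cast
  ring

theorem cauchyLine_sub_eq_integral_poisson (hg : Integrable g) {ε : ℝ} (hε : 0 < ε) :
    cauchyLine c g (c - ε) - cauchyLine c g (c + ε) =
      ∫ v, g v * ((2 * ε / (ε ^ 2 + v ^ 2) : ℝ) : ℂ) := by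
  have hne : c - ε ≠ c := by linarith
  have hne' : c + ε ≠ c := by linarith
  rw [cauchyLine, cauchyLine, ← integral_sub (integrable_mul_inv_vline_sub hg hne)
    (integrable_mul_inv_vline_sub hg hne')]
  congr 1
  ext v
  have hprod : (vline c v - (c - ε : ℝ)) * (vline c v - (c + ε : ℝ)) =
      -((ε ^ 2 + v ^ 2 : ℝ) : ℂ) := by
    rw [vline]
    push_cast
    linear_combination (v : ℂ) ^ 2 * Complex.I_sq
  rw [← mul_sub, inv_sub_inv (vline_sub_ne_zero hne v) (vline_sub_ne_zero hne' v), hprod,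
    Complex.ofReal_div, div_neg, ← neg_div]
  congr 2
  push_cast
  ring

theorem tendsto_mul_cauchyLine (hg : Integrable g) :
    Tendsto (fun ε : ℝ => (ε : ℂ) * cauchyLine c g (c + ε)) (𝓝[>] 0) (𝓝 0) := by
  have hsub (ε v : ℝ) : vline c v - (c + ε : ℝ) = v * Complex.I - ε := by
    rw [vline]; push_cast; ring
  rw [← integral_zero ℝ ℂ (μ := volume)]
  simp only [cauchyLine, ← integral_const_mul]
  refine tendsto_integral_filter_of_dominated_convergence (fun v => ‖g v‖) ?_ ?_ hg.norm ?_
  · filter_upwards [self_mem_nhdsWithin] with ε hε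
    exact ((integrable_mul_inv_vline_sub hg
      (add_ne_left.2 (ne_of_gt hε))).const_mul _).aestronglyMeasurable
  · filter_upwards [self_mem_nhdsWithin] with ε hε
    have hε : 0 < ε := hε
    refine Eventually.of_forall fun v => ?_
    have hinv := norm_inv_vline_sub_le (c := c) (add_ne_left.2 hε.ne') v
    rw [sub_add_cancel_left, abs_neg, abs_of_pos hε] at hinv
    rw [norm_mul, norm_mul, Complex.norm_real, norm_of_nonneg hε.le]
    calc ε * (‖g v‖ * ‖(vline c v - (c + ε : ℝ))⁻¹‖) ≤ ε * (‖g v‖ * ε⁻¹) := by gcongr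
      _ = ‖g v‖ := by field_simp
  · filter_upwards [Measure.ae_ne volume 0] with v hv
    have hv' : (v : ℂ) * Complex.I - (0 : ℝ) ≠ 0 := by simpa using hv
    have hcast : Tendsto (fun ε : ℝ => (ε : ℂ)) (𝓝 0) (𝓝 ((0 : ℝ) : ℂ)) :=
      Complex.continuous_ofReal.tendsto 0
    have h := hcast.mul (((tendsto_const_nhds.sub hcast).inv₀ hv').const_mul (g v))
    rw [Complex.ofReal_zero, zero_mul] at h
    simpa only [hsub] using h.mono_left nhdsWithin_le_nhds

theorem tendsto_symm_slope_of_hasDerivAt {W : ℝ → ℝ} {W' : ℝ} (hW : HasDerivAt W W' c) :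
    Tendsto (fun ε => (W (c - ε) - W (c + ε)) / ε) (𝓝[>] 0) (𝓝 (-(2 * W'))) := by
  have hsub : HasDerivAt (fun ε => W (c - ε)) (-W') 0 :=
    HasDerivAt.comp_const_sub c 0 (by rwa [sub_zero])
  have hadd : HasDerivAt (fun ε => W (c + ε)) W' 0 :=
    HasDerivAt.comp_const_add c 0 (by rwa [add_zero])
  have h := (hsub.sub hadd).tendsto_slope_zero_right
  rw [show -W' - W' = -(2 * W') by ring] at h
  refine h.congr fun ε => ?_
  simp [div_eq_inv_mul]

/- The Plemelj jump. The weight `W` differs on the two sides of the line by `O(ε)`, which is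
harmless because `cauchyLine` is `o(1 / ε)`. -/
theorem tendsto_mul_cauchyLine_sub (hg : Integrable g) (h0 : ContinuousAt g 0) {W : ℝ → ℝ} {W' : ℝ}
    (hW : HasDerivAt W W' c) :
    Tendsto (fun ε : ℝ => W (c - ε) * cauchyLine c g (c - ε) - W (c + ε) * cauchyLine c g (c + ε))
      (𝓝[>] 0) (𝓝 (W c * (2 * π * g 0))) := by
  have hWc : Tendsto (fun ε => W (c - ε)) (𝓝[>] 0) (𝓝 (W c)) := by
    refine hW.continuousAt.tendsto.comp (Tendsto.mono_left ?_ nhdsWithin_le_nhds)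
    exact Continuous.tendsto' (by fun_prop) _ _ (sub_zero c)
  have h := (((Complex.continuous_ofReal.tendsto _).comp hWc).mul
    (tendsto_integral_poisson hg h0)).add (((Complex.continuous_ofReal.tendsto _).comp
      (tendsto_symm_slope_of_hasDerivAt hW)).mul (tendsto_mul_cauchyLine (c := c) hg))
  rw [mul_zero, add_zero] at h
  refine h.congr' ?_
  filter_upwards [self_mem_nhdsWithin] with ε hε
  have hε' : (ε : ℂ) ≠ 0 := Complex.ofReal_ne_zero.2 (ne_of_gt hε)
  simp only [Function.comp_apply]
  rw [← cauchyLine_sub_eq_integral_poisson (c := c) hg hε]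
  push_cast
  field_simp
  ring

end CauchyLine

section IncompleteBeta

open Filter Topology MeasureTheory

variable {p q y : ℝ}

theorem betaDensity_ofReal {t : ℝ} (ht : t ∈ Icc (0 : ℝ) 1) (p q : ℝ) :
    ((t ^ (p - 1) * (1 - t) ^ (q - 1) : ℝ) : ℂ) =
      (t : ℂ) ^ ((p : ℂ) - 1) * (1 - (t : ℂ)) ^ ((q : ℂ) - 1) := by
  rw [Complex.ofReal_mul, Complex.ofReal_cpow ht.1, Complex.ofReal_cpow (sub_nonneg.2 ht.2)]
  push_cast
  rfl

theorem intervalIntegrable_betaDensity (hp : 0 < p) (hq : 0 < q) {a b : ℝ}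
    (ha : a ∈ Icc (0 : ℝ) 1) (hb : b ∈ Icc (0 : ℝ) 1) :
    IntervalIntegrable (fun t : ℝ => t ^ (p - 1) * (1 - t) ^ (q - 1)) volume a b := by
  have h := Complex.betaIntegral_convergent (u := p) (v := q) (by simpa) (by simpa)
  refine IntervalIntegrable.mono_set (a := 0) (b := 1) ?_
    (by rw [uIcc_of_le zero_le_one]; exact uIcc_subset_Icc ha hb)
  rw [intervalIntegrable_iff_integrableOn_Ioc_of_le zero_le_one] at h ⊢
  refine IntegrableOn.congr_fun (Integrable.re h) (fun t ht => ?_) measurableSet_Ioc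
  simp only [← betaDensity_ofReal (Ioc_subset_Icc_self ht) p q]
  exact Complex.ofReal_re _

theorem integral_betaDensity (hp : 0 < p) (hq : 0 < q) :
    ∫ t in (0 : ℝ)..1, t ^ (p - 1) * (1 - t) ^ (q - 1) = ProbabilityTheory.beta p q := by
  have hcast : Complex.betaIntegral p q =
      ((∫ t in (0 : ℝ)..1, t ^ (p - 1) * (1 - t) ^ (q - 1) : ℝ) : ℂ) := by
    rw [← intervalIntegral.integral_ofReal]
    refine intervalIntegral.integral_congr fun t ht => ?_
    rw [uIcc_of_le zero_le_one] at ht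
    exact (betaDensity_ofReal ht p q).symm
  rw [ProbabilityTheory.beta_eq_betaIntegralReal p q hp hq, hcast, Complex.ofReal_re]

/-- The unnormalized incomplete beta function. -/
noncomputable def incompleteBeta (p q y : ℝ) : ℝ :=
  ∫ t in (0 : ℝ)..y, t ^ (p - 1) * (1 - t) ^ (q - 1)

theorem incompleteBeta_one (hp : 0 < p) (hq : 0 < q) :
    incompleteBeta p q 1 = ProbabilityTheory.beta p q :=
  integral_betaDensity hp hq

theorem incompleteBeta_sub (hp : 0 < p) (hq : 0 < q) {a b : ℝ} (ha : a ∈ Icc (0 : ℝ) 1)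
    (hb : b ∈ Icc (0 : ℝ) 1) : incompleteBeta p q b - incompleteBeta p q a =
      ∫ t in a..b, t ^ (p - 1) * (1 - t) ^ (q - 1) :=
  intervalIntegral.integral_interval_sub_left
    (intervalIntegrable_betaDensity hp hq ⟨le_rfl, zero_le_one⟩ hb)
    (intervalIntegrable_betaDensity hp hq ⟨le_rfl, zero_le_one⟩ ha)

theorem continuousAt_incompleteBeta (hp : 0 < p) (hq : 0 < q) (hy0 : 0 < y) (hy1 : y < 1) :
    ContinuousAt (incompleteBeta p q) y := by
  have hint := intervalIntegrable_betaDensity (p := p) (q := q) hp hq (left_mem_Icc.2 zero_le_one)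
    (right_mem_Icc.2 zero_le_one)
  rw [intervalIntegrable_iff_integrableOn_Icc_of_le zero_le_one] at hint
  have h := intervalIntegral.continuousOn_primitive_interval (a := 0) (b := 1)
    (by rwa [uIcc_of_le zero_le_one])
  rw [uIcc_of_le zero_le_one] at h
  exact h.continuousAt (Icc_mem_nhds hy0 hy1)

theorem hasDerivAt_betaWeight (p q : ℝ) (hy0 : 0 < y) (hy1 : y < 1) :
    HasDerivAt (fun y : ℝ => y ^ p * (1 - y) ^ q)
      (y ^ (p - 1) * (1 - y) ^ (q - 1) * (p * (1 - y) - q * y)) y := by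
  have h1y : 0 < 1 - y := sub_pos.2 hy1
  have h1 := (hasDerivAt_id y).rpow_const (p := p) (.inl hy0.ne')
  have h2 := ((hasDerivAt_id y).const_sub 1).rpow_const (p := q) (.inl h1y.ne')
  convert! h1.mul h2 using 1
  simp only [id]
  rw [rpow_sub_one hy0.ne', rpow_sub_one h1y.ne']
  field_simp
  ring

end IncompleteBeta

section BetaLine

open Filter Topology MeasureTheory

variable {c p q y : ℝ}

/-- The function `u ^ (-p) * (1 - u) ^ (-q)` on the vertical line `Re u = c`. -/
noncomputable def betaLine (c p q v : ℝ) : ℂ :=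
  vline c v ^ (-p : ℂ) * (1 - vline c v) ^ (-q : ℂ)

theorem continuous_betaLine (hc : 0 < c) (hc1 : c < 1) (p q : ℝ) :
    Continuous (betaLine c p q) :=
  ((continuous_vline c).cpow continuous_const (vline_mem_slitPlane hc)).mul
    ((continuous_const.sub (continuous_vline c)).cpow continuous_const
      (one_sub_vline_mem_slitPlane hc1))

theorem sqrt_sq_add_sq_rpow_neg_le {c : ℝ} (hc : 0 < c) (hc1 : c ≤ 1) (hp : 0 ≤ p) (v : ℝ) :
    √(c ^ 2 + v ^ 2) ^ (-p) ≤ c ^ (-p) * (1 + v ^ 2) ^ (-p / 2) := by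
  have hle : c * √(1 + v ^ 2) ≤ √(c ^ 2 + v ^ 2) := by
    refine le_sqrt_of_sq_le ?_
    rw [mul_pow, sq_sqrt (by positivity)]
    nlinarith [mul_le_of_le_one_left (sq_nonneg v) (pow_le_one₀ hc.le hc1 (n := 2))]
  calc √(c ^ 2 + v ^ 2) ^ (-p) ≤ (c * √(1 + v ^ 2)) ^ (-p) :=
        rpow_le_rpow_of_nonpos (by positivity) hle (by linarith)
    _ = c ^ (-p) * (1 + v ^ 2) ^ (-p / 2) := by
        rw [mul_rpow hc.le (sqrt_nonneg _), sqrt_eq_rpow, ← rpow_mul (by positivity)]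
        ring_nf

theorem norm_betaLine_le (hc : 0 < c) (hc1 : c < 1) (hp : 0 ≤ p) (hq : 0 ≤ q) (v : ℝ) :
    ‖betaLine c p q v‖ ≤ c ^ (-p) * (1 - c) ^ (-q) * (1 + v ^ 2) ^ (-(p + q) / 2) := by
  rw [betaLine, norm_mul, ← Complex.ofReal_neg, ← Complex.ofReal_neg, Complex.norm_cpow_real,
    Complex.norm_cpow_real, norm_vline, norm_one_sub_vline]
  refine (mul_le_mul (sqrt_sq_add_sq_rpow_neg_le hc hc1.le hp v)
    (sqrt_sq_add_sq_rpow_neg_le (sub_pos.2 hc1) (by linarith) hq v) (by positivity)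
    (by positivity)).trans (le_of_eq ?_)
  rw [show -(p + q) / 2 = -p / 2 + -q / 2 by ring, rpow_add (by positivity)]
  ring

theorem integrable_betaLine (hc : 0 < c) (hc1 : c < 1) (hp : 0 ≤ p) (hq : 0 ≤ q)
    (hpq : 1 < p + q) : Integrable (betaLine c p q) := by
  have h : Integrable fun v : ℝ => (1 + ‖v‖ ^ 2) ^ (-(p + q) / 2) :=
    integrable_rpow_neg_one_add_norm_sq (by simpa using hpq)
  simp only [norm_eq_abs, sq_abs] at h
  exact (h.const_mul _).mono' (continuous_betaLine hc hc1 p q).aestronglyMeasurable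
    (Eventually.of_forall (norm_betaLine_le hc hc1 hp hq))

theorem hasDerivAt_betaLine (hc : 0 < c) (hc1 : c < 1) (p q v : ℝ) :
    HasDerivAt (betaLine c p q)
      (Complex.I * betaLine c p q v * (-p / vline c v + q / (1 - vline c v))) v := by
  have h0 := vline_ne_zero hc v
  have h1 := one_sub_vline_ne_zero hc1 v
  have e1 := (hasDerivAt_id (vline c v)).cpow_const (c := (-p : ℂ)) (vline_mem_slitPlane hc v)
  have e2 := ((hasDerivAt_id (vline c v)).const_sub 1).cpow_const (c := (-q : ℂ))
    (one_sub_vline_mem_slitPlane hc1 v)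
  convert! (e1.mul e2).comp v (hasDerivAt_vline c v) using 1
  simp only [id]
  rw [Complex.cpow_sub _ _ h0, Complex.cpow_sub _ _ h1, Complex.cpow_one, Complex.cpow_one,
    betaLine]
  field_simp

/-- The product of `u ^ (1 - p) * (1 - u) ^ (1 - q)` with the Cauchy kernel, on `Re u = c`. The
integral of its derivative vanishes, which is the differential equation satisfied by
`cauchyLine c (betaLine c p q)`. -/
noncomputable def betaKernel (c p q y v : ℝ) : ℂ :=
  betaLine c p q v * (vline c v * (1 - vline c v) * (vline c v - y)⁻¹)

theorem hasDerivAt_betaKernel (hc : 0 < c) (hc1 : c < 1) (p q : ℝ) (hy : y ≠ c) (v : ℝ) :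
    HasDerivAt (betaKernel c p q y) (Complex.I * ((p + q - 1 : ℂ) * betaLine c p q v +
      ((p + q) * y - p) * (betaLine c p q v * (vline c v - y)⁻¹) -
        y * (1 - y) * (betaLine c p q v * (vline c v - y)⁻¹ ^ 2))) v := by
  have h := hasDerivAt_vline c v
  have h0 := vline_ne_zero hc v
  have h1 := one_sub_vline_ne_zero hc1 v
  have h2 := vline_sub_ne_zero hy v
  convert! (hasDerivAt_betaLine hc hc1 p q v).mul
    ((h.mul (h.const_sub 1)).mul ((h.sub_const (y : ℂ)).inv h2)) using 1
  simp only [Pi.mul_apply, Pi.inv_apply]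
  field_simp
  ring

theorem norm_vline_mul_inv_sub_le (hy : y ≠ c) (v : ℝ) :
    ‖vline c v * (vline c v - y)⁻¹‖ ≤ 1 + |y| * |c - y|⁻¹ := by
  have h : vline c v * (vline c v - y)⁻¹ = 1 + y * (vline c v - y)⁻¹ := by
    have := vline_sub_ne_zero hy v
    field_simp
    ring
  rw [h]
  refine (norm_add_le _ _).trans ?_
  rw [norm_one, norm_mul, Complex.norm_real, norm_eq_abs]
  gcongr
  exact norm_inv_vline_sub_le hy v

theorem norm_betaKernel_le (hc : 0 < c) (hc1 : c < 1) (hp : 0 ≤ p) (hq : 0 ≤ q) (hy : y ≠ c)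
    (v : ℝ) : ‖betaKernel c p q y v‖ ≤ c ^ (-p) * (1 - c) ^ (-q) * (1 + |y| * |c - y|⁻¹) *
      (1 + v ^ 2) ^ (-((p + q - 1) / 2)) := by
  have := (sub_pos.2 hc1).le
  have hsqrt : ‖1 - vline c v‖ ≤ (1 + v ^ 2) ^ (1 / 2 : ℝ) := by
    rw [norm_one_sub_vline, ← sqrt_eq_rpow]
    exact sqrt_le_sqrt (by nlinarith)
  calc ‖betaKernel c p q y v‖
      = ‖betaLine c p q v‖ * (‖vline c v * (vline c v - y)⁻¹‖ * ‖1 - vline c v‖) := by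
        rw [betaKernel, mul_right_comm, norm_mul, norm_mul]
    _ ≤ c ^ (-p) * (1 - c) ^ (-q) * (1 + v ^ 2) ^ (-(p + q) / 2) *
          ((1 + |y| * |c - y|⁻¹) * (1 + v ^ 2) ^ (1 / 2 : ℝ)) := by
        gcongr
        · exact norm_betaLine_le hc hc1 hp hq v
        · exact norm_vline_mul_inv_sub_le hy v
    _ = _ := by
        rw [show -((p + q - 1) / 2) = -(p + q) / 2 + 1 / 2 by ring, rpow_add (by positivity)]
        ring

theorem tendsto_betaKernel (hc : 0 < c) (hc1 : c < 1) (hp : 0 ≤ p) (hq : 0 ≤ q)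
    (hpq : 1 < p + q) (hy : y ≠ c) {l : Filter ℝ} (hl : Tendsto (fun v => |v|) l atTop) :
    Tendsto (betaKernel c p q y) l (𝓝 0) := by
  have hsq : Tendsto (fun v : ℝ => 1 + v ^ 2) l atTop := by
    simpa only [Function.comp_def, sq_abs] using
      tendsto_atTop_add_const_left _ 1 ((tendsto_pow_atTop two_ne_zero).comp hl)
  have h := ((tendsto_rpow_neg_atTop (half_pos (sub_pos.2 hpq))).comp hsq).const_mul
    (c ^ (-p) * (1 - c) ^ (-q) * (1 + |y| * |c - y|⁻¹))
  rw [mul_zero] at h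
  exact squeeze_zero_norm (norm_betaKernel_le hc hc1 hp hq hy) h

theorem cauchyLine_betaLine_ode (hc : 0 < c) (hc1 : c < 1) (hp : 0 ≤ p) (hq : 0 ≤ q)
    (hpq : 1 < p + q) (hy : y ≠ c) :
    (p + q - 1 : ℂ) * (∫ v, betaLine c p q v) +
      ((p + q) * y - p) * cauchyLine c (betaLine c p q) y -
        y * (1 - y) * deriv (cauchyLine c (betaLine c p q)) y = 0 := by
  have i0 := integrable_betaLine hc hc1 hp hq hpq
  have i1 := (integrable_mul_inv_vline_sub i0 hy).const_mul ((p + q) * y - p : ℂ)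
  have i2 := (integrable_mul_inv_vline_sub_pow i0 hy 2).const_mul (y * (1 - y) : ℂ)
  have i01 := (i0.const_mul (p + q - 1 : ℂ)).add i1
  have h := integral_of_hasDerivAt_of_tendsto (hasDerivAt_betaKernel hc hc1 p q hy)
    ((i01.sub i2).const_mul _) (tendsto_betaKernel hc hc1 hp hq hpq hy tendsto_abs_atBot_atTop)
    (tendsto_betaKernel hc hc1 hp hq hpq hy tendsto_abs_atTop_atTop)
  rw [sub_zero, integral_const_mul] at h
  have h := (mul_eq_zero.1 h).resolve_left Complex.I_ne_zero
  rw [integral_sub (by exact i01) i2, integral_add (i0.const_mul _) i1, integral_const_mul,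
    integral_const_mul, integral_const_mul] at h
  rwa [(hasDerivAt_cauchyLine i0 hy).deriv, cauchyLine]

/-- The function `y ^ p * (1 - y) ^ q` times the Cauchy integral of `betaLine`. Up to a constant
factor it is the incomplete beta function to the left of `c`, and minus its complement to the
right. -/
noncomputable def betaCauchy (c p q y : ℝ) : ℂ :=
  ((y ^ p * (1 - y) ^ q : ℝ) : ℂ) * cauchyLine c (betaLine c p q) y

theorem hasDerivAt_betaCauchy (hc : 0 < c) (hc1 : c < 1) (hp : 0 ≤ p) (hq : 0 ≤ q)
    (hpq : 1 < p + q) (hy : y ≠ c) (hy0 : 0 < y) (hy1 : y < 1) :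
    HasDerivAt (betaCauchy c p q)
      ((p + q - 1) * (∫ v, betaLine c p q v) * ((y ^ (p - 1) * (1 - y) ^ (q - 1) : ℝ) : ℂ)) y := by
  have hdiff := (hasDerivAt_cauchyLine (integrable_betaLine hc hc1 hp hq hpq) hy).differentiableAt
  convert! (hasDerivAt_betaWeight p q hy0 hy1).ofReal_comp.mul hdiff.hasDerivAt using 1
  have hw : y ^ p * (1 - y) ^ q = y ^ (p - 1) * (1 - y) ^ (q - 1) * (y * (1 - y)) := by
    have h1y := (sub_pos.2 hy1).ne'
    rw [rpow_sub_one hy0.ne', rpow_sub_one h1y]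
    field_simp
  rw [hw]
  push_cast
  linear_combination ((y ^ (p - 1) : ℝ) : ℂ) * (((1 - y) ^ (q - 1) : ℝ) : ℂ) *
    cauchyLine_betaLine_ode hc hc1 hp hq hpq hy

theorem continuousAt_betaCauchy (hc : 0 < c) (hc1 : c < 1) (hp : 0 ≤ p) (hq : 0 ≤ q)
    (hpq : 1 < p + q) (hy : y ≠ c) : ContinuousAt (betaCauchy c p q) y := by
  have hw : Continuous fun y : ℝ => y ^ p * (1 - y) ^ q :=
    (continuous_rpow_const hp).mul
      ((continuous_rpow_const hq).comp (continuous_const.sub continuous_id))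
  exact (Complex.continuous_ofReal.comp hw).continuousAt.mul
    (hasDerivAt_cauchyLine (integrable_betaLine hc hc1 hp hq hpq) hy).continuousAt

theorem betaCauchy_sub (hc : 0 < c) (hc1 : c < 1) (hp : 0 < p) (hq : 0 < q)
    (hpq : 1 < p + q) {a b : ℝ} (ha : 0 ≤ a) (hab : a ≤ b) (hb : b ≤ 1) (h : c ∉ Icc a b) :
    betaCauchy c p q b - betaCauchy c p q a = (p + q - 1) * (∫ v, betaLine c p q v) *
      ((incompleteBeta p q b - incompleteBeta p q a : ℝ) : ℂ) := by
  have hne : ∀ t ∈ Icc a b, t ≠ c := fun t ht h' => h (h' ▸ ht)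
  have ha' : a ∈ Icc (0 : ℝ) 1 := ⟨ha, hab.trans hb⟩
  have hb' : b ∈ Icc (0 : ℝ) 1 := ⟨ha.trans hab, hb⟩
  have hint := intervalIntegrable_betaDensity hp hq ha' hb'
  rw [incompleteBeta_sub hp hq ha' hb', ← intervalIntegral.integral_ofReal,
    ← intervalIntegral.integral_const_mul]
  refine (intervalIntegral.integral_eq_sub_of_hasDerivAt_of_le hab (fun t ht => ?_)
    (fun t ht => ?_) (IntervalIntegrable.const_mul ⟨hint.1.ofReal, hint.2.ofReal⟩ _)).symm
  · exact (continuousAt_betaCauchy hc hc1 hp.le hq.le hpq (hne t ht)).continuousWithinAt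
  · exact hasDerivAt_betaCauchy hc hc1 hp.le hq.le hpq (hne t (Ioo_subset_Icc_self ht))
      (ha.trans_lt ht.1) (ht.2.trans_le hb)

theorem betaCauchy_of_lt (hc : 0 < c) (hc1 : c < 1) (hp : 0 < p) (hq : 0 < q)
    (hpq : 1 < p + q) (hy : 0 ≤ y) (hyc : y < c) : betaCauchy c p q y =
      (p + q - 1) * (∫ v, betaLine c p q v) * (incompleteBeta p q y : ℂ) := by
  have h := betaCauchy_sub hc hc1 hp hq hpq le_rfl hy (by linarith) fun h => hyc.not_ge h.2
  have hzero : betaCauchy c p q 0 = 0 := by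
    rw [betaCauchy, zero_rpow hp.ne', zero_mul, Complex.ofReal_zero, zero_mul]
  have hB : incompleteBeta p q 0 = 0 := intervalIntegral.integral_same
  rwa [hzero, hB, sub_zero, sub_zero] at h

theorem betaCauchy_of_gt (hc : 0 < c) (hc1 : c < 1) (hp : 0 < p) (hq : 0 < q)
    (hpq : 1 < p + q) (hcy : c < y) (hy : y ≤ 1) : betaCauchy c p q y =
      (p + q - 1) * (∫ v, betaLine c p q v) *
        ((incompleteBeta p q y - ProbabilityTheory.beta p q : ℝ) : ℂ) := by
  have h := betaCauchy_sub hc hc1 hp hq hpq (by linarith) hy le_rfl fun h => hcy.not_ge h.1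
  have hone : betaCauchy c p q 1 = 0 := by
    rw [betaCauchy, sub_self, zero_rpow hq.ne', mul_zero, Complex.ofReal_zero, zero_mul]
  rw [hone, incompleteBeta_one hp hq] at h
  push_cast at h ⊢
  linear_combination -h

theorem betaWeight_mul_betaLine_zero (hc : 0 < c) (hc1 : c < 1) (p q : ℝ) :
    ((c ^ p * (1 - c) ^ q : ℝ) : ℂ) * betaLine c p q 0 = 1 := by
  have h1c : 0 < 1 - c := sub_pos.2 hc1
  have h : betaLine c p q 0 = ((c ^ (-p) * (1 - c) ^ (-q) : ℝ) : ℂ) := by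
    rw [betaLine, vline_zero, Complex.ofReal_mul, Complex.ofReal_cpow hc.le,
      Complex.ofReal_cpow h1c.le]
    push_cast
    rfl
  rw [h, ← Complex.ofReal_mul, mul_mul_mul_comm, ← rpow_add hc, ← rpow_add h1c, add_neg_cancel,
    add_neg_cancel, rpow_zero, rpow_zero, mul_one, Complex.ofReal_one]

theorem tendsto_betaCauchy_sub (hc : 0 < c) (hc1 : c < 1) (hp : 0 ≤ p) (hq : 0 ≤ q)
    (hpq : 1 < p + q) :
    Tendsto (fun ε : ℝ => betaCauchy c p q (c - ε) - betaCauchy c p q (c + ε)) (𝓝[>] 0)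
      (𝓝 (2 * π)) := by
  have h := tendsto_mul_cauchyLine_sub (integrable_betaLine hc hc1 hp hq hpq)
    (continuous_betaLine hc hc1 p q).continuousAt (hasDerivAt_betaWeight p q hc hc1)
  rwa [mul_left_comm, betaWeight_mul_betaLine_zero hc hc1, mul_one] at h

theorem integral_betaLine_mul_beta (hc : 0 < c) (hc1 : c < 1) (hp : 0 < p) (hq : 0 < q)
    (hpq : 1 < p + q) :
    (p + q - 1) * (∫ v, betaLine c p q v) * (ProbabilityTheory.beta p q : ℂ) = 2 * π := by
  set A : ℂ := (p + q - 1) * (∫ v, betaLine c p q v)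
  have hcont : ContinuousAt (fun ε => (incompleteBeta p q (c - ε) : ℂ)
      - incompleteBeta p q (c + ε)) 0 := by
    have hB := continuousAt_incompleteBeta hp hq hc hc1
    have hsub : ContinuousAt (fun ε => incompleteBeta p q (c - ε)) 0 :=
      ContinuousAt.comp (g := incompleteBeta p q) (f := fun ε => c - ε) (by rwa [sub_zero])
        (by fun_prop)
    have hadd : ContinuousAt (fun ε => incompleteBeta p q (c + ε)) 0 :=
      ContinuousAt.comp (g := incompleteBeta p q) (f := fun ε => c + ε) (by rwa [add_zero])
        (by fun_prop)
    exact hsub.ofReal.sub hadd.ofReal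
  have hlim := ((hcont.tendsto.mono_left (nhdsWithin_le_nhds (s := Ioi 0))).add_const
    (ProbabilityTheory.beta p q : ℂ)).const_mul A
  rw [sub_zero, add_zero, sub_self, zero_add] at hlim
  refine tendsto_nhds_unique (hlim.congr' ?_) (tendsto_betaCauchy_sub hc hc1 hp.le hq.le hpq)
  filter_upwards [Ioo_mem_nhdsGT (lt_min hc (sub_pos.2 hc1))] with ε hε
  have hεc : ε < c := hε.2.trans_le (min_le_left _ _)
  have hε1 : ε < 1 - c := hε.2.trans_le (min_le_right _ _)
  rw [betaCauchy_of_lt hc hc1 hp hq hpq (sub_nonneg.2 hεc.le) (sub_lt_self c hε.1),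
    betaCauchy_of_gt hc hc1 hp hq hpq (lt_add_of_pos_right c hε.1) (by linarith)]
  push_cast
  ring

theorem centralBeta_eq_integral (hc : 0 < c) (hc1 : c < 1) (hp : 0 < p) (hq : 0 < q)
    (hpq : 1 < p + q) (hy : 0 ≤ y) (hyc : y < c) :
    (centralBeta p q y : ℂ) = ((y ^ p * (1 - y) ^ q : ℝ) : ℂ) / (2 * π) *
      ∫ v, betaLine c p q v * (vline c v - y)⁻¹ := by
  have hnorm := integral_betaLine_mul_beta hc hc1 hp hq hpq
  have hbeta := betaCauchy_of_lt hc hc1 hp hq hpq hy hyc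
  have hpi : (2 * π : ℂ) ≠ 0 := by simp [pi_ne_zero]
  rw [betaCauchy, cauchyLine] at hbeta
  rw [← hnorm] at hpi
  rw [div_mul_eq_mul_div, hbeta, ← hnorm, mul_div_mul_left _ _ (left_ne_zero_of_mul hpi),
    centralBeta, incompleteBeta, Complex.ofReal_div]

theorem hasSum_integral_pow_div_factorial_mul {g h : ℝ → ℂ} {K : ℝ} (hg : Integrable g)
    (hh : Continuous h) (hK : ∀ v, ‖h v‖ ≤ K) :
    HasSum (fun j : ℕ => ∫ v, h v ^ j / (j.factorial : ℂ) * g v)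
      (∫ v, Complex.exp (h v) * g v) := by
  have hbound (v : ℝ) : HasSum (fun j : ℕ => K ^ j / j.factorial * ‖g v‖) (exp K * ‖g v‖) := by
    rw [exp_eq_exp_ℝ]
    exact (NormedSpace.expSeries_div_hasSum_exp K).mul_right _
  refine hasSum_integral_of_dominated_convergence (fun j v => K ^ j / j.factorial * ‖g v‖)
    (fun j => ?_) (fun j => Eventually.of_forall fun v => ?_)
    (Eventually.of_forall fun v => (hbound v).summable) ?_ (Eventually.of_forall fun v => ?_)
  · exact ((hh.pow j).div_const _).aestronglyMeasurable.mul hg.aestronglyMeasurable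
  · rw [norm_mul, norm_div, norm_pow, Complex.norm_natCast]
    gcongr
    exact hK v
  · simp only [fun v => (hbound v).tsum_eq]
    exact hg.norm.const_mul _
  · rw [Complex.exp_eq_exp_ℂ]
    exact (NormedSpace.expSeries_div_hasSum_exp (h v)).mul_right _

theorem betaLine_add_nat (hc : 0 < c) (p q v : ℝ) (j : ℕ) :
    betaLine c (p + j) q v = betaLine c p q v * (vline c v)⁻¹ ^ j := by
  rw [betaLine, betaLine, show (-((p + j : ℝ) : ℂ)) = -(p : ℂ) - (j : ℂ) by push_cast; ring,
    Complex.cpow_sub _ _ (vline_ne_zero hc v), Complex.cpow_natCast, inv_pow]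
  ring

theorem centralBeta_add_nat_eq_integral {z : ℝ} (hc : 0 < c) (hc1 : c < 1) (hp : 0 < p)
    (hq : 0 < q) (hpq : 1 < p + q) (hy : 0 ≤ y) (hyc : y < c) (j : ℕ) :
    (z ^ j / (j.factorial : ℂ)) * centralBeta (p + j) q y =
      ((y ^ p * (1 - y) ^ q : ℝ) : ℂ) / (2 * π) *
        ∫ v, (((z * y : ℝ) : ℂ) / vline c v) ^ j / (j.factorial : ℂ) *
          (betaLine c p q v * (vline c v - y)⁻¹) := by
  have hj : (0 : ℝ) ≤ j := Nat.cast_nonneg j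
  have hint : ∫ v, (((z * y : ℝ) : ℂ) / vline c v) ^ j / (j.factorial : ℂ) *
      (betaLine c p q v * (vline c v - y)⁻¹) = ((z * y : ℝ) : ℂ) ^ j / (j.factorial : ℂ) *
        ∫ v, betaLine c (p + j) q v * (vline c v - y)⁻¹ := by
    rw [← integral_const_mul]
    congr 1
    ext v
    rw [betaLine_add_nat hc, div_pow, inv_pow]
    ring
  rw [centralBeta_eq_integral hc hc1 (by positivity) hq (by linarith) hy hyc, hint,
    rpow_add_of_nonneg hy hp.le hj, rpow_natCast]
  push_cast
  ring

theorem noncentralBeta_eq_integral {x : ℝ} (hc : 0 < c) (hc1 : c < 1) (hp : 0 < p) (hq : 0 < q)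
    (hpq : 1 < p + q) (hy : 0 ≤ y) (hyc : y < c) :
    (noncentralBeta p q x y : ℂ) = ((exp (-x / 2) * y ^ p * (1 - y) ^ q : ℝ) : ℂ) / (2 * π) *
      ∫ v, Complex.exp ((x / 2 * y : ℝ) / vline c v) *
        (betaLine c p q v * (vline c v - y)⁻¹) := by
  have hinv (v : ℝ) : ‖((x / 2 * y : ℝ) : ℂ) / vline c v‖ ≤ |x / 2 * y| * c⁻¹ := by
    rw [norm_div, Complex.norm_real, norm_eq_abs, div_eq_mul_inv]
    have := norm_inv_vline_sub_le hc.ne v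
    rw [sub_zero, abs_of_pos hc, Complex.ofReal_zero, sub_zero, norm_inv] at this
    gcongr
  have hsum := hasSum_integral_pow_div_factorial_mul
    (h := fun v => ((x / 2 * y : ℝ) : ℂ) / vline c v)
    (integrable_mul_inv_vline_sub (integrable_betaLine hc hc1 hp.le hq.le hpq) hyc.ne)
    (Continuous.div continuous_const (continuous_vline c) (vline_ne_zero hc)) hinv
  rw [← hsum.tsum_eq, noncentralBeta, Complex.ofReal_mul, Complex.ofReal_tsum, mul_assoc,
    Complex.ofReal_mul, mul_div_assoc, mul_assoc]
  congr 1
  rw [← tsum_mul_left]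
  refine tsum_congr fun j => ?_
  rw [← centralBeta_add_nat_eq_integral hc hc1 hp hq hpq hy hyc j]
  push_cast
  rfl

end BetaLine

section MorseCoordinate

open Filter Topology Metric

/-- The point `c` is a saddle point of the function `f`, which is holomorphic on the disc of radius
`ρ` about `c`: its derivative is `(u - c) * K u` with `K` holomorphic and `Re K` bounded below.
The constant `1 / 2` is a normalization. -/
structure IsSaddle (f K : ℂ → ℂ) (c : ℂ) (ρ : ℝ) : Prop where
  pos : 0 < ρ
  hasDerivAt : ∀ u ∈ ball c ρ, HasDerivAt f ((u - c) * K u) u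
  differentiableOn_slope : DifferentiableOn ℂ K (ball c ρ)
  half_le_re : ∀ u ∈ ball c ρ, 1 / 2 ≤ (K u).re

/-- The quotient of `f u - f c` by `(u - c) ^ 2`, extended holomorphically to a critical point `c`
of `f`. -/
noncomputable def secondSlope (f : ℂ → ℂ) (c : ℂ) : ℂ → ℂ :=
  dslope (dslope f c) c

/-- The quotient of `morseCoord f c u` by `u - c`. -/
noncomputable def morseFactor (f : ℂ → ℂ) (c u : ℂ) : ℂ :=
  (2 * secondSlope f c u) ^ (1 / 2 : ℂ)

/-- The coordinate `w` of the holomorphic Morse lemma, in which `f` equals `f c + w ^ 2 / 2`. -/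
noncomputable def morseCoord (f : ℂ → ℂ) (c u : ℂ) : ℂ :=
  (u - c) * morseFactor f c u

theorem half_mul_le_re_segment_slope {f K : ℂ → ℂ} {c z : ℂ} {m : ℝ} (hz : z ≠ 0)
    (hf : ∀ s ∈ Icc (0 : ℝ) 1, HasDerivAt f (s * z * K (c + s * z)) (c + s * z))
    (hK : ∀ s ∈ Icc (0 : ℝ) 1, m ≤ (K (c + s * z)).re) :
    m / 2 ≤ ((f (c + z) - f c) / z ^ 2).re := by
  set F : ℝ → ℝ := fun s => ((f (c + s * z) - f c) / z ^ 2).re - m / 2 * s ^ 2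
  have hF (s : ℝ) (hs : s ∈ Icc (0 : ℝ) 1) :
      HasDerivAt F (s * ((K (c + s * z)).re - m)) s := by
    have hline : HasDerivAt (fun s : ℂ => c + s * z) z s := by
      simpa only [one_mul, id] using ((hasDerivAt_id (s : ℂ)).mul_const z).const_add c
    have hquot := ((((hf s hs).comp (s : ℂ) hline).sub_const (f c)).div_const (z ^ 2))
    convert! hquot.real_of_complex.sub ((hasDerivAt_pow 2 s).const_mul (m / 2)) using 1
    rw [show s * z * K (c + s * z) * z / z ^ 2 = s * K (c + s * z) by field_simp,
      Complex.re_ofReal_mul]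
    ring
  have hmono : MonotoneOn F (Icc 0 1) := by
    refine monotoneOn_of_deriv_nonneg (convex_Icc 0 1)
      (fun s hs => (hF s hs).continuousAt.continuousWithinAt)
      (fun s hs => (hF s (interior_subset hs)).differentiableAt.differentiableWithinAt)
      fun s hs => ?_
    have hs := interior_subset hs
    rw [(hF s hs).deriv]
    exact mul_nonneg hs.1 (sub_nonneg.2 (hK s hs))
  have h01 := hmono (left_mem_Icc.2 zero_le_one) (right_mem_Icc.2 zero_le_one) zero_le_one
  simp only [F, Complex.ofReal_zero, zero_mul, add_zero, sub_self, zero_div, Complex.zero_re,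
    Complex.ofReal_one, one_mul] at h01
  linarith

theorem re_cpow_half_pos {z : ℂ} (hz : 0 < z.re) : 0 < (z ^ (1 / 2 : ℂ)).re := by
  have hz0 : z ≠ 0 := fun h => by simp [h] at hz
  have him : (Complex.log z * (1 / 2)).im = z.arg / 2 := by
    rw [mul_one_div, Complex.div_ofNat_im, Complex.log_im]
  rw [Complex.cpow_def_of_ne_zero hz0, Complex.exp_re, him]
  have := Complex.neg_pi_lt_arg z
  have := Complex.arg_lt_pi_iff.2 (Or.inl hz.le)
  exact mul_pos (exp_pos _) (cos_pos_of_mem_Ioo ⟨by linarith, by linarith⟩)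

theorem morseFactor_sq (f : ℂ → ℂ) (c u : ℂ) : morseFactor f c u ^ 2 = 2 * secondSlope f c u := by
  rw [morseFactor, ← Complex.cpow_nat_mul]
  norm_num

theorem norm_morseFactor_sq (f : ℂ → ℂ) (c u : ℂ) :
    ‖morseFactor f c u‖ ^ 2 = 2 * ‖secondSlope f c u‖ := by
  rw [← norm_pow, morseFactor_sq, norm_mul, Complex.norm_ofNat]

theorem add_mul_sub_mem_ball {c u : ℂ} {ρ s : ℝ} (hu : u ∈ ball c ρ)
    (hs : s ∈ Icc (0 : ℝ) 1) :
    c + s * (u - c) ∈ ball c ρ := by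
  rw [mem_ball_iff_norm] at hu ⊢
  rw [add_sub_cancel_left, norm_mul, Complex.norm_real, norm_of_nonneg hs.1]
  exact (mul_le_of_le_one_left (norm_nonneg _) hs.2).trans_lt hu

theorem mem_of_forall_ne_mem {X : Type*} [TopologicalSpace X] {g : ℂ → X} {s : Set X}
    {c u : ℂ} {ρ : ℝ} (hρ : 0 < ρ) (hg : ContinuousAt g c) (hs : IsClosed s)
    (hmem : ∀ u ∈ ball c ρ, u ≠ c → g u ∈ s) (hu : u ∈ ball c ρ) : g u ∈ s := by
  obtain rfl | hne := eq_or_ne u c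
  · refine hs.mem_of_tendsto (b := 𝓝[≠] u) (hg.tendsto.mono_left nhdsWithin_le_nhds) ?_
    filter_upwards [nhdsWithin_le_nhds (ball_mem_nhds u hρ), self_mem_nhdsWithin] with z hz hne
    exact hmem z hz hne
  · exact hmem u hu hne

namespace IsSaddle

variable {f K : ℂ → ℂ} {c u : ℂ} {ρ M : ℝ}

theorem mem_ball (h : IsSaddle f K c ρ) : c ∈ ball c ρ := mem_ball_self h.pos

theorem slope_ne_zero (h : IsSaddle f K c ρ) (hu : u ∈ ball c ρ) : K u ≠ 0 := fun h0 => by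
  have := h.half_le_re u hu
  rw [h0, Complex.zero_re] at this
  linarith

theorem half_le_norm_slope (h : IsSaddle f K c ρ) (hu : u ∈ ball c ρ) : 1 / 2 ≤ ‖K u‖ :=
  (h.half_le_re u hu).trans (Complex.re_le_norm _)

theorem sq_mul_secondSlope (h : IsSaddle f K c ρ) (u : ℂ) :
    (u - c) ^ 2 * secondSlope f c u = f u - f c := by
  have hzero : dslope f c c = 0 := by
    rw [dslope_same, (h.hasDerivAt c h.mem_ball).deriv, sub_self, zero_mul]
  have hslope := sub_smul_dslope (dslope f c) c u
  rw [hzero, sub_zero, smul_eq_mul] at hslope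
  rw [secondSlope, sq, mul_assoc, hslope, ← smul_eq_mul, sub_smul_dslope]

theorem secondSlope_of_ne (h : IsSaddle f K c ρ) (hne : u ≠ c) :
    secondSlope f c u = (f u - f c) / (u - c) ^ 2 := by
  rw [← h.sq_mul_secondSlope u, mul_div_cancel_left₀ _ (pow_ne_zero 2 (sub_ne_zero.2 hne))]

theorem differentiableOn_secondSlope (h : IsSaddle f K c ρ) :
    DifferentiableOn ℂ (secondSlope f c) (ball c ρ) := by
  have hn : ball c ρ ∈ 𝓝 c := ball_mem_nhds _ h.pos
  exact (Complex.differentiableOn_dslope hn).2 <| (Complex.differentiableOn_dslope hn).2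
    fun u hu => (h.hasDerivAt u hu).differentiableAt.differentiableWithinAt

theorem continuousAt_secondSlope (h : IsSaddle f K c ρ) : ContinuousAt (secondSlope f c) c :=
  (h.differentiableOn_secondSlope.differentiableAt (ball_mem_nhds c h.pos)).continuousAt

theorem quarter_le_re_secondSlope (h : IsSaddle f K c ρ) (hu : u ∈ ball c ρ) :
    1 / 4 ≤ (secondSlope f c u).re := by
  refine mem_of_forall_ne_mem (s := {z : ℂ | 1 / 4 ≤ z.re}) h.pos h.continuousAt_secondSlope
    (isClosed_le continuous_const Complex.continuous_re) (fun u hu hne => ?_) hu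
  have hseg := half_mul_le_re_segment_slope (f := f) (sub_ne_zero.2 hne)
    (fun s hs => by
      simpa only [add_sub_cancel_left] using h.hasDerivAt _ (add_mul_sub_mem_ball hu hs))
    (fun s hs => h.half_le_re _ (add_mul_sub_mem_ball hu hs))
  rw [add_sub_cancel] at hseg
  rw [mem_ofPred_eq, h.secondSlope_of_ne hne]
  linarith

theorem norm_secondSlope_le (h : IsSaddle f K c ρ) (hM : ∀ u ∈ ball c ρ, ‖K u‖ ≤ M)
    (hu : u ∈ ball c ρ) : ‖secondSlope f c u‖ ≤ M := by
  refine mem_of_forall_ne_mem (s := {z : ℂ | ‖z‖ ≤ M}) h.pos h.continuousAt_secondSlope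
    (isClosed_le continuous_norm continuous_const) (fun u hu hne => ?_) hu
  have hseg := (convex_ball c ρ).segment_subset h.mem_ball hu
  have hle := (convex_segment (𝕜 := ℝ) c u).norm_image_sub_le_of_norm_hasDerivWithin_le
    (C := ‖u - c‖ * M) (fun z hz => (h.hasDerivAt z (hseg hz)).hasDerivWithinAt)
    (fun z hz => by
      rw [norm_mul]
      gcongr
      exacts [norm_sub_le_of_mem_segment hz, hM z (hseg hz)])
    (left_mem_segment _ _ _) (right_mem_segment _ _ _)
  have hpos : 0 < ‖u - c‖ := norm_pos_iff.2 (sub_ne_zero.2 hne)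
  rw [mem_ofPred_eq, h.secondSlope_of_ne hne, norm_div, norm_pow, div_le_iff₀ (by positivity)]
  linarith

theorem re_two_mul_secondSlope_pos (h : IsSaddle f K c ρ) (hu : u ∈ ball c ρ) :
    0 < (2 * secondSlope f c u).re := by
  rw [← Complex.ofReal_ofNat, Complex.re_ofReal_mul]
  linarith [h.quarter_le_re_secondSlope hu]

theorem re_morseFactor_pos (h : IsSaddle f K c ρ) (hu : u ∈ ball c ρ) :
    0 < (morseFactor f c u).re :=
  re_cpow_half_pos (h.re_two_mul_secondSlope_pos hu)

theorem half_le_norm_morseFactor (h : IsSaddle f K c ρ) (hu : u ∈ ball c ρ) :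
    1 / 2 ≤ ‖morseFactor f c u‖ := by
  have hre := (h.quarter_le_re_secondSlope hu).trans (Complex.re_le_norm _)
  nlinarith [norm_nonneg (morseFactor f c u), norm_morseFactor_sq f c u]

theorem morseFactor_ne_zero (h : IsSaddle f K c ρ) (hu : u ∈ ball c ρ) : morseFactor f c u ≠ 0 :=
  norm_pos_iff.1 (by linarith [h.half_le_norm_morseFactor hu])

theorem norm_morseFactor_le (h : IsSaddle f K c ρ) (hM : ∀ u ∈ ball c ρ, ‖K u‖ ≤ M)
    (hu : u ∈ ball c ρ) : ‖morseFactor f c u‖ ≤ 2 * M := by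
  have hle := h.norm_secondSlope_le hM hu
  have hhalf := (h.half_le_norm_slope hu).trans (hM u hu)
  nlinarith [norm_nonneg (morseFactor f c u), norm_morseFactor_sq f c u]

theorem differentiableOn_morseFactor (h : IsSaddle f K c ρ) :
    DifferentiableOn ℂ (morseFactor f c) (ball c ρ) :=
  (h.differentiableOn_secondSlope.const_mul 2).cpow_const
    fun _ hu => Or.inl (h.re_two_mul_secondSlope_pos hu)

theorem differentiableOn_morseCoord (h : IsSaddle f K c ρ) :
    DifferentiableOn ℂ (morseCoord f c) (ball c ρ) :=
  (differentiableOn_id.sub_const _).mul h.differentiableOn_morseFactor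

theorem differentiableOn_deriv_morseCoord (h : IsSaddle f K c ρ) :
    DifferentiableOn ℂ (deriv (morseCoord f c)) (ball c ρ) :=
  h.differentiableOn_morseCoord.deriv isOpen_ball

theorem hasDerivAt_morseCoord (h : IsSaddle f K c ρ) (hu : u ∈ ball c ρ) :
    HasDerivAt (morseCoord f c) (deriv (morseCoord f c) u) u :=
  (h.differentiableOn_morseCoord.differentiableAt (isOpen_ball.mem_nhds hu)).hasDerivAt

theorem morseCoord_sq (h : IsSaddle f K c ρ) (u : ℂ) :
    morseCoord f c u ^ 2 / 2 = f u - f c := by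
  rw [morseCoord, mul_pow, morseFactor_sq, ← h.sq_mul_secondSlope]
  ring

theorem morseFactor_mul_deriv_morseCoord (h : IsSaddle f K c ρ) (hu : u ∈ ball c ρ) :
    morseFactor f c u * deriv (morseCoord f c) u = K u := by
  have hc := ball_mem_nhds c h.pos
  have hcont : ContinuousAt
      (fun u => morseFactor f c u * deriv (morseCoord f c) u - K u) c :=
    (((h.differentiableOn_morseFactor.mul h.differentiableOn_deriv_morseCoord).sub
      h.differentiableOn_slope).differentiableAt hc).continuousAt
  refine sub_eq_zero.1 (mem_of_forall_ne_mem h.pos hcont isClosed_singleton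
    (fun u hu hne => sub_eq_zero.2 ?_) hu)
  have hsq : (fun u => (morseCoord f c ^ 2) u / 2) = fun u => f u - f c :=
    funext h.morseCoord_sq
  have hderiv := ((h.hasDerivAt_morseCoord hu).pow 2).div_const 2
  rw [hsq] at hderiv
  have heq := hderiv.unique ((h.hasDerivAt u hu).sub_const (f c))
  apply mul_left_cancel₀ (sub_ne_zero.2 hne)
  rw [← heq, morseCoord]
  norm_num
  ring

theorem norm_deriv_morseCoord_le (h : IsSaddle f K c ρ) (hM : ∀ u ∈ ball c ρ, ‖K u‖ ≤ M)
    (hu : u ∈ ball c ρ) : ‖deriv (morseCoord f c) u‖ ≤ 2 * M := by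
  have hK := hM u hu
  rw [← h.morseFactor_mul_deriv_morseCoord hu, norm_mul] at hK
  nlinarith [h.half_le_norm_morseFactor hu, norm_nonneg (deriv (morseCoord f c) u)]

end IsSaddle

theorem vline_mem_ball {a v ρ : ℝ} (hv : |v| < ρ) : vline a v ∈ ball (a : ℂ) ρ := by
  rwa [mem_ball_iff_norm, vline_sub_self, norm_mul, Complex.norm_I, mul_one, Complex.norm_real]

theorem morseCoord_vline (f : ℂ → ℂ) (a v : ℝ) :
    morseCoord f a (vline a v) = v * (Complex.I * morseFactor f a (vline a v)) := by
  rw [morseCoord, vline_sub_self, mul_assoc]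

theorem im_morseCoord_vline (f : ℂ → ℂ) (a v : ℝ) :
    (morseCoord f a (vline a v)).im = v * (morseFactor f a (vline a v)).re := by
  rw [morseCoord_vline, Complex.im_ofReal_mul, Complex.I_mul_im]

namespace IsSaddle

variable {f K : ℂ → ℂ} {a ρ M v : ℝ}

theorem vline_mem_ball_of_mem (h : IsSaddle f K a ρ) (hv : v ∈ Icc (-(ρ / 2)) (ρ / 2)) :
    vline a v ∈ ball (a : ℂ) ρ :=
  vline_mem_ball ((abs_le.2 hv).trans_lt (half_lt_self h.pos))

theorem hasDerivAt_morseCoord_vline (h : IsSaddle f K a ρ) (hv : v ∈ Icc (-(ρ / 2)) (ρ / 2)) :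
    HasDerivAt (fun v => morseCoord f a (vline a v))
      (deriv (morseCoord f a) (vline a v) * Complex.I) v :=
  (h.hasDerivAt_morseCoord (h.vline_mem_ball_of_mem hv)).comp v (hasDerivAt_vline a v)

theorem isSaddlePath (h : IsSaddle f K a ρ) (hM : ∀ u ∈ ball (a : ℂ) ρ, ‖K u‖ ≤ M) :
    IsSaddlePath (ρ / 2) (2 * M) fun v => morseCoord f a (vline a v) where
  pos := half_pos h.pos
  differentiableAt _ hv := (h.hasDerivAt_morseCoord_vline hv).differentiableAt
  continuousOn_deriv := by
    refine ContinuousOn.congr ?_ fun v hv => (h.hasDerivAt_morseCoord_vline hv).deriv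
    exact (h.differentiableOn_deriv_morseCoord.continuousOn.comp
      (continuous_vline a).continuousOn fun v hv => h.vline_mem_ball_of_mem hv).mul
        continuousOn_const
  re_sq_le v hv := by
    have hre := h.quarter_le_re_secondSlope (h.vline_mem_ball_of_mem hv)
    have hsq : morseCoord f a (vline a v) ^ 2 =
        ((-(2 * v ^ 2) : ℝ) : ℂ) * secondSlope f a (vline a v) := by
      rw [morseCoord_vline, mul_pow, mul_pow, Complex.I_sq, morseFactor_sq]
      push_cast
      ring
    rw [hsq, Complex.re_ofReal_mul]
    nlinarith [sq_nonneg v]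
  norm_le v hv := by
    rw [morseCoord_vline, norm_mul, norm_mul, Complex.norm_I, one_mul, Complex.norm_real,
      norm_eq_abs, mul_comm]
    gcongr
    exact h.norm_morseFactor_le hM (h.vline_mem_ball_of_mem hv)
  norm_deriv_le v hv := by
    rw [(h.hasDerivAt_morseCoord_vline hv).deriv, norm_mul, Complex.norm_I, mul_one]
    exact h.norm_deriv_morseCoord_le hM (h.vline_mem_ball_of_mem hv)
  im_pos := by
    have hρ := half_pos h.pos
    rw [im_morseCoord_vline]
    exact mul_pos hρ (h.re_morseFactor_pos (h.vline_mem_ball_of_mem ⟨by linarith, le_rfl⟩))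
  im_neg := by
    have hρ := half_pos h.pos
    rw [im_morseCoord_vline]
    exact mul_neg_of_neg_of_pos (neg_lt_zero.2 hρ)
      (h.re_morseFactor_pos (h.vline_mem_ball_of_mem ⟨le_rfl, by linarith⟩))

end IsSaddle

/-- The functions obtained from `G` by repeatedly subtracting the value at `c` and dividing by
`(u - c) * S u`. Their values at `c` are the coefficients of the expansion of `G` in powers of
`(u - c) * S u`. -/
noncomputable def reducedSeq (S G : ℂ → ℂ) (c : ℂ) : ℕ → ℂ → ℂ
  | 0 => G
  | k + 1 => fun u => dslope (reducedSeq S G c k) c u / S u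

theorem differentiableOn_reducedSeq {S G : ℂ → ℂ} {c : ℂ} {ρ : ℝ} (hρ : 0 < ρ)
    (hS : DifferentiableOn ℂ S (ball c ρ)) (hG : DifferentiableOn ℂ G (ball c ρ))
    (hS0 : ∀ u ∈ ball c ρ, S u ≠ 0) (k : ℕ) :
    DifferentiableOn ℂ (reducedSeq S G c k) (ball c ρ) := by
  induction k with
  | zero => exact hG
  | succ k ih => exact ((Complex.differentiableOn_dslope (ball_mem_nhds c hρ)).2 ih).div hS hS0

theorem norm_reducedSeq_le {S G : ℂ → ℂ} {c : ℂ} {ρ M : ℝ} (hρ : 0 < ρ)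
    (hS : DifferentiableOn ℂ S (ball c ρ)) (hG : DifferentiableOn ℂ G (ball c ρ))
    (hS0 : ∀ u ∈ ball c ρ, 1 / 2 ≤ ‖S u‖) (hM : ∀ u ∈ ball c ρ, ‖G u‖ ≤ M) (k : ℕ) :
    ∀ u ∈ ball c ρ, ‖reducedSeq S G c k u‖ ≤ M * (4 / ρ) ^ k := by
  have hS0' : ∀ u ∈ ball c ρ, S u ≠ 0 := fun u hu => norm_pos_iff.1 (by linarith [hS0 u hu])
  have hM0 : 0 ≤ M := (norm_nonneg _).trans (hM c (mem_ball_self hρ))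
  induction k with
  | zero => simpa only [pow_zero, mul_one, reducedSeq] using hM
  | succ k ih =>
    intro u hu
    have hmaps : MapsTo (reducedSeq S G c k) (ball c ρ)
        (closedBall (reducedSeq S G c k c) (2 * (M * (4 / ρ) ^ k))) := fun z hz => by
      rw [mem_closedBall_iff_norm]
      exact (norm_sub_le _ _).trans (by linarith [ih z hz, ih c (mem_ball_self hρ)])
    have hdslope := Complex.norm_dslope_le_div_of_mapsTo_ball
      (differentiableOn_reducedSeq hρ hS hG hS0' k) hmaps hu
    calc ‖reducedSeq S G c (k + 1) u‖
        = ‖dslope (reducedSeq S G c k) c u‖ / ‖S u‖ := norm_div _ _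
      _ ≤ 2 * (M * (4 / ρ) ^ k) / ρ / (1 / 2) := by
          gcongr
          exact hS0 u hu
      _ = M * (4 / ρ) ^ (k + 1) := by
          rw [pow_succ]
          ring

theorem eq_sum_reducedSeq_add {S : ℂ → ℂ} {u : ℂ} (hS0 : S u ≠ 0) (G : ℂ → ℂ) (c : ℂ) (n : ℕ) :
    G u = ∑ k ∈ Finset.range n, reducedSeq S G c k c * ((u - c) * S u) ^ k +
      ((u - c) * S u) ^ n * reducedSeq S G c n u := by
  induction n with
  | zero => simp [reducedSeq]
  | succ n ih =>
    have hstep : reducedSeq S G c n u = reducedSeq S G c n c +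
        ((u - c) * S u) * reducedSeq S G c (n + 1) u := by
      have := sub_smul_dslope (reducedSeq S G c n) c u
      rw [smul_eq_mul] at this
      rw [reducedSeq, mul_assoc, mul_div_cancel₀ _ hS0, this]
      ring
    conv_lhs => rw [ih, hstep]
    rw [Finset.sum_range_succ]
    ring

end MorseCoordinate

section SaddleIntegral

open Metric

/-- The coefficients of `g / (morseCoord f c)'` in powers of the Morse coordinate at `c`. -/
noncomputable def saddleCoeff (f : ℂ → ℂ) (c : ℂ) (g : ℂ → ℂ) (k : ℕ) : ℂ :=
  reducedSeq (morseFactor f c) (fun u => g u / deriv (morseCoord f c) u) c k c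

namespace IsSaddle

variable {f K g : ℂ → ℂ} {c u : ℂ} {ρ M A : ℝ}

theorem deriv_morseCoord_ne_zero (h : IsSaddle f K c ρ) (hu : u ∈ ball c ρ) :
    deriv (morseCoord f c) u ≠ 0 :=
  right_ne_zero_of_mul (h.morseFactor_mul_deriv_morseCoord hu ▸ h.slope_ne_zero hu)

theorem norm_inv_deriv_morseCoord_le (h : IsSaddle f K c ρ) (hM : ∀ u ∈ ball c ρ, ‖K u‖ ≤ M)
    (hu : u ∈ ball c ρ) : ‖(deriv (morseCoord f c) u)⁻¹‖ ≤ 4 * M := by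
  have hinv : (deriv (morseCoord f c) u)⁻¹ = morseFactor f c u / K u := by
    rw [← h.morseFactor_mul_deriv_morseCoord hu, div_mul_cancel_left₀ (h.morseFactor_ne_zero hu)]
  have hK := h.half_le_norm_slope hu
  have hfactor := h.norm_morseFactor_le hM hu
  rw [hinv, norm_div, div_le_iff₀ (by linarith)]
  nlinarith [norm_nonneg (morseFactor f c u)]

theorem differentiableOn_div_deriv_morseCoord (h : IsSaddle f K c ρ)
    (hg : DifferentiableOn ℂ g (ball c ρ)) :
    DifferentiableOn ℂ (fun u => g u / deriv (morseCoord f c) u) (ball c ρ) :=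
  hg.div h.differentiableOn_deriv_morseCoord fun _ hu => h.deriv_morseCoord_ne_zero hu

theorem norm_div_deriv_morseCoord_le (h : IsSaddle f K c ρ) (hM : ∀ u ∈ ball c ρ, ‖K u‖ ≤ M)
    (hA : ∀ u ∈ ball c ρ, ‖g u‖ ≤ A) (hu : u ∈ ball c ρ) :
    ‖g u / deriv (morseCoord f c) u‖ ≤ A * (4 * M) := by
  rw [div_eq_mul_inv, norm_mul]
  exact mul_le_mul (hA u hu) (h.norm_inv_deriv_morseCoord_le hM hu) (norm_nonneg _)
    ((norm_nonneg _).trans (hA u hu))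

theorem eq_sum_saddleCoeff_add (h : IsSaddle f K c ρ) (g : ℂ → ℂ) (hu : u ∈ ball c ρ) (n : ℕ) :
    g u = (∑ k ∈ Finset.range n, saddleCoeff f c g k * morseCoord f c u ^ k +
      morseCoord f c u ^ n *
        reducedSeq (morseFactor f c) (fun u => g u / deriv (morseCoord f c) u) c n u) *
      deriv (morseCoord f c) u := by
  rw [← div_eq_iff (h.deriv_morseCoord_ne_zero hu)]
  exact eq_sum_reducedSeq_add (h.morseFactor_ne_zero hu)
    (fun u => g u / deriv (morseCoord f c) u) c n

end IsSaddle

theorem IsSaddle.I_mul_integral_eq_pathIntegral {f K : ℂ → ℂ} {a ρ : ℝ} (h : IsSaddle f K a ρ)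
    (g : ℂ → ℂ) (r : ℝ) (n : ℕ) :
    Complex.I * ∫ v in (-(ρ / 2))..(ρ / 2),
        Complex.exp (r * (f (vline a v) - f a)) * g (vline a v) =
      pathIntegral (ρ / 2) r (fun v => morseCoord f a (vline a v)) fun v =>
        ∑ k ∈ Finset.range n, saddleCoeff f a g k * morseCoord f a (vline a v) ^ k +
          morseCoord f a (vline a v) ^ n * reducedSeq (morseFactor f a)
            (fun u => g u / deriv (morseCoord f a) u) a n (vline a v) := by
  rw [← intervalIntegral.integral_const_mul, pathIntegral]
  refine intervalIntegral.integral_congr fun v hv => ?_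
  rw [uIcc_of_le (by linarith [h.pos])] at hv
  have hg := h.eq_sum_saddleCoeff_add g (h.vline_mem_ball_of_mem hv) n
  rw [(h.hasDerivAt_morseCoord_vline hv).deriv, ← h.morseCoord_sq, mul_div_assoc, hg]
  ring

theorem exists_norm_saddle_integral_sub_le {ρ M : ℝ} (hρ : 0 < ρ) (hM : 0 ≤ M) (N : ℕ) :
    ∃ C, 0 ≤ C ∧ ∀ r : ℝ, 1 ≤ r → ∀ (f K g : ℂ → ℂ) (a A : ℝ), IsSaddle f K a ρ →
      (∀ u ∈ ball (a : ℂ) ρ, ‖K u‖ ≤ M) → DifferentiableOn ℂ g (ball a ρ) →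
      (∀ u ∈ ball (a : ℂ) ρ, ‖g u‖ ≤ A) →
      ‖(∫ v in (-(ρ / 2))..(ρ / 2), Complex.exp (r * (f (vline a v) - f a)) * g (vline a v)) -
        evenGaussSum r (saddleCoeff f a g) N‖ ≤ C * A / (√r * r ^ N) := by
  obtain ⟨C, hC0, hC⟩ := exists_norm_saddlePath_integral_sub_le (half_pos hρ)
    (mul_nonneg zero_le_two hM) N
  refine ⟨C * (4 * M * (4 / ρ + 1) ^ (2 * N)), by positivity, fun r hr f K g a A h hK hg hA => ?_⟩
  have hA0 : 0 ≤ A := (norm_nonneg _).trans (hA a h.mem_ball)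
  have hdiff := differentiableOn_reducedSeq h.pos h.differentiableOn_morseFactor
    (h.differentiableOn_div_deriv_morseCoord hg) (fun u hu => h.morseFactor_ne_zero hu) (2 * N)
  have hbound (k : ℕ) (hk : k ≤ 2 * N) (u : ℂ) (hu : u ∈ ball (a : ℂ) ρ) :
      ‖reducedSeq (morseFactor f a) (fun u => g u / deriv (morseCoord f a) u) a k u‖ ≤
        A * (4 * M) * (4 / ρ + 1) ^ (2 * N) := by
    refine (norm_reducedSeq_le h.pos h.differentiableOn_morseFactor
      (h.differentiableOn_div_deriv_morseCoord hg) (fun u hu => h.half_le_norm_morseFactor hu)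
      (fun u hu => h.norm_div_deriv_morseCoord_le hK hA hu) k u hu).trans ?_
    gcongr
    exact (pow_le_pow_left₀ (by positivity) (by linarith) k).trans
      (pow_le_pow_right₀ (by linarith [div_pos four_pos hρ]) hk)
  have hpath := hC r hr _ (h.isSaddlePath hK) _ (saddleCoeff f a g) _
    (fun k hk => hbound k hk.le a h.mem_ball)
    (hdiff.continuousOn.comp (continuous_vline a).continuousOn
      fun v hv => h.vline_mem_ball_of_mem hv)
    (fun v hv => hbound (2 * N) le_rfl _ (h.vline_mem_ball_of_mem hv))
  simp only [Function.comp_apply] at hpath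
  rw [← h.I_mul_integral_eq_pathIntegral, sum_range_two_mul_gaussMoment, ← mul_sub, norm_mul,
    Complex.norm_I, one_mul] at hpath
  exact hpath.trans_eq (by ring)

end SaddleIntegral

section InvPhase

open Metric MeasureTheory

theorem half_le_re_inv_mul {z : ℂ} {a : ℝ} (ha : 0 < a) (ha1 : a ≤ 1) (hz : ‖z - a‖ ≤ a / 8) :
    1 / 2 ≤ ((z * a)⁻¹).re := by
  obtain ⟨hre, hre'⟩ := abs_le.1 ((Complex.abs_re_le_norm _).trans hz)
  obtain ⟨him, him'⟩ := abs_le.1 ((Complex.abs_im_le_norm _).trans hz)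
  simp only [Complex.sub_re, Complex.ofReal_re, Complex.sub_im, Complex.ofReal_im, sub_zero]
    at hre hre' him him'
  have hsq : 0 < Complex.normSq z := Complex.normSq_pos.2 fun h0 => by
    rw [h0, Complex.zero_re] at hre
    linarith
  have hsq' : Complex.normSq z ≤ 82 / 64 * a ^ 2 := by
    rw [Complex.normSq_apply]
    nlinarith
  rw [mul_comm, mul_inv, ← Complex.ofReal_inv, Complex.re_ofReal_mul, Complex.inv_re,
    ← div_eq_inv_mul, div_div, le_div_iff₀ (by positivity)]
  nlinarith [mul_le_mul_of_nonneg_left hsq' ha.le, mul_le_of_le_one_left (sq_nonneg a) ha1]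

theorem re_add_div_sq_nonneg {z : ℂ} {a : ℝ} (ha : 0 < a) (hz : ‖z - a‖ ≤ a / 8) :
    0 ≤ ((z + a) / (z ^ 2 * a ^ 2)).re := by
  obtain ⟨hre, -⟩ := abs_le.1 ((Complex.abs_re_le_norm _).trans hz)
  obtain ⟨him, him'⟩ := abs_le.1 ((Complex.abs_im_le_norm _).trans hz)
  simp only [Complex.sub_re, Complex.ofReal_re, Complex.sub_im, Complex.ofReal_im, sub_zero]
    at hre him him'
  have hz0 : z ≠ 0 := fun h0 => by
    rw [h0, Complex.zero_re] at hre
    linarith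
  have ha0 : (a : ℂ) ≠ 0 := by exact_mod_cast ha.ne'
  have hsplit : (z + a) / (z ^ 2 * a ^ 2) =
      ((1 / a ^ 2 : ℝ) : ℂ) * z⁻¹ + ((1 / a : ℝ) : ℂ) * (z ^ 2)⁻¹ := by
    push_cast
    field_simp
  have hz_re : 0 ≤ z.re := by linarith
  have hsq_re : 0 ≤ (z ^ 2).re := by
    rw [sq, Complex.mul_re]
    nlinarith
  rw [hsplit, Complex.add_re, Complex.re_ofReal_mul, Complex.re_ofReal_mul, Complex.inv_re,
    Complex.inv_re]
  have := Complex.normSq_nonneg z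
  have := Complex.normSq_nonneg (z ^ 2)
  positivity

theorem norm_inv_le_two_div {z : ℂ} {a b : ℝ} (hb : 0 < b) (hba : b ≤ a) (hz : ‖z - a‖ ≤ a / 8) :
    ‖z⁻¹‖ ≤ 2 / b := by
  have ha : 0 < a := hb.trans_le hba
  have hnorm := norm_sub_norm_le (a : ℂ) z
  rw [norm_sub_rev, Complex.norm_real, norm_of_nonneg ha.le] at hnorm
  rw [norm_inv, ← one_div, div_le_div_iff₀ (by linarith) hb]
  linarith

theorem norm_inv_ofReal_le {a b : ℝ} (hb : 0 < b) (hba : b ≤ a) : ‖(a : ℂ)⁻¹‖ ≤ 1 / b := by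
  rw [norm_inv, Complex.norm_real, norm_of_nonneg (hb.le.trans hba), one_div]
  exact inv_anti₀ hb hba

theorem norm_inv_mul_le {z : ℂ} {a b : ℝ} (hb : 0 < b) (hba : b ≤ a) (hz : ‖z - a‖ ≤ a / 8) :
    ‖(z * a)⁻¹‖ ≤ 2 / b ^ 2 := by
  rw [mul_inv, norm_mul]
  calc ‖z⁻¹‖ * ‖(a : ℂ)⁻¹‖ ≤ 2 / b * (1 / b) := by
        gcongr
        exacts [norm_inv_le_two_div hb hba hz, norm_inv_ofReal_le hb hba]
    _ = 2 / b ^ 2 := by ring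

theorem norm_add_div_sq_le {z : ℂ} {a b : ℝ} (hb : 0 < b) (hba : b ≤ a) (hz : ‖z - a‖ ≤ a / 8) :
    ‖(z + a) / (z ^ 2 * a ^ 2)‖ ≤ 6 / b ^ 3 := by
  have ha0 : (a : ℂ) ≠ 0 := by exact_mod_cast (hb.trans_le hba).ne'
  have hz0 : z ≠ 0 := by
    rintro rfl
    rw [zero_sub, norm_neg, Complex.norm_real, norm_of_nonneg (hb.le.trans hba)] at hz
    linarith
  have hsplit : (z + a) / (z ^ 2 * a ^ 2) = (z * a)⁻¹ * (z⁻¹ + (a : ℂ)⁻¹) := by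
    field_simp
    ring
  rw [hsplit, norm_mul]
  calc ‖(z * a)⁻¹‖ * ‖z⁻¹ + (a : ℂ)⁻¹‖ ≤ 2 / b ^ 2 * (2 / b + 1 / b) := by
        gcongr
        exacts [norm_inv_mul_le hb hba hz, (norm_add_le _ _).trans
          (add_le_add (norm_inv_le_two_div hb hba hz) (norm_inv_ofReal_le hb hba))]
    _ = 6 / b ^ 3 := by ring

/-- The phase function `phase θ ξ` in the variable `u = 1 / t`, with `α = cos² θ` and
`β = sin² θ`. -/
noncomputable def invPhase (α β ξ : ℝ) (u : ℂ) : ℂ :=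
  -α * Complex.log u - β * Complex.log (1 - u) + ξ / u

/-- The quotient of the derivative of `invPhase α β ξ` at `u` by `u - a`, for a critical point
`a`. -/
noncomputable def invPhaseSlope (α β ξ a : ℝ) (u : ℂ) : ℂ :=
  α * (u * a)⁻¹ + β * ((1 - u) * (1 - a : ℝ))⁻¹ + ξ * ((u + a) / (u ^ 2 * a ^ 2))

/-- The point `a` of `(0, 1)` is a critical point of `invPhase α β ξ`, for a normalized choice of
the weights `α` and `β`. -/
structure IsInvPhaseSaddle (α β ξ a : ℝ) : Prop where
  α_nonneg : 0 ≤ α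
  β_nonneg : 0 ≤ β
  add_eq_one : α + β = 1
  ξ_nonneg : 0 ≤ ξ
  pos : 0 < a
  lt_one : a < 1
  eq_zero : -α / a + β / (1 - a) - ξ / a ^ 2 = 0

theorem norm_one_sub_sub_one_sub (u : ℂ) (a : ℝ) : ‖(1 - u) - (1 - a : ℝ)‖ = ‖u - a‖ := by
  rw [Complex.ofReal_sub, Complex.ofReal_one, sub_sub_sub_cancel_left, norm_sub_rev]

theorem mem_slitPlane_of_norm_sub_lt {u : ℂ} {a : ℝ} (ha : ‖u - a‖ < a)
    (ha1 : ‖u - a‖ < 1 - a) : u ∈ Complex.slitPlane ∧ 1 - u ∈ Complex.slitPlane := by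
  have hre := (Complex.abs_re_le_norm (u - a)).trans_lt (lt_min ha ha1)
  rw [lt_min_iff, abs_lt, abs_lt, Complex.sub_re, Complex.ofReal_re] at hre
  refine ⟨Or.inl (by linarith), Or.inl ?_⟩
  rw [Complex.sub_re, Complex.one_re]
  linarith

theorem re_invPhase (α β ξ : ℝ) (u : ℂ) : (invPhase α β ξ u).re =
    -α * log ‖u‖ - β * log ‖1 - u‖ + ξ * (u.re / Complex.normSq u) := by
  rw [invPhase, Complex.add_re, Complex.sub_re, ← Complex.ofReal_neg, Complex.re_ofReal_mul,
    Complex.re_ofReal_mul, div_eq_mul_inv, Complex.re_ofReal_mul, Complex.inv_re,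
    Complex.log_re, Complex.log_re]

theorem log_add_half_log_one_add_sq_le {b : ℝ} (hb : 0 < b) (hb1 : b ≤ 1) (v : ℝ) :
    log b + log (1 + v ^ 2) / 2 ≤ log √(b ^ 2 + v ^ 2) := by
  calc log b + log (1 + v ^ 2) / 2 = log √(b ^ 2 * (1 + v ^ 2)) := by
        rw [log_sqrt (by positivity), log_mul (by positivity) (by positivity), log_pow]
        push_cast
        ring
    _ ≤ log √(b ^ 2 + v ^ 2) := by
        gcongr
        nlinarith [mul_le_of_le_one_left (sq_nonneg v) (pow_le_one₀ hb.le hb1 (n := 2))]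

namespace IsInvPhaseSaddle

variable {α β ξ a b X ρ : ℝ} {u : ℂ}

theorem hasDerivAt_invPhase (h : IsInvPhaseSaddle α β ξ a) (hu : u ∈ Complex.slitPlane)
    (hu1 : 1 - u ∈ Complex.slitPlane) :
    HasDerivAt (invPhase α β ξ) ((u - a) * invPhaseSlope α β ξ a u) u := by
  have hu0 := Complex.slitPlane_ne_zero hu
  have hu10 := Complex.slitPlane_ne_zero hu1
  have ha0 : (a : ℂ) ≠ 0 := by exact_mod_cast h.pos.ne'
  have ha10 : (1 - a : ℂ) ≠ 0 := by exact_mod_cast (sub_pos.2 h.lt_one).ne'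
  have hcrit : (-α / a + β / (1 - a) - ξ / a ^ 2 : ℂ) = 0 := by exact_mod_cast h.eq_zero
  have hslope : (u - a) * invPhaseSlope α β ξ a u = -α * u⁻¹ - β * (-1 / (1 - u)) +
      ξ * -(u ^ 2)⁻¹ - (-α / a + β / (1 - a) - ξ / a ^ 2 : ℂ) := by
    rw [invPhaseSlope]
    push_cast
    field_simp
    ring
  rw [hslope, hcrit, sub_zero]
  exact (((Complex.hasDerivAt_log hu).const_mul (-α : ℂ)).sub
    ((((hasDerivAt_id u).const_sub 1).clog hu1).const_mul (β : ℂ))).add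
    ((hasDerivAt_inv hu0).const_mul (ξ : ℂ))

theorem half_le_re_invPhaseSlope (h : IsInvPhaseSaddle α β ξ a) (ha : ‖u - a‖ ≤ a / 8)
    (ha1 : ‖u - a‖ ≤ (1 - a) / 8) : 1 / 2 ≤ (invPhaseSlope α β ξ a u).re := by
  rw [← norm_one_sub_sub_one_sub] at ha1
  rw [invPhaseSlope, Complex.add_re, Complex.add_re, Complex.re_ofReal_mul, Complex.re_ofReal_mul,
    Complex.re_ofReal_mul]
  have hα := mul_le_mul_of_nonneg_left (half_le_re_inv_mul h.pos h.lt_one.le ha) h.α_nonneg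
  have hβ := mul_le_mul_of_nonneg_left (half_le_re_inv_mul (sub_pos.2 h.lt_one)
    (sub_le_self 1 h.pos.le) ha1) h.β_nonneg
  have hξ := mul_nonneg h.ξ_nonneg (re_add_div_sq_nonneg h.pos ha)
  linear_combination hα + hβ + hξ - 1 / 2 * h.add_eq_one

theorem norm_invPhaseSlope_le (h : IsInvPhaseSaddle α β ξ a) (hb : 0 < b) (hba : b ≤ a)
    (hba1 : b ≤ 1 - a) (hX : ξ ≤ X) (hu : ‖u - a‖ ≤ b / 8) :
    ‖invPhaseSlope α β ξ a u‖ ≤ 2 / b ^ 2 + X * (6 / b ^ 3) := by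
  have hα := mul_le_mul_of_nonneg_left
    (norm_inv_mul_le (z := u) hb hba (by linarith)) h.α_nonneg
  have hβ := mul_le_mul_of_nonneg_left (norm_inv_mul_le (z := 1 - u) hb hba1
    (by linarith [norm_one_sub_sub_one_sub u a])) h.β_nonneg
  have hξ := mul_le_mul_of_nonneg_left
    (norm_add_div_sq_le (z := u) hb hba (by linarith)) h.ξ_nonneg
  have hX' := mul_le_mul_of_nonneg_right hX (by positivity : 0 ≤ 6 / b ^ 3)
  refine norm_add₃_le.trans ?_
  rw [norm_mul, norm_mul, norm_mul, Complex.norm_real, Complex.norm_real, Complex.norm_real,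
    norm_of_nonneg h.α_nonneg, norm_of_nonneg h.β_nonneg, norm_of_nonneg h.ξ_nonneg]
  linear_combination hα + hβ + hξ + hX' + 2 / b ^ 2 * h.add_eq_one

theorem differentiableOn_invPhaseSlope (h : IsInvPhaseSaddle α β ξ a) :
    DifferentiableOn ℂ (invPhaseSlope α β ξ a) ({0, 1} : Set ℂ)ᶜ := fun u hu => by
  have ha0 : (a : ℂ) ≠ 0 := by exact_mod_cast h.pos.ne'
  have ha10 : ((1 - a : ℝ) : ℂ) ≠ 0 := by exact_mod_cast (sub_pos.2 h.lt_one).ne'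
  rw [mem_compl_iff, mem_insert_iff, mem_singleton_iff, not_or] at hu
  have hu0 : u ≠ 0 := hu.1
  have hu10 : 1 - u ≠ 0 := sub_ne_zero.2 (Ne.symm hu.2)
  refine DifferentiableAt.differentiableWithinAt (.add (.add ?_ ?_) ?_)
  · exact ((differentiableAt_id.mul_const _).inv (mul_ne_zero hu0 ha0)).const_mul _
  · exact (((differentiableAt_id.const_sub _).mul_const _).inv (mul_ne_zero hu10 ha10)).const_mul _
  · exact (DifferentiableAt.fun_div (c := fun u : ℂ => u + a) (d := fun u : ℂ => u ^ 2 * a ^ 2)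
      (by fun_prop) (by fun_prop) (mul_ne_zero (pow_ne_zero 2 hu0) (pow_ne_zero 2 ha0))).const_mul _

theorem isSaddle (h : IsInvPhaseSaddle α β ξ a) (hρ : 0 < ρ) (hρa : 8 * ρ ≤ a)
    (hρa1 : 8 * ρ ≤ 1 - a) : IsSaddle (invPhase α β ξ) (invPhaseSlope α β ξ a) a ρ := by
  have hslit (u : ℂ) (hu : u ∈ ball (a : ℂ) ρ) :
      u ∈ Complex.slitPlane ∧ 1 - u ∈ Complex.slitPlane := by
    rw [mem_ball_iff_norm] at hu
    exact mem_slitPlane_of_norm_sub_lt (a := a) (by linarith) (by linarith)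
  refine ⟨hρ, fun u hu => h.hasDerivAt_invPhase (hslit u hu).1 (hslit u hu).2,
    h.differentiableOn_invPhaseSlope.mono fun u hu => ?_, fun u hu => ?_⟩
  · rw [mem_compl_iff, mem_insert_iff, mem_singleton_iff, not_or]
    exact ⟨Complex.slitPlane_ne_zero (hslit u hu).1,
      Ne.symm (sub_ne_zero.1 (Complex.slitPlane_ne_zero (hslit u hu).2))⟩
  · rw [mem_ball_iff_norm] at hu
    exact h.half_le_re_invPhaseSlope (by linarith) (by linarith)

theorem re_invPhase_vline_sub_le (h : IsInvPhaseSaddle α β ξ a) (v : ℝ) :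
    (invPhase α β ξ (vline a v) - invPhase α β ξ a).re ≤ -(log (1 + v ^ 2) / 2) := by
  have ha1 : 0 < 1 - a := sub_pos.2 h.lt_one
  have hnorm : ‖(1 : ℂ) - a‖ = 1 - a := by
    rw [← Complex.ofReal_one, ← Complex.ofReal_sub, Complex.norm_real, norm_of_nonneg ha1.le]
  have hdiv : a / (a * a + v * v) ≤ a / (a * a) :=
    div_le_div_of_nonneg_left h.pos.le (mul_pos h.pos h.pos) (by nlinarith)
  rw [Complex.sub_re, re_invPhase, re_invPhase, norm_vline, norm_one_sub_vline, hnorm,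
    Complex.norm_real, norm_of_nonneg h.pos.le, Complex.normSq_apply, Complex.normSq_apply,
    vline_re, vline_im, Complex.ofReal_re, Complex.ofReal_im, mul_zero, add_zero]
  have hα := mul_le_mul_of_nonneg_left
    (log_add_half_log_one_add_sq_le h.pos h.lt_one.le v) h.α_nonneg
  have hβ := mul_le_mul_of_nonneg_left
    (log_add_half_log_one_add_sq_le ha1 (by linarith [h.pos]) v) h.β_nonneg
  have hξ := mul_le_mul_of_nonneg_left hdiv h.ξ_nonneg
  linear_combination hα + hβ + hξ - log (1 + v ^ 2) / 2 * h.add_eq_one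

theorem norm_exp_invPhase_vline_le (h : IsInvPhaseSaddle α β ξ a) {r : ℝ} (hr : 0 ≤ r) (v : ℝ) :
    ‖Complex.exp (r * (invPhase α β ξ (vline a v) - invPhase α β ξ a))‖ ≤
      exp (-(r * (log (1 + v ^ 2) / 2))) := by
  rw [Complex.norm_exp, exp_le_exp, Complex.re_ofReal_mul, ← mul_neg]
  exact mul_le_mul_of_nonneg_left (h.re_invPhase_vline_sub_le v) hr

theorem continuous_invPhase_vline (h : IsInvPhaseSaddle α β ξ a) :
    Continuous fun v => invPhase α β ξ (vline a v) :=
  continuous_iff_continuousAt.2 fun v => (h.hasDerivAt_invPhase (vline_mem_slitPlane h.pos v)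
    (one_sub_vline_mem_slitPlane h.lt_one v)).continuousAt.comp (continuous_vline a).continuousAt

end IsInvPhaseSaddle

theorem exp_neg_half_mul_log_le {r ρ v : ℝ} (hr : 2 ≤ r) (hv : ρ ^ 2 ≤ v ^ 2) :
    exp (-(r * (log (1 + v ^ 2) / 2))) ≤
      (1 + ρ ^ 2) * exp (-(r * (log (1 + ρ ^ 2) / 2))) * (1 + v ^ 2)⁻¹ := by
  have hlog : log (1 + ρ ^ 2) ≤ log (1 + v ^ 2) := log_le_log (by positivity) (by linarith)
  calc exp (-(r * (log (1 + v ^ 2) / 2)))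
      ≤ exp (log (1 + ρ ^ 2) + -(r * (log (1 + ρ ^ 2) / 2)) + -log (1 + v ^ 2)) := by
        gcongr
        nlinarith
    _ = _ := by
        rw [exp_add, exp_add, exp_neg (log (1 + v ^ 2)), exp_log (by positivity),
          exp_log (by positivity)]

theorem norm_integral_sub_intervalIntegral_le {F : ℝ → ℂ} {r A ρ : ℝ} (hr : 2 ≤ r) (hρ : 0 ≤ ρ)
    (hF : Continuous F) (hle : ∀ v, ‖F v‖ ≤ exp (-(r * (log (1 + v ^ 2) / 2))) * A) :
    ‖(∫ v, F v) - ∫ v in (-ρ)..ρ, F v‖ ≤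
      π * (1 + ρ ^ 2) * A * exp (-(r * (log (1 + ρ ^ 2) / 2))) := by
  have hA : 0 ≤ A := nonneg_of_mul_nonneg_right ((norm_nonneg _).trans (hle 0)) (exp_pos _)
  set B := (1 + ρ ^ 2) * exp (-(r * (log (1 + ρ ^ 2) / 2))) * A with hB
  have hB0 : 0 ≤ B := by rw [hB]; positivity
  have hbound {σ v : ℝ} (hv : σ ^ 2 ≤ v ^ 2) :
      ‖F v‖ ≤ (1 + σ ^ 2) * exp (-(r * (log (1 + σ ^ 2) / 2))) * A * (1 + v ^ 2)⁻¹ := by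
    refine (hle v).trans ?_
    rw [mul_right_comm]
    gcongr
    exact exp_neg_half_mul_log_le hr hv
  have hF_int : Integrable F := by
    refine (integrable_inv_one_add_sq.const_mul A).mono' hF.aestronglyMeasurable
      (.of_forall fun v => (hbound (σ := 0) (by simpa using sq_nonneg v)).trans_eq ?_)
    simp
  have hsplit := integral_add_compl (measurableSet_Ioc (a := -ρ) (b := ρ)) hF_int
  have hB_int : Integrable fun v : ℝ => B * (1 + v ^ 2)⁻¹ := integrable_inv_one_add_sq.const_mul B
  rw [intervalIntegral.integral_of_le (by linarith), ← hsplit, add_sub_cancel_left]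
  calc ‖∫ v in (Ioc (-ρ) ρ)ᶜ, F v‖ ≤ ∫ v in (Ioc (-ρ) ρ)ᶜ, B * (1 + v ^ 2)⁻¹ := by
        apply norm_integral_le_of_norm_le hB_int.integrableOn
        filter_upwards [ae_restrict_mem measurableSet_Ioc.compl] with v hv
        refine hbound (sq_le_sq.2 ?_)
        rw [abs_of_nonneg hρ]
        exact not_lt.1 fun hlt => hv (Ioo_subset_Ioc_self (abs_lt.1 hlt))
    _ ≤ ∫ v : ℝ, B * (1 + v ^ 2)⁻¹ :=
        setIntegral_le_integral hB_int (.of_forall fun v => mul_nonneg hB0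
          (inv_nonneg.2 (add_nonneg zero_le_one (sq_nonneg v))))
    _ = _ := by
        rw [integral_const_mul, integral_univ_inv_one_add_sq, hB]
        ring

theorem IsInvPhaseSaddle.norm_invPhase_tail_le {α β ξ a y b r ρ : ℝ}
    (h : IsInvPhaseSaddle α β ξ a) (hb : 0 < b) (hy : b ≤ a - y) (hr : 2 ≤ r) (hρ : 0 < ρ)
    (N : ℕ) :
    ‖(∫ v, Complex.exp (r * (invPhase α β ξ (vline a v) - invPhase α β ξ a)) *
        (vline a v - y)⁻¹) -
      ∫ v in (-ρ)..ρ, Complex.exp (r * (invPhase α β ξ (vline a v) - invPhase α β ξ a)) *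
        (vline a v - y)⁻¹‖ ≤
      π * (1 + ρ ^ 2) * b⁻¹ * ((N + 1).factorial / (log (1 + ρ ^ 2) / 2) ^ (N + 1)) /
        (√r * r ^ N) := by
  have hya : y ≠ a := by linarith
  have hη : 0 < log (1 + ρ ^ 2) / 2 := half_pos (log_pos (by linarith [pow_pos hρ 2]))
  refine (norm_integral_sub_intervalIntegral_le hr hρ.le ?_ fun v => ?_).trans
    ((mul_le_mul_of_nonneg_left (exp_neg_mul_le_inv_sqrt_mul_pow hη (by linarith) N)
      (by positivity)).trans_eq (mul_div_assoc _ _ _).symm)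
  · exact ((h.continuous_invPhase_vline.sub continuous_const).const_mul _).cexp.mul
      (continuous_inv_vline_sub hya)
  · rw [norm_mul]
    gcongr
    · exact h.norm_exp_invPhase_vline_le (by linarith) v
    · exact (norm_inv_vline_sub_le hya v).trans (inv_anti₀ hb (hy.trans (le_abs_self _)))

theorem half_le_norm_sub_of_mem_ball {u : ℂ} {a y b : ℝ} (hy : b ≤ a - y)
    (hu : u ∈ ball (a : ℂ) (b / 8)) : b / 2 ≤ ‖u - y‖ := by
  rw [mem_ball_iff_norm'] at hu
  have := norm_sub_norm_le ((a : ℂ) - y) (a - u)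
  rw [sub_sub_sub_cancel_left, ← Complex.ofReal_sub, Complex.norm_real, norm_eq_abs] at this
  linarith [le_abs_self (a - y), norm_nonneg ((a : ℂ) - u)]

theorem exists_norm_invPhase_integral_sub_le {b X : ℝ} (hb : 0 < b) (hX : 0 ≤ X) (N : ℕ) :
    ∃ C, 0 ≤ C ∧ ∀ r : ℝ, 2 ≤ r → ∀ α β ξ a y : ℝ, IsInvPhaseSaddle α β ξ a → ξ ≤ X →
      b ≤ a → b ≤ 1 - a → b ≤ a - y →
      ‖(∫ v, Complex.exp (r * (invPhase α β ξ (vline a v) - invPhase α β ξ a)) *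
          (vline a v - y)⁻¹) -
        evenGaussSum r (saddleCoeff (invPhase α β ξ) a fun u => (u - y)⁻¹) N‖ ≤
      C / (√r * r ^ N) := by
  obtain ⟨C, hC0, hC⟩ := exists_norm_saddle_integral_sub_le (ρ := b / 8) (by positivity)
    (by positivity : 0 ≤ 2 / b ^ 2 + X * (6 / b ^ 3)) N
  set ρ := b / 8 / 2
  have hρ : 0 < ρ := by positivity
  set D := π * (1 + ρ ^ 2) * b⁻¹ * ((N + 1).factorial / (log (1 + ρ ^ 2) / 2) ^ (N + 1))
  have hD : 0 ≤ D := by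
    have : 0 ≤ log (1 + ρ ^ 2) := log_nonneg (by linarith [pow_pos hρ 2])
    positivity
  refine ⟨D + C * (b / 2)⁻¹, by positivity, fun r hr α β ξ a y h hξ hba hba1 hy => ?_⟩
  have hne {u : ℂ} (hu : u ∈ ball (a : ℂ) (b / 8)) : u - y ≠ 0 :=
    norm_pos_iff.1 ((half_pos hb).trans_le (half_le_norm_sub_of_mem_ball hy hu))
  have hloc := hC r (by linarith) _ _ (fun u => (u - y)⁻¹) a (b / 2)⁻¹
    (h.isSaddle (by positivity) (by linarith) (by linarith))
    (fun u hu => h.norm_invPhaseSlope_le hb hba hba1 hξ (mem_ball_iff_norm.1 hu).le)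
    (DifferentiableOn.fun_inv (by fun_prop) fun u hu => hne hu)
    (fun u hu => (norm_inv _).trans_le
      (inv_anti₀ (half_pos hb) (half_le_norm_sub_of_mem_ball hy hu)))
  rw [add_div, ← sub_add_sub_cancel]
  exact (norm_add_le _ _).trans (add_le_add (h.norm_invPhase_tail_le hb hy hr hρ N) hloc)

end InvPhase

section Amplitude

open Filter Topology Metric

/-- The phase function of the integral on a vertical line, in the complex variable `u = 1 / t`. -/
noncomputable def recipPhase (θ ξ : ℝ) : ℂ → ℂ :=
  invPhase (cos θ ^ 2) (sin θ ^ 2) ξ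

variable {θ ξ t y : ℝ}

theorem recipPhase_inv (θ ξ : ℝ) (ht : 1 < t) : recipPhase θ ξ (t⁻¹ : ℝ) = phase θ ξ t := by
  have ht0 : 0 < t := by linarith
  have ht1 : 0 < t - 1 := sub_pos.2 ht
  have hsub : 1 - t⁻¹ = (t - 1) / t := by field_simp
  rw [recipPhase, invPhase, ← Complex.ofReal_one, ← Complex.ofReal_sub, hsub,
    ← Complex.ofReal_log (by positivity), ← Complex.ofReal_log (by positivity), log_inv,
    log_div ht1.ne' ht0.ne', phase, cos_sq']
  push_cast
  rw [div_inv_eq_mul]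
  ring

theorem isInvPhaseSaddle_inv_saddle (hθ : θ ∈ Ioo 0 (π / 2)) (hξ : 0 ≤ ξ) :
    IsInvPhaseSaddle (cos θ ^ 2) (sin θ ^ 2) ξ (saddle θ ξ)⁻¹ where
  α_nonneg := sq_nonneg _
  β_nonneg := sq_nonneg _
  add_eq_one := cos_sq_add_sin_sq θ
  ξ_nonneg := hξ
  pos := inv_pos.2 (saddle_pos hθ hξ)
  lt_one := inv_lt_one_of_one_lt₀ (one_lt_saddle hθ hξ)
  eq_zero := by
    have hs := (saddle_pos hθ hξ).ne'
    have hs1 : saddle θ ξ - 1 ≠ 0 := sub_ne_zero.2 (one_lt_saddle hθ hξ).ne'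
    have hsub : 1 - (saddle θ ξ)⁻¹ = (saddle θ ξ - 1) / saddle θ ξ := by field_simp
    rw [hsub, sin_sq]
    field_simp
    linear_combination -saddle θ ξ * saddle_quadratic hθ hξ

theorem exists_isSaddle_recipPhase (hθ : θ ∈ Ioo 0 (π / 2)) (hξ : 0 ≤ ξ) {δ : ℝ} (hδ : 0 < δ) :
    ∃ K ρ, ρ ≤ δ ∧ IsSaddle (recipPhase θ ξ) K ((saddle θ ξ)⁻¹ : ℝ) ρ := by
  have h := isInvPhaseSaddle_inv_saddle hθ hξ
  have hle {x : ℝ} (hx : min δ (min (saddle θ ξ)⁻¹ (1 - (saddle θ ξ)⁻¹)) ≤ x) :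
      8 * (min δ (min (saddle θ ξ)⁻¹ (1 - (saddle θ ξ)⁻¹)) / 8) ≤ x := by linarith
  have hpos : 0 < min δ (min (saddle θ ξ)⁻¹ (1 - (saddle θ ξ)⁻¹)) :=
    lt_min hδ (lt_min h.pos (sub_pos.2 h.lt_one))
  refine ⟨_, _, ?_, h.isSaddle (div_pos hpos (by norm_num)) (hle ?_) (hle ?_)⟩
  · exact (div_le_self hpos.le (by norm_num)).trans (min_le_left _ _)
  · exact (min_le_right _ _).trans (min_le_left _ _)
  · exact (min_le_right _ _).trans (min_le_right _ _)

theorem eq_neg_ofReal_of_sq_eq {z : ℂ} {w : ℝ} (hsq : z ^ 2 = (w : ℂ) ^ 2) (h : z.re * w ≤ 0) :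
    z = -(w : ℂ) := by
  rcases sq_eq_sq_iff_eq_or_eq_neg.1 hsq with rfl | hz
  · have : w = 0 := mul_self_eq_zero.1 (h.antisymm (mul_self_nonneg w))
    simp [this]
  · exact hz

theorem inv_sub_inv_mul_wOf_nonpos (hθ : θ ∈ Ioo 0 (π / 2)) (hξ : 0 ≤ ξ) (ht : 1 < t) :
    (t⁻¹ - (saddle θ ξ)⁻¹) * wOf θ ξ t ≤ 0 := by
  have ht0 : 0 < t := by linarith
  rcases le_total (saddle θ ξ) t with hle | hle
  · refine mul_nonpos_of_nonpos_of_nonneg (sub_nonpos.2 (inv_anti₀ (saddle_pos hθ hξ) hle)) ?_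
    exact (sqrt_nonneg _).trans_eq (signedSqrt_of_ge hle).symm
  · refine mul_nonpos_of_nonneg_of_nonpos (sub_nonneg.2 (inv_anti₀ ht0 hle)) ?_
    exact (signedSqrt_of_le hle).trans_le (neg_nonpos.2 (sqrt_nonneg _))

theorem morseCoord_recipPhase_inv (hθ : θ ∈ Ioo 0 (π / 2)) (hξ : 0 ≤ ξ) {K : ℂ → ℂ} {ρ : ℝ}
    (h : IsSaddle (recipPhase θ ξ) K ((saddle θ ξ)⁻¹ : ℝ) ρ) (ht : 1 < t)
    (hu : ((t⁻¹ : ℝ) : ℂ) ∈ ball (((saddle θ ξ)⁻¹ : ℝ) : ℂ) ρ) :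
    morseCoord (recipPhase θ ξ) ((saddle θ ξ)⁻¹ : ℝ) (t⁻¹ : ℝ) = -(wOf θ ξ t : ℂ) := by
  refine eq_neg_ofReal_of_sq_eq ?_ ?_
  · have hsq := h.morseCoord_sq (t⁻¹ : ℝ)
    rw [recipPhase_inv θ ξ ht, recipPhase_inv θ ξ (one_lt_saddle hθ hξ)] at hsq
    rw [← Complex.ofReal_pow, wOf_sq hθ hξ ht, Complex.ofReal_mul, Complex.ofReal_sub,
      Complex.ofReal_ofNat]
    linear_combination 2 * hsq
  · rw [morseCoord, ← Complex.ofReal_sub, Complex.re_ofReal_mul, mul_right_comm]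
    exact mul_nonpos_of_nonpos_of_nonneg (inv_sub_inv_mul_wOf_nonpos hθ hξ ht)
      (h.re_morseFactor_pos hu).le

theorem eventually_inv_mem_ball (hθ : θ ∈ Ioo 0 (π / 2)) (hξ : 0 ≤ ξ) {ρ : ℝ} (hρ : 0 < ρ) :
    ∀ᶠ t : ℝ in 𝓝 (saddle θ ξ), 1 < t ∧
      ((t⁻¹ : ℝ) : ℂ) ∈ ball (((saddle θ ξ)⁻¹ : ℝ) : ℂ) ρ := by
  have hcont : ContinuousAt (fun t : ℝ => ((t⁻¹ : ℝ) : ℂ)) (saddle θ ξ) :=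
    Complex.continuous_ofReal.continuousAt.comp (continuousAt_inv₀ (saddle_pos hθ hξ).ne')
  exact (lt_mem_nhds (one_lt_saddle hθ hξ)).and (hcont.tendsto (ball_mem_nhds _ hρ))

theorem eventually_wOf_eq (hθ : θ ∈ Ioo 0 (π / 2)) (hξ : 0 ≤ ξ) :
    ∀ᶠ t in 𝓝 (saddle θ ξ), (wOf θ ξ t : ℂ) =
      -morseCoord (recipPhase θ ξ) ((saddle θ ξ)⁻¹ : ℝ) (t⁻¹ : ℝ) := by
  obtain ⟨K, ρ, -, h⟩ := exists_isSaddle_recipPhase hθ hξ one_pos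
  filter_upwards [eventually_inv_mem_ball hθ hξ h.pos] with t ht
  rw [morseCoord_recipPhase_inv hθ hξ h ht.1 ht.2, neg_neg]

theorem analyticAt_wOf (hθ : θ ∈ Ioo 0 (π / 2)) (hξ : 0 ≤ ξ) :
    AnalyticAt ℝ (wOf θ ξ) (saddle θ ξ) := by
  obtain ⟨K, ρ, -, h⟩ := exists_isSaddle_recipPhase hθ hξ one_pos
  have hmorse : AnalyticAt ℝ (morseCoord (recipPhase θ ξ) ((saddle θ ξ)⁻¹ : ℝ))
      (Complex.ofRealCLM (saddle θ ξ)⁻¹) :=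
    (h.differentiableOn_morseCoord.analyticAt (ball_mem_nhds _ h.pos)).restrictScalars
  have hinv : AnalyticAt ℝ (fun t : ℝ => Complex.ofRealCLM t⁻¹) (saddle θ ξ) :=
    (Complex.ofRealCLM.analyticAt _).comp (analyticAt_inv (saddle_pos hθ hξ).ne')
  have hcomp : AnalyticAt ℝ (fun t : ℝ => morseCoord (recipPhase θ ξ) ((saddle θ ξ)⁻¹ : ℝ)
      (Complex.ofRealCLM t⁻¹)) (saddle θ ξ) :=
    AnalyticAt.comp_of_eq (f := fun t : ℝ => Complex.ofRealCLM t⁻¹) hmorse hinv rfl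
  refine (((Complex.reCLM.analyticAt _).comp hcomp).neg).congr ?_
  filter_upwards [eventually_wOf_eq hθ hξ] with t ht
  simpa using (congrArg Complex.re ht).symm

theorem deriv_wOf_saddle_ne_zero (hθ : θ ∈ Ioo 0 (π / 2)) (hξ : 0 ≤ ξ) :
    deriv (wOf θ ξ) (saddle θ ξ) ≠ 0 := by
  obtain ⟨K, ρ, -, h⟩ := exists_isSaddle_recipPhase hθ hξ one_pos
  have hs := (saddle_pos hθ hξ).ne'
  have hmorse := ((h.hasDerivAt_morseCoord h.mem_ball).comp (saddle θ ξ)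
    (hasDerivAt_inv hs).ofReal_comp).neg
  have hwOf := (analyticAt_wOf hθ hξ).differentiableAt.hasDerivAt.ofReal_comp
  have heq := hwOf.unique (hmorse.congr_of_eventuallyEq (eventually_wOf_eq hθ hξ))
  rw [← Complex.ofReal_ne_zero, heq]
  exact neg_ne_zero.2 (mul_ne_zero (h.deriv_morseCoord_ne_zero h.mem_ball)
    (Complex.ofReal_ne_zero.2 (neg_ne_zero.2 (inv_ne_zero (pow_ne_zero 2 hs)))))

theorem tOf_wOf (hθ : θ ∈ Ioo 0 (π / 2)) (hξ : 0 ≤ ξ) (ht : 1 < t) :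
    tOf θ ξ (wOf θ ξ t) = t :=
  (bijOn_wOf hθ hξ).invOn_invFunOn.1 ht

theorem wOf_tOf (hθ : θ ∈ Ioo 0 (π / 2)) (hξ : 0 ≤ ξ) (w : ℝ) : wOf θ ξ (tOf θ ξ w) = w :=
  (bijOn_wOf hθ hξ).invOn_invFunOn.2 (mem_univ w)

theorem one_lt_tOf (hθ : θ ∈ Ioo 0 (π / 2)) (hξ : 0 ≤ ξ) (w : ℝ) : 1 < tOf θ ξ w :=
  (bijOn_wOf hθ hξ).surjOn.mapsTo_invFunOn (mem_univ w)

theorem wOf_saddle (θ ξ : ℝ) : wOf θ ξ (saddle θ ξ) = 0 := signedSqrt_self _ _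

theorem tOf_zero (hθ : θ ∈ Ioo 0 (π / 2)) (hξ : 0 ≤ ξ) : tOf θ ξ 0 = saddle θ ξ := by
  rw [← wOf_saddle θ ξ, tOf_wOf hθ hξ (one_lt_saddle hθ hξ)]

theorem analyticAt_tOf (hθ : θ ∈ Ioo 0 (π / 2)) (hξ : 0 ≤ ξ) : AnalyticAt ℝ (tOf θ ξ) 0 := by
  rw [← wOf_saddle θ ξ, ← analyticAt_comp_iff_of_deriv_ne_zero (analyticAt_wOf hθ hξ)
    (deriv_wOf_saddle_ne_zero hθ hξ)]
  refine analyticAt_id.congr ?_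
  filter_upwards [lt_mem_nhds (one_lt_saddle hθ hξ)] with t ht using (tOf_wOf hθ hξ ht).symm

theorem analyticAt_amplitude (hθ : θ ∈ Ioo 0 (π / 2)) (hξ : 0 ≤ ξ) (hy : y * saddle θ ξ < 1) :
    AnalyticAt ℝ (amplitude θ ξ y) 0 := by
  have hT := analyticAt_tOf hθ hξ
  have hne : tOf θ ξ 0 * (1 - y * tOf θ ξ 0) ≠ 0 := by
    rw [tOf_zero hθ hξ]
    exact mul_ne_zero (saddle_pos hθ hξ).ne' (sub_pos.2 hy).ne'
  exact (analyticAt_const.div (hT.mul (analyticAt_const.sub (analyticAt_const.mul hT))) hne).mul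
    hT.deriv

theorem exists_hasSum_amplitude (hθ : θ ∈ Ioo 0 (π / 2)) (hξ : 0 ≤ ξ) (hy : y * saddle θ ξ < 1) :
    ∃ ρ : ℝ, 0 < ρ ∧ ∀ w : ℝ, |w| < ρ →
      HasSum (fun k : ℕ => fCoeff θ ξ y k * w ^ k) (amplitude θ ξ y w) := by
  have hseries := hasFPowerSeriesAt_iff.1 (analyticAt_amplitude hθ hξ hy).hasFPowerSeriesAt
  obtain ⟨ρ, hρ, hsum⟩ := Metric.eventually_nhds_iff.1 hseries
  refine ⟨ρ, hρ, fun w hw => ?_⟩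
  simpa [fCoeff, mul_comm, FormalMultilinearSeries.coeff_ofScalars] using
    hsum (y := w) (by simpa [Real.dist_eq] using hw)

theorem iterate_dslope_zero {F : ℝ → ℝ} (hF : AnalyticAt ℝ F 0) (k : ℕ) :
    (Function.swap dslope 0)^[k] F 0 = iteratedDeriv k F 0 / k.factorial := by
  rw [← (hF.hasFPowerSeriesAt.has_fpower_series_iterate_dslope_fslope k).coeff_zero 1]
  refine (FormalMultilinearSeries.coeff_iterate_fslope k 0).trans ?_
  rw [zero_add, FormalMultilinearSeries.coeff_ofScalars]

theorem eventually_iterate_dslope_eq_reducedSeq {S G : ℂ → ℂ} {c : ℂ} {F : ℝ → ℝ} {u : ℝ → ℂ}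
    (hF : AnalyticAt ℝ F 0) (hu : ContinuousAt u 0) (hu0 : u 0 = c)
    (hSG : ∀ k, ContinuousAt (reducedSeq S G c k) c)
    (huS : ∀ᶠ w : ℝ in 𝓝 0, (u w - c) * S (u w) = -w) (hFG : ∀ᶠ w in 𝓝 0, F w = G (u w)) (k : ℕ) :
    ∀ᶠ w in 𝓝 0, ((((Function.swap dslope 0)^[k] F w : ℝ)) : ℂ) =
      (-1) ^ k * reducedSeq S G c k (u w) := by
  induction k with
  | zero => simpa [reducedSeq] using hFG
  | succ k ih =>
    have hleft : ContinuousAt (fun w => (((Function.swap dslope 0)^[k + 1] F w : ℝ) : ℂ)) 0 :=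
      (hF.hasFPowerSeriesAt.has_fpower_series_iterate_dslope_fslope
        (k + 1)).continuousAt.tendsto.ofReal
    have hright : ContinuousAt (fun w => (-1) ^ (k + 1) * reducedSeq S G c (k + 1) (u w)) 0 :=
      (ContinuousAt.comp_of_eq (g := reducedSeq S G c (k + 1)) (hSG (k + 1)) hu hu0).const_mul _
    refine (hleft.eventuallyEq_nhds_iff_eventuallyEq_nhdsNE hright).1 ?_
    filter_upwards [nhdsWithin_le_nhds ih, nhdsWithin_le_nhds huS, self_mem_nhdsWithin]
      with w hw hwS hw0
    have huc : u w ≠ c := by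
      rintro huc
      rw [huc, sub_self, zero_mul, eq_comm, neg_eq_zero, Complex.ofReal_eq_zero] at hwS
      exact hw0 hwS
    rw [Function.iterate_succ_apply', reducedSeq, Function.swap, dslope_of_ne _ hw0]
    beta_reduce
    rw [dslope_of_ne _ huc, slope_def_field, slope_def_field, sub_zero, div_div, hwS,
      Complex.ofReal_div, Complex.ofReal_sub, hw, ih.self_of_nhds, hu0, pow_succ, div_neg]
    ring

theorem eventually_morseCoord_inv_tOf (hθ : θ ∈ Ioo 0 (π / 2)) (hξ : 0 ≤ ξ) :
    ∀ᶠ w in 𝓝 0,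
      morseCoord (recipPhase θ ξ) ((saddle θ ξ)⁻¹ : ℝ) ((tOf θ ξ w)⁻¹ : ℝ) = -(w : ℂ) := by
  have hT := (analyticAt_tOf hθ hξ).continuousAt.tendsto
  rw [tOf_zero hθ hξ] at hT
  filter_upwards [hT.eventually (eventually_wOf_eq hθ hξ)] with w hw
  rw [eq_neg_iff_add_eq_zero, ← wOf_tOf hθ hξ w, hw, tOf_wOf hθ hξ (one_lt_tOf hθ hξ w),
    add_neg_cancel]

theorem eventually_amplitude_eq (hθ : θ ∈ Ioo 0 (π / 2)) (hξ : 0 ≤ ξ) {K : ℂ → ℂ} {ρ : ℝ}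
    (h : IsSaddle (recipPhase θ ξ) K ((saddle θ ξ)⁻¹ : ℝ) ρ) (y : ℝ) :
    ∀ᶠ w in 𝓝 0, (amplitude θ ξ y w : ℂ) = (((tOf θ ξ w)⁻¹ : ℝ) - y : ℂ)⁻¹ /
      deriv (morseCoord (recipPhase θ ξ) ((saddle θ ξ)⁻¹ : ℝ)) ((tOf θ ξ w)⁻¹ : ℝ) := by
  have hT := (analyticAt_tOf hθ hξ).continuousAt.tendsto
  rw [tOf_zero hθ hξ] at hT
  filter_upwards [(eventually_morseCoord_inv_tOf hθ hξ).eventually_nhds,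
    (analyticAt_tOf hθ hξ).eventually_analyticAt,
    hT.eventually (eventually_inv_mem_ball hθ hξ h.pos)] with w hw hTw ⟨ht, hu⟩
  have ht0 : (tOf θ ξ w : ℂ) ≠ 0 := Complex.ofReal_ne_zero.2 (by linarith)
  have hinv := (hTw.differentiableAt.hasDerivAt.fun_inv (by linarith : tOf θ ξ w ≠ 0)).ofReal_comp
  have hid : HasDerivAt (fun w : ℝ => -(w : ℂ)) (-((1 : ℝ) : ℂ)) w :=
    (hasDerivAt_id' w).ofReal_comp.fun_neg
  have hchain := (HasDerivAt.comp (h := fun w => (((tOf θ ξ w)⁻¹ : ℝ) : ℂ)) w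
    (h.hasDerivAt_morseCoord hu) hinv).unique (hid.congr_of_eventuallyEq hw)
  have hM := h.deriv_morseCoord_ne_zero hu
  generalize deriv (morseCoord (recipPhase θ ξ) ((saddle θ ξ)⁻¹ : ℝ)) ((tOf θ ξ w)⁻¹ : ℝ) = M
    at hchain hM ⊢
  have hT' : ((deriv (tOf θ ξ) w : ℝ) : ℂ) * M = (tOf θ ξ w : ℂ) ^ 2 := by
    push_cast at hchain
    field_simp at hchain
    linear_combination -hchain
  have hsub : (tOf θ ξ w : ℂ)⁻¹ - y = (1 - y * tOf θ ξ w) / tOf θ ξ w := by field_simp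
  rw [amplitude, eq_div_iff hM, Complex.ofReal_mul, mul_assoc, hT', Complex.ofReal_inv, hsub,
    inv_div]
  push_cast
  field_simp

theorem fCoeff_eq_saddleCoeff (hθ : θ ∈ Ioo 0 (π / 2)) (hξ : 0 ≤ ξ) (hy : y * saddle θ ξ < 1)
    (k : ℕ) : (fCoeff θ ξ y k : ℂ) =
      (-1) ^ k * saddleCoeff (recipPhase θ ξ) ((saddle θ ξ)⁻¹ : ℝ) (fun u => (u - y)⁻¹) k := by
  have hgap : 0 < (saddle θ ξ)⁻¹ - y :=
    sub_pos.2 ((lt_inv_mul_iff₀ (saddle_pos hθ hξ)).2 (by linarith) |>.trans_eq (mul_one _))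
  obtain ⟨K, ρ, hρ, h⟩ := exists_isSaddle_recipPhase hθ hξ hgap
  have hg : DifferentiableOn ℂ (fun u : ℂ => (u - y)⁻¹) (ball ((saddle θ ξ)⁻¹ : ℝ) ρ) := by
    refine (differentiableOn_id.sub_const _).inv fun u hu => sub_ne_zero.2 ?_
    rintro rfl
    rw [mem_ball_iff_norm', ← Complex.ofReal_sub, Complex.norm_of_nonneg hgap.le] at hu
    exact hu.not_ge hρ
  have hcont (k : ℕ) := ((differentiableOn_reducedSeq h.pos h.differentiableOn_morseFactor
    (h.differentiableOn_div_deriv_morseCoord hg) (fun _ hu => h.morseFactor_ne_zero hu)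
    k).differentiableAt (ball_mem_nhds _ h.pos)).continuousAt
  have hF := analyticAt_amplitude hθ hξ hy
  have hu0 : (((tOf θ ξ 0)⁻¹ : ℝ) : ℂ) = ((saddle θ ξ)⁻¹ : ℝ) := by rw [tOf_zero hθ hξ]
  have hu : ContinuousAt (fun w => (((tOf θ ξ w)⁻¹ : ℝ) : ℂ)) 0 :=
    ((analyticAt_tOf hθ hξ).continuousAt.inv₀ (by linarith [one_lt_tOf hθ hξ 0])).tendsto.ofReal
  have heq := (eventually_iterate_dslope_eq_reducedSeq hF hu hu0 hcont
    (eventually_morseCoord_inv_tOf hθ hξ) (eventually_amplitude_eq hθ hξ h y) k).self_of_nhds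
  rw [iterate_dslope_zero hF, hu0] at heq
  exact heq

end Amplitude

section ChainRule

variable {𝕜 : Type*} [NontriviallyNormedField 𝕜] [CompleteSpace 𝕜] {g T : 𝕜 → 𝕜} {x : 𝕜}

theorem deriv_comp_mul_deriv (hg : AnalyticAt 𝕜 g (T x)) (hT : AnalyticAt 𝕜 T x) :
    deriv (g ∘ T * deriv T) x =
      deriv g (T x) * deriv T x ^ 2 + g (T x) * iteratedDeriv 2 T x := by
  rw [deriv_mul (hg.comp hT).differentiableAt hT.deriv.differentiableAt,
    deriv_comp x hg.differentiableAt hT.differentiableAt, iteratedDeriv_succ, iteratedDeriv_one,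
    Function.comp_apply]
  ring

theorem iteratedDeriv_two_comp_mul_deriv (hg : AnalyticAt 𝕜 g (T x)) (hT : AnalyticAt 𝕜 T x) :
    iteratedDeriv 2 (g ∘ T * deriv T) x =
      iteratedDeriv 2 g (T x) * deriv T x ^ 3 +
        3 * deriv g (T x) * deriv T x * iteratedDeriv 2 T x + g (T x) * iteratedDeriv 3 T x := by
  rw [iteratedDeriv_mul (hg.comp hT).contDiffAt hT.deriv.contDiffAt]
  simp only [Finset.sum_range_succ, Finset.sum_range_zero, iteratedDeriv_zero, iteratedDeriv_one,
    ← iteratedDeriv_succ', Nat.choose, Nat.reduceSub, Nat.reduceAdd, Function.comp_apply,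
    deriv_comp x hg.differentiableAt hT.differentiableAt,
    iteratedDeriv_comp_two hg.contDiffAt hT.contDiffAt]
  push_cast
  ring

theorem iteratedDeriv_three_comp_mul_deriv (hg : AnalyticAt 𝕜 g (T x)) (hT : AnalyticAt 𝕜 T x) :
    iteratedDeriv 3 (g ∘ T * deriv T) x =
      iteratedDeriv 3 g (T x) * deriv T x ^ 4 +
        6 * iteratedDeriv 2 g (T x) * deriv T x ^ 2 * iteratedDeriv 2 T x +
        deriv g (T x) * (3 * iteratedDeriv 2 T x ^ 2 + 4 * deriv T x * iteratedDeriv 3 T x) +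
        g (T x) * iteratedDeriv 4 T x := by
  rw [iteratedDeriv_mul (hg.comp hT).contDiffAt hT.deriv.contDiffAt]
  simp only [Finset.sum_range_succ, Finset.sum_range_zero, iteratedDeriv_zero, iteratedDeriv_one,
    ← iteratedDeriv_succ', Nat.choose, Nat.reduceSub, Nat.reduceAdd, Function.comp_apply,
    deriv_comp x hg.differentiableAt hT.differentiableAt,
    iteratedDeriv_comp_two hg.contDiffAt hT.contDiffAt,
    iteratedDeriv_comp_three hg.contDiffAt hT.contDiffAt]
  push_cast
  ring

end ChainRule

section ExplicitCoefficients

open Filter Topology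

variable {θ ξ t y : ℝ}

theorem eventually_deriv_phase_eq (hθ : θ ∈ Ioo 0 (π / 2)) (hξ : 0 ≤ ξ) (ht : 1 < t) :
    deriv (phase θ ξ) =ᶠ[𝓝 t] fun s =>
      (s - saddle θ ξ) * ((ξ * s + 1 / saddle θ ξ) / (s * (s - 1))) := by
  filter_upwards [lt_mem_nhds ht] with s hs
  rw [(hasDerivAt_phase θ ξ hs).deriv, phase_deriv_eq_mul hθ hξ hs]

theorem analyticAt_phase (θ ξ : ℝ) (ht : 1 < t) : AnalyticAt ℝ (phase θ ξ) t := by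
  have hlog := analyticAt_log (x := t) (by linarith)
  have hlog_sub := (analyticAt_id.sub analyticAt_const).log (f := fun t : ℝ => t - 1) (sub_pos.2 ht)
  exact (hlog.sub (analyticAt_const.mul hlog_sub)).add (analyticAt_const.mul analyticAt_id)

theorem phaseDeriv_two (hθ : θ ∈ Ioo 0 (π / 2)) (hξ : 0 ≤ ξ) : phaseDeriv θ ξ 2 =
    (ξ * saddle θ ξ + 1 / saddle θ ξ) / (saddle θ ξ * (saddle θ ξ - 1)) := by
  have hs := one_lt_saddle hθ hξ
  have := saddle_pos hθ hξ
  have := sub_pos.2 hs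
  have hcof : DifferentiableAt ℝ (fun s => (ξ * s + 1 / saddle θ ξ) / (s * (s - 1)))
      (saddle θ ξ) := by fun_prop (disch := positivity)
  rw [phaseDeriv, iteratedDeriv_succ, iteratedDeriv_one,
    (eventually_deriv_phase_eq hθ hξ hs).deriv_eq,
    (((hasDerivAt_id' _).sub_const _).fun_mul hcof.hasDerivAt).deriv]
  ring

theorem phaseDeriv_two_pos (hθ : θ ∈ Ioo 0 (π / 2)) (hξ : 0 ≤ ξ) : 0 < phaseDeriv θ ξ 2 :=
  (phase_deriv_cofactor_pos hθ hξ (one_lt_saddle hθ hξ)).trans_eq (phaseDeriv_two hθ hξ).symm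

theorem eventually_deriv_phase_tOf_mul (hθ : θ ∈ Ioo 0 (π / 2)) (hξ : 0 ≤ ξ) :
    deriv (phase θ ξ) ∘ tOf θ ξ * deriv (tOf θ ξ) =ᶠ[𝓝 0] id := by
  have hphase : phase θ ξ ∘ tOf θ ξ = fun w => w ^ 2 / 2 + phase θ ξ (saddle θ ξ) := by
    funext w
    have := wOf_sq hθ hξ (one_lt_tOf hθ hξ w)
    rw [wOf_tOf hθ hξ] at this
    rw [Function.comp_apply]
    linarith
  filter_upwards [(analyticAt_tOf hθ hξ).eventually_analyticAt] with w hw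
  rw [Pi.mul_apply, Function.comp_apply,
    ← deriv_comp w (analyticAt_phase θ ξ (one_lt_tOf hθ hξ w)).differentiableAt
      hw.differentiableAt, hphase, deriv_add_const, deriv_div_const, deriv_pow_field]
  simp

theorem strictMono_tOf (hθ : θ ∈ Ioo 0 (π / 2)) (hξ : 0 ≤ ξ) : StrictMono (tOf θ ξ) := by
  intro v w hvw
  have hmono : StrictMonoOn (wOf θ ξ) (Ioi 1) := strictMonoOn_signedSqrt (one_lt_saddle hθ hξ)
    (strictAntiOn_phase hθ hξ) (strictMonoOn_phase hθ hξ)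
  refine (hmono.lt_iff_lt (one_lt_tOf hθ hξ v) (one_lt_tOf hθ hξ w)).1 ?_
  rwa [wOf_tOf hθ hξ, wOf_tOf hθ hξ]

theorem deriv_phase_tOf_zero (hθ : θ ∈ Ioo 0 (π / 2)) (hξ : 0 ≤ ξ) :
    deriv (phase θ ξ) (tOf θ ξ 0) = 0 := by
  rw [tOf_zero hθ hξ, (hasDerivAt_phase_saddle hθ hξ).deriv]

theorem analyticAt_deriv_phase_tOf_zero (hθ : θ ∈ Ioo 0 (π / 2)) (hξ : 0 ≤ ξ) :
    AnalyticAt ℝ (deriv (phase θ ξ)) (tOf θ ξ 0) :=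
  (analyticAt_phase θ ξ (one_lt_tOf hθ hξ 0)).deriv

theorem phaseDeriv_two_mul_deriv_tOf_sq (hθ : θ ∈ Ioo 0 (π / 2)) (hξ : 0 ≤ ξ) :
    phaseDeriv θ ξ 2 * deriv (tOf θ ξ) 0 ^ 2 = 1 := by
  have h := (eventually_deriv_phase_tOf_mul hθ hξ).deriv_eq
  rw [deriv_comp_mul_deriv (analyticAt_deriv_phase_tOf_zero hθ hξ) (analyticAt_tOf hθ hξ),
    deriv_phase_tOf_zero hθ hξ, zero_mul, add_zero, deriv_id, tOf_zero hθ hξ] at h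
  rwa [phaseDeriv, iteratedDeriv_succ, iteratedDeriv_one]

theorem phaseDeriv_three_mul_add_eq_zero (hθ : θ ∈ Ioo 0 (π / 2)) (hξ : 0 ≤ ξ) :
    phaseDeriv θ ξ 3 * deriv (tOf θ ξ) 0 ^ 3 +
      3 * phaseDeriv θ ξ 2 * deriv (tOf θ ξ) 0 * iteratedDeriv 2 (tOf θ ξ) 0 = 0 := by
  have h := (eventually_deriv_phase_tOf_mul hθ hξ).iteratedDeriv_eq 2
  rw [iteratedDeriv_two_comp_mul_deriv (analyticAt_deriv_phase_tOf_zero hθ hξ)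
    (analyticAt_tOf hθ hξ), deriv_phase_tOf_zero hθ hξ, zero_mul, add_zero, tOf_zero hθ hξ] at h
  simpa [phaseDeriv, iteratedDeriv_id, iteratedDeriv_succ] using h

theorem phaseDeriv_four_mul_add_eq_zero (hθ : θ ∈ Ioo 0 (π / 2)) (hξ : 0 ≤ ξ) :
    phaseDeriv θ ξ 4 * deriv (tOf θ ξ) 0 ^ 4 +
      6 * phaseDeriv θ ξ 3 * deriv (tOf θ ξ) 0 ^ 2 * iteratedDeriv 2 (tOf θ ξ) 0 +
      phaseDeriv θ ξ 2 * (3 * iteratedDeriv 2 (tOf θ ξ) 0 ^ 2 +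
        4 * deriv (tOf θ ξ) 0 * iteratedDeriv 3 (tOf θ ξ) 0) = 0 := by
  have h := (eventually_deriv_phase_tOf_mul hθ hξ).iteratedDeriv_eq 3
  rw [iteratedDeriv_three_comp_mul_deriv (analyticAt_deriv_phase_tOf_zero hθ hξ)
    (analyticAt_tOf hθ hξ), deriv_phase_tOf_zero hθ hξ, zero_mul, add_zero, tOf_zero hθ hξ] at h
  simpa [phaseDeriv, iteratedDeriv_id, iteratedDeriv_succ] using h

theorem deriv_tOf_zero (hθ : θ ∈ Ioo 0 (π / 2)) (hξ : 0 ≤ ξ) :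
    deriv (tOf θ ξ) 0 = 1 / √(phaseDeriv θ ξ 2) := by
  rw [eq_div_iff (sqrt_pos.2 (phaseDeriv_two_pos hθ hξ)).ne',
    ← sqrt_sq (strictMono_tOf hθ hξ).monotone.deriv_nonneg, ← sqrt_mul (sq_nonneg _), mul_comm,
    phaseDeriv_two_mul_deriv_tOf_sq hθ hξ, sqrt_one]

theorem fCoeff_zero (hθ : θ ∈ Ioo 0 (π / 2)) (hξ : 0 ≤ ξ) (y : ℝ) :
    fCoeff θ ξ y 0 = 1 / √(phaseDeriv θ ξ 2) / (saddle θ ξ * (1 - y * saddle θ ξ)) := by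
  rw [fCoeff, iteratedDeriv_zero, amplitude, tOf_zero hθ hξ, deriv_tOf_zero hθ hξ,
    Nat.factorial_zero, Nat.cast_one, div_one, one_div_mul_eq_div]

theorem sq_mul_phaseDeriv_two (hθ : θ ∈ Ioo 0 (π / 2)) (hξ : 0 ≤ ξ) :
    (saddle θ ξ * (saddle θ ξ - 1)) ^ 2 * phaseDeriv θ ξ 2 =
      sin θ ^ 2 * saddle θ ξ ^ 2 - (saddle θ ξ - 1) ^ 2 := by
  have hs := (saddle_pos hθ hξ).ne'
  have := (sub_pos.2 (one_lt_saddle hθ hξ)).ne'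
  rw [phaseDeriv_two hθ hξ, sin_sq]
  field_simp
  linear_combination saddle θ ξ * saddle_quadratic hθ hξ

theorem fCoeff_zero_eq_div_sqrt (hθ : θ ∈ Ioo 0 (π / 2)) (hξ : 0 ≤ ξ) (y : ℝ) :
    fCoeff θ ξ y 0 = (saddle θ ξ - 1) / ((1 - y * saddle θ ξ) *
      √(sin θ ^ 2 * saddle θ ξ ^ 2 - (saddle θ ξ - 1) ^ 2)) := by
  have hs := saddle_pos hθ hξ
  have hs1 := sub_pos.2 (one_lt_saddle hθ hξ)
  rw [← sq_mul_phaseDeriv_two hθ hξ, sqrt_mul (sq_nonneg _), sqrt_sq (mul_pos hs hs1).le,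
    fCoeff_zero hθ hξ]
  field_simp

theorem hasDerivAt_one_div_mul_one_sub (ht : t ≠ 0) (hy : 1 - y * t ≠ 0) :
    HasDerivAt (fun t => 1 / (t * (1 - y * t))) (y ^ 2 / (1 - y * t) ^ 2 - 1 / t ^ 2) t := by
  have hmul := (hasDerivAt_id' t).fun_mul (((hasDerivAt_id' t).const_mul y).const_sub 1)
  convert! (hasDerivAt_const t (1 : ℝ)).fun_div hmul (mul_ne_zero ht hy) using 1
  field_simp
  ring

theorem hasDerivAt_sq_div_sq_sub_one_div_sq (ht : t ≠ 0) (hy : 1 - y * t ≠ 0) :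
    HasDerivAt (fun t => y ^ 2 / (1 - y * t) ^ 2 - 1 / t ^ 2)
      (2 * y ^ 3 / (1 - y * t) ^ 3 + 2 / t ^ 3) t := by
  have hsub := (((hasDerivAt_id' t).const_mul y).const_sub 1).fun_pow 2
  convert! ((hasDerivAt_const t (y ^ 2)).fun_div hsub (pow_ne_zero 2 hy)).fun_sub
    ((hasDerivAt_const t (1 : ℝ)).fun_div (hasDerivAt_pow 2 t) (pow_ne_zero 2 ht)) using 1
  field_simp
  ring

theorem iteratedDeriv_two_one_div_mul_one_sub (ht : t ≠ 0) (hy : 1 - y * t ≠ 0) :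
    iteratedDeriv 2 (fun t => 1 / (t * (1 - y * t))) t =
      2 * y ^ 3 / (1 - y * t) ^ 3 + 2 / t ^ 3 := by
  have hev : deriv (fun t => 1 / (t * (1 - y * t))) =ᶠ[𝓝 t]
      fun t => y ^ 2 / (1 - y * t) ^ 2 - 1 / t ^ 2 := by
    have hcont : ContinuousAt (fun t => 1 - y * t) t := by fun_prop
    filter_upwards [continuousAt_id.eventually_ne ht, hcont.eventually_ne hy] with s hs hys
      using (hasDerivAt_one_div_mul_one_sub hs hys).deriv
  rw [iteratedDeriv_succ, iteratedDeriv_one, hev.deriv_eq,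
    (hasDerivAt_sq_div_sq_sub_one_div_sq ht hy).deriv]

theorem iteratedDeriv_two_amplitude (hθ : θ ∈ Ioo 0 (π / 2)) (hξ : 0 ≤ ξ)
    (hy : y * saddle θ ξ < 1) :
    iteratedDeriv 2 (amplitude θ ξ y) 0 =
      (2 * y ^ 3 / (1 - y * saddle θ ξ) ^ 3 + 2 / saddle θ ξ ^ 3) * deriv (tOf θ ξ) 0 ^ 3 +
      3 * (y ^ 2 / (1 - y * saddle θ ξ) ^ 2 - 1 / saddle θ ξ ^ 2) * deriv (tOf θ ξ) 0 *
        iteratedDeriv 2 (tOf θ ξ) 0 +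
      1 / (saddle θ ξ * (1 - y * saddle θ ξ)) * iteratedDeriv 3 (tOf θ ξ) 0 := by
  have hs := (saddle_pos hθ hξ).ne'
  have hys := (sub_pos.2 hy).ne'
  have hg : AnalyticAt ℝ (fun t => 1 / (t * (1 - y * t))) (tOf θ ξ 0) := by
    rw [tOf_zero hθ hξ]
    fun_prop (disch := exact mul_ne_zero hs hys)
  have hamp : amplitude θ ξ y = (fun t => 1 / (t * (1 - y * t))) ∘ tOf θ ξ * deriv (tOf θ ξ) := rfl
  rw [hamp, iteratedDeriv_two_comp_mul_deriv hg (analyticAt_tOf hθ hξ), tOf_zero hθ hξ,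
    iteratedDeriv_two_one_div_mul_one_sub hs hys, (hasDerivAt_one_div_mul_one_sub hs hys).deriv]

theorem iteratedDeriv_two_tOf_zero (hθ : θ ∈ Ioo 0 (π / 2)) (hξ : 0 ≤ ξ) :
    iteratedDeriv 2 (tOf θ ξ) 0 = -phaseDeriv θ ξ 3 / (3 * phaseDeriv θ ξ 2 ^ 2) := by
  have hpos := phaseDeriv_two_pos hθ hξ
  have h := phaseDeriv_three_mul_add_eq_zero hθ hξ
  have hsq := phaseDeriv_two_mul_deriv_tOf_sq hθ hξ
  have ha : deriv (tOf θ ξ) 0 ≠ 0 := by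
    rw [deriv_tOf_zero hθ hξ]
    exact (one_div_pos.2 (sqrt_pos.2 hpos)).ne'
  rw [eq_div_iff (by positivity)]
  refine mul_left_cancel₀ ha ?_
  linear_combination phaseDeriv θ ξ 2 * h - phaseDeriv θ ξ 3 * deriv (tOf θ ξ) 0 * hsq

theorem iteratedDeriv_three_tOf_zero (hθ : θ ∈ Ioo 0 (π / 2)) (hξ : 0 ≤ ξ) :
    iteratedDeriv 3 (tOf θ ξ) 0 =
      (5 * phaseDeriv θ ξ 3 ^ 2 - 3 * phaseDeriv θ ξ 4 * phaseDeriv θ ξ 2) /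
        (12 * √(phaseDeriv θ ξ 2) ^ 7) := by
  have hpos := phaseDeriv_two_pos hθ hξ
  have hsqrt := sqrt_pos.2 hpos
  have h := phaseDeriv_four_mul_add_eq_zero hθ hξ
  rw [iteratedDeriv_two_tOf_zero hθ hξ, deriv_tOf_zero hθ hξ] at h
  have hsq : phaseDeriv θ ξ 2 = √(phaseDeriv θ ξ 2) ^ 2 := (sq_sqrt hpos.le).symm
  generalize √(phaseDeriv θ ξ 2) = s at *
  rw [hsq] at h ⊢
  rw [eq_div_iff (by positivity)]
  field_simp at h ⊢
  linear_combination h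

theorem fCoeff_two (hθ : θ ∈ Ioo 0 (π / 2)) (hξ : 0 ≤ ξ) {t₀ φ₂ φ₃ φ₄ : ℝ}
    (ht : t₀ = saddle θ ξ) (hy : y * t₀ < 1) (h₂ : φ₂ = phaseDeriv θ ξ 2)
    (h₃ : φ₃ = phaseDeriv θ ξ 3) (h₄ : φ₄ = phaseDeriv θ ξ 4) :
    fCoeff θ ξ y 2 =
      1 / (24 * φ₂ ^ (7 / 2 : ℝ) * t₀ ^ 3 * (1 - y * t₀) ^ 3) *
        (24 * φ₂ ^ 2 + 12 * φ₂ * (φ₃ - 6 * y * φ₂) * t₀ +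
          (72 * φ₂ ^ 2 * y ^ 2 + 5 * φ₃ ^ 2 - 36 * φ₃ * y * φ₂ - 3 * φ₄ * φ₂) * t₀ ^ 2 +
          2 * y * (12 * φ₃ * y * φ₂ + 3 * φ₄ * φ₂ - 5 * φ₃ ^ 2) * t₀ ^ 3 +
          y ^ 2 * (5 * φ₃ ^ 2 - 3 * φ₄ * φ₂) * t₀ ^ 4) := by
  have hpos : 0 < φ₂ := h₂ ▸ phaseDeriv_two_pos hθ hξ
  have hs : 0 < t₀ := ht ▸ saddle_pos hθ hξ
  have hyt : 1 - y * t₀ ≠ 0 := (sub_pos.2 hy).ne'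
  have hpow : φ₂ ^ (7 / 2 : ℝ) = √φ₂ ^ 7 := by
    rw [sqrt_eq_rpow, ← rpow_mul_natCast hpos.le]
    norm_num
  rw [fCoeff, iteratedDeriv_two_amplitude hθ hξ (ht ▸ hy), iteratedDeriv_three_tOf_zero hθ hξ,
    iteratedDeriv_two_tOf_zero hθ hξ, deriv_tOf_zero hθ hξ, ← ht, ← h₂, ← h₃, ← h₄, hpow]
  have hsqrt : 0 < √φ₂ := sqrt_pos.2 hpos
  have hsq : φ₂ = √φ₂ ^ 2 := (sq_sqrt hpos.le).symm
  clear h₂ hpow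
  generalize √φ₂ = s at *
  subst hsq
  simp only [Nat.factorial]
  push_cast
  field_simp
  ring

end ExplicitCoefficients

section Asymptotics

open MeasureTheory

variable {θ ξ r p q x y δ₁ δ₂ δ₃ : ℝ}

theorem exp_mul_betaLine_eq {a : ℝ} (ha : 0 < a) (ha1 : a < 1) (r α β ξ v : ℝ) :
    Complex.exp ((r * ξ : ℝ) / vline a v) * betaLine a (r * α) (r * β) v =
      Complex.exp (r * invPhase α β ξ (vline a v)) := by
  rw [betaLine, Complex.cpow_def_of_ne_zero (Complex.slitPlane_ne_zero (vline_mem_slitPlane ha v)),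
    Complex.cpow_def_of_ne_zero (Complex.slitPlane_ne_zero (one_sub_vline_mem_slitPlane ha1 v)),
    ← Complex.exp_add, ← Complex.exp_add, invPhase]
  congr 1
  push_cast
  ring

theorem add_eq_of_eq_mul_cos_sq (hp : p = r * cos θ ^ 2) (hq : q = r * sin θ ^ 2) :
    p + q = r := by
  rw [hp, hq, ← mul_add, cos_sq_add_sin_sq, mul_one]

/-- The integral over the vertical line through the saddle point that is left of `B_{p,q}(x,y)`
after division by `prefactor p q x y θ ξ` and multiplication by `√(2π/r)`. -/
noncomputable def saddleIntegral (θ ξ r y : ℝ) : ℂ :=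
  ∫ v, Complex.exp (r * (recipPhase θ ξ (vline (saddle θ ξ)⁻¹ v) -
    recipPhase θ ξ ((saddle θ ξ)⁻¹ : ℝ))) * (vline (saddle θ ξ)⁻¹ v - y)⁻¹

theorem noncentralBeta_eq_exp_mul_saddleIntegral (hθ : θ ∈ Ioo 0 (π / 2)) (hξ : 0 ≤ ξ)
    (hr : 1 < r) (hp : p = r * cos θ ^ 2) (hq : q = r * sin θ ^ 2) (hxy : x * y / 2 = r * ξ)
    (hy : 0 ≤ y) (hys : y < (saddle θ ξ)⁻¹) :
    (noncentralBeta p q x y : ℂ) = ((exp (-x / 2) * y ^ p * (1 - y) ^ q : ℝ) : ℂ) / (2 * π) *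
      ((exp (r * phase θ ξ (saddle θ ξ)) : ℝ) * saddleIntegral θ ξ r y) := by
  have hs := one_lt_saddle hθ hξ
  have ha := inv_pos.2 (saddle_pos hθ hξ)
  have ha1 := inv_lt_one_of_one_lt₀ hs
  have hr0 : 0 < r := one_pos.trans hr
  have hp0 : 0 < p := hp ▸ mul_pos hr0 (cos_sq_pos_of_mem hθ)
  have hq0 : 0 < q := hq ▸ mul_pos hr0 (sin_sq_pos_of_mem hθ)
  have hpq : 1 < p + q := hr.trans_eq (add_eq_of_eq_mul_cos_sq hp hq).symm
  rw [noncentralBeta_eq_integral ha ha1 hp0 hq0 hpq hy hys, saddleIntegral,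
    ← integral_const_mul (exp (r * phase θ ξ (saddle θ ξ)) : ℂ)]
  congr 1
  refine integral_congr_ae (.of_forall fun v => ?_)
  have hx : x / 2 * y = r * ξ := by rw [← hxy]; ring
  beta_reduce
  rw [hx, hp, hq, ← mul_assoc, exp_mul_betaLine_eq ha ha1, recipPhase_inv θ ξ hs, ← mul_assoc,
    Complex.ofReal_exp, ← Complex.exp_add, recipPhase, Complex.ofReal_mul]
  congr 2
  ring

theorem noncentralBeta_eq_prefactor_mul (hθ : θ ∈ Ioo 0 (π / 2)) (hξ : 0 ≤ ξ)
    (hr : 1 < r) (hp : p = r * cos θ ^ 2) (hq : q = r * sin θ ^ 2) (hxy : x * y / 2 = r * ξ)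
    (hy : 0 ≤ y) (hys : y < (saddle θ ξ)⁻¹) :
    (noncentralBeta p q x y : ℂ) =
      ((prefactor p q x y θ ξ / √(2 * π / r) : ℝ) : ℂ) * saddleIntegral θ ξ r y := by
  have hr0 : 0 < r := one_pos.trans hr
  have hsqrt : √(2 * π * r) * √(2 * π / r) = 2 * π := by
    rw [← sqrt_mul (by positivity), mul_assoc, mul_div_cancel₀ _ hr0.ne',
      sqrt_mul_self (by positivity)]
  rw [noncentralBeta_eq_exp_mul_saddleIntegral hθ hξ hr hp hq hxy hy hys, ← mul_assoc, prefactor,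
    add_eq_of_eq_mul_cos_sq hp hq, div_div, hsqrt, exp_add]
  push_cast
  ring

theorem sin_sq_le_cos_sq (hδ₁ : 0 < δ₁) (hθ : θ ∈ Icc δ₁ (π / 2 - δ₁)) :
    sin δ₁ ^ 2 ≤ cos θ ^ 2 := by
  have hπ := pi_pos
  have hsin : 0 ≤ sin δ₁ := sin_nonneg_of_nonneg_of_le_pi hδ₁.le (by linarith [hθ.1, hθ.2])
  refine pow_le_pow_left₀ hsin ?_ 2
  rw [← cos_pi_div_two_sub]
  exact cos_le_cos_of_nonneg_of_le_pi (by linarith [hθ.1]) (by linarith) hθ.2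

theorem cos_sq_le_inv_saddle (hθ : θ ∈ Ioo 0 (π / 2)) (hξ : 0 ≤ ξ) :
    cos θ ^ 2 ≤ (saddle θ ξ)⁻¹ := by
  have hs := saddle_pos hθ hξ
  have hs1 := sub_pos.2 (one_lt_saddle hθ hξ)
  rw [← one_div, le_div_iff₀ hs]
  have : 0 ≤ ξ * (saddle θ ξ * (saddle θ ξ - 1)) := by positivity
  linarith [saddle_quadratic hθ hξ]

theorem le_one_div_of_add_le_saddle (hθ : θ ∈ Ioo 0 (π / 2)) (hξ : 0 ≤ ξ) (hδ₂ : 0 < δ₂)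
    (hs : 1 + δ₂ ≤ saddle θ ξ) : ξ ≤ 1 / δ₂ := by
  have hs0 := saddle_pos hθ hξ
  rw [le_div_iff₀ hδ₂]
  have hδs : δ₂ ≤ saddle θ ξ * (saddle θ ξ - 1) := by nlinarith
  have : 0 ≤ cos θ ^ 2 * saddle θ ξ := by positivity
  linarith [mul_le_mul_of_nonneg_left hδs hξ, saddle_quadratic hθ hξ]

theorem div_add_one_le_one_sub_inv_saddle (hδ₂ : 0 < δ₂) (hs : 1 + δ₂ ≤ saddle θ ξ) :
    δ₂ / (1 + δ₂) ≤ 1 - (saddle θ ξ)⁻¹ :=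
  calc δ₂ / (1 + δ₂) = 1 - (1 + δ₂)⁻¹ := by field_simp; ring
    _ ≤ 1 - (saddle θ ξ)⁻¹ := by gcongr

theorem min_le_inv_saddle_sub (hθ : θ ∈ Ioo 0 (π / 2)) (hr : 0 < r) (hp : p = r * cos θ ^ 2)
    (hq : q = r * sin θ ^ 2) (hξ : 0 ≤ ξ) (hxy : x * y / 2 = r * ξ) (hδ₃ : 0 ≤ δ₃)
    (hy : y ∈ Icc 0 (yTransition p q x - δ₃)) :
    min 1 δ₃ * cos θ ^ 2 ≤ (saddle θ ξ)⁻¹ - y := by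
  have hs := saddle_pos hθ hξ
  have hδ : min 1 δ₃ ≤ 1 - y * saddle θ ξ := by
    obtain hy0 | hy0 := hy.1.eq_or_lt
    · rw [← hy0, zero_mul, sub_zero]
      exact min_le_left _ _
    · exact (min_le_right _ _).trans
        (le_one_sub_mul_saddle hθ hr hp hq hy0 hξ hxy hδ₃ hy.2)
  calc min 1 δ₃ * cos θ ^ 2 ≤ (1 - y * saddle θ ξ) * (saddle θ ξ)⁻¹ := by
        gcongr
        · exact (le_min zero_le_one hδ₃).trans hδ
        · exact cos_sq_le_inv_saddle hθ hξ
    _ = (saddle θ ξ)⁻¹ - y := by field_simp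

theorem sqrt_mul_partialSeries_eq (hθ : θ ∈ Ioo 0 (π / 2)) (hξ : 0 ≤ ξ)
    (hy : y * saddle θ ξ < 1) (r : ℝ) (N : ℕ) :
    ((√(2 * π / r) * partialSeries θ ξ y r N : ℝ) : ℂ) =
      evenGaussSum r (saddleCoeff (recipPhase θ ξ) ((saddle θ ξ)⁻¹ : ℝ) fun u => (u - y)⁻¹) N := by
  rw [evenGaussSum, partialSeries, Complex.ofReal_mul, Complex.ofReal_sum]
  congr 1
  refine Finset.sum_congr rfl fun k _ => ?_
  have hcoeff := fCoeff_eq_saddleCoeff hθ hξ hy (2 * k)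
  rw [pow_mul, neg_one_sq, one_pow, one_mul] at hcoeff
  rw [← hcoeff, ← Complex.ofReal_mul]
  congr 1
  ring

theorem abs_noncentralBeta_sub_le {C : ℝ} {N : ℕ} (hθ : θ ∈ Ioo 0 (π / 2)) (hξ : 0 ≤ ξ)
    (hr : 1 < r) (hp : p = r * cos θ ^ 2) (hq : q = r * sin θ ^ 2) (hxy : x * y / 2 = r * ξ)
    (hy : 0 ≤ y) (hys : y < (saddle θ ξ)⁻¹)
    (hC : ‖saddleIntegral θ ξ r y - evenGaussSum r
      (saddleCoeff (recipPhase θ ξ) ((saddle θ ξ)⁻¹ : ℝ) fun u => (u - y)⁻¹) N‖ ≤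
        C / (√r * r ^ N)) :
    |noncentralBeta p q x y - prefactor p q x y θ ξ * partialSeries θ ξ y r N| ≤
      C / √(2 * π) * prefactor p q x y θ ξ / r ^ N := by
  have hr0 : 0 < r := one_pos.trans hr
  have hs := one_lt_saddle hθ hξ
  have hy1 : 0 ≤ 1 - y := sub_nonneg.2 (hys.trans (inv_lt_one_of_one_lt₀ hs)).le
  have hyt : y * saddle θ ξ < 1 := by rwa [← lt_div_iff₀ (one_pos.trans hs), one_div]
  have hP : 0 ≤ prefactor p q x y θ ξ := by
    rw [prefactor]
    positivity
  have hsqrt : 0 < √(2 * π / r) := sqrt_pos.2 (by positivity)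
  rw [← sqrt_mul_partialSeries_eq hθ hξ hyt] at hC
  have hdiff : ((noncentralBeta p q x y -
      prefactor p q x y θ ξ * partialSeries θ ξ y r N : ℝ) : ℂ) =
      ((prefactor p q x y θ ξ / √(2 * π / r) : ℝ) : ℂ) *
        (saddleIntegral θ ξ r y - ((√(2 * π / r) * partialSeries θ ξ y r N : ℝ) : ℂ)) := by
    rw [mul_sub, ← noncentralBeta_eq_prefactor_mul hθ hξ hr hp hq hxy hy hys,
      ← Complex.ofReal_mul, ← mul_assoc, div_mul_cancel₀ _ hsqrt.ne', ← Complex.ofReal_sub]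
  calc |noncentralBeta p q x y - prefactor p q x y θ ξ * partialSeries θ ξ y r N|
      = prefactor p q x y θ ξ / √(2 * π / r) *
        ‖saddleIntegral θ ξ r y - ((√(2 * π / r) * partialSeries θ ξ y r N : ℝ) : ℂ)‖ := by
        rw [← norm_eq_abs, ← Complex.norm_real, hdiff, norm_mul, Complex.norm_real,
          norm_of_nonneg (by positivity)]
    _ ≤ prefactor p q x y θ ξ / √(2 * π / r) * (C / (√r * r ^ N)) := by gcongr
    _ = C / √(2 * π) * prefactor p q x y θ ξ / r ^ N := by
        have := sqrt_pos.2 hr0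
        rw [sqrt_div (by positivity)]
        field_simp

theorem exists_abs_noncentralBeta_sub_le (hδ₁ : 0 < δ₁) (hδ₂ : 0 < δ₂) (hδ₃ : 0 < δ₃) (N : ℕ) :
    ∃ C R : ℝ, 0 < R ∧ ∀ r θ p q x y ξ : ℝ, R ≤ r → θ ∈ Icc δ₁ (π / 2 - δ₁) →
      p = r * cos θ ^ 2 → q = r * sin θ ^ 2 → 0 ≤ x → x * y / 2 = r * ξ →
      1 + δ₂ ≤ saddle θ ξ → y ∈ Icc 0 (yTransition p q x - δ₃) →
      |noncentralBeta p q x y - prefactor p q x y θ ξ * partialSeries θ ξ y r N| ≤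
        C * prefactor p q x y θ ξ / r ^ N := by
  obtain hempty | hδ := lt_or_ge (π / 2 - δ₁) δ₁
  · exact ⟨0, 1, one_pos, fun r θ p q x y ξ _ hθ => absurd (hθ.1.trans hθ.2) hempty.not_ge⟩
  have hsin : 0 < sin δ₁ := sin_pos_of_pos_of_lt_pi hδ₁ (by linarith [pi_pos])
  set b := min (δ₂ / (1 + δ₂)) (min 1 δ₃ * sin δ₁ ^ 2)
  have hb : 0 < b := by positivity
  obtain ⟨C, -, hC⟩ := exists_norm_invPhase_integral_sub_le hb (one_div_pos.2 hδ₂).le N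
  refine ⟨C / √(2 * π), 2, two_pos, fun r θ p q x y ξ hr hθδ hp hq hx hxy hs hy => ?_⟩
  have hr0 : 0 < r := two_pos.trans_le hr
  have hθ : θ ∈ Ioo 0 (π / 2) := ⟨hδ₁.trans_le hθδ.1, hθδ.2.trans_lt (sub_lt_self _ hδ₁)⟩
  have hξ : 0 ≤ ξ :=
    nonneg_of_mul_nonneg_right (hxy ▸ div_nonneg (mul_nonneg hx hy.1) zero_le_two) hr0
  have hb_mul : b ≤ min 1 δ₃ * cos θ ^ 2 :=
    (min_le_right _ _).trans (by gcongr ?_ * ?_; exact sin_sq_le_cos_sq hδ₁ hθδ)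
  have hb_inv : b ≤ (saddle θ ξ)⁻¹ := hb_mul.trans <|
    (mul_le_of_le_one_left (sq_nonneg _) (min_le_left _ _)).trans (cos_sq_le_inv_saddle hθ hξ)
  have hb_one_sub : b ≤ 1 - (saddle θ ξ)⁻¹ :=
    (min_le_left _ _).trans (div_add_one_le_one_sub_inv_saddle hδ₂ hs)
  have hb_sub : b ≤ (saddle θ ξ)⁻¹ - y :=
    hb_mul.trans (min_le_inv_saddle_sub hθ hr0 hp hq hξ hxy hδ₃.le hy)
  exact abs_noncentralBeta_sub_le hθ hξ (one_lt_two.trans_le hr) hp hq hxy hy.1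
    (sub_pos.1 (hb.trans_le hb_sub)) (hC r hr _ _ _ _ y (isInvPhaseSaddle_inv_saddle hθ hξ)
      (le_one_div_of_add_le_saddle hθ hξ hδ₂ hs) hb_inv hb_one_sub hb_sub)

end Asymptotics

end NoncentralBeta

theorem mainTheorem7 :
    -- the saddle point and the substitution `φ(t) - φ(t₀) = w² / 2`
    (∀ θ ξ : ℝ, θ ∈ Set.Ioo 0 (Real.pi / 2) → 0 ≤ ξ →
      1 < NoncentralBeta.saddle θ ξ ∧
      HasDerivAt (NoncentralBeta.phase θ ξ) 0 (NoncentralBeta.saddle θ ξ) ∧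
      (∀ t : ℝ, 1 < t →
        NoncentralBeta.phase θ ξ t - NoncentralBeta.phase θ ξ (NoncentralBeta.saddle θ ξ) =
          NoncentralBeta.wOf θ ξ t ^ 2 / 2) ∧
      Set.BijOn (NoncentralBeta.wOf θ ξ) (Set.Ioi 1) Set.univ) ∧
    -- the expansion `f(w) = ∑ f_k w^k` and the explicit coefficients `f₀` and `f₂`
    (∀ θ ξ y t₀ φ₂ φ₃ φ₄ : ℝ, θ ∈ Set.Ioo 0 (Real.pi / 2) → 0 ≤ ξ → 0 ≤ y →
      t₀ = NoncentralBeta.saddle θ ξ → y * t₀ < 1 →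
      φ₂ = NoncentralBeta.phaseDeriv θ ξ 2 →
      φ₃ = NoncentralBeta.phaseDeriv θ ξ 3 →
      φ₄ = NoncentralBeta.phaseDeriv θ ξ 4 →
      (∃ ρ : ℝ, 0 < ρ ∧ ∀ w : ℝ, |w| < ρ →
        HasSum (fun k : ℕ => NoncentralBeta.fCoeff θ ξ y k * w ^ k)
          (NoncentralBeta.amplitude θ ξ y w)) ∧
      NoncentralBeta.fCoeff θ ξ y 0 = 1 / √φ₂ / (t₀ * (1 - y * t₀)) ∧
      NoncentralBeta.fCoeff θ ξ y 0 =
        (t₀ - 1) / ((1 - y * t₀) * √(Real.sin θ ^ 2 * t₀ ^ 2 - (t₀ - 1) ^ 2)) ∧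
      NoncentralBeta.fCoeff θ ξ y 2 =
        1 / (24 * φ₂ ^ (7 / 2 : ℝ) * t₀ ^ 3 * (1 - y * t₀) ^ 3) *
          (24 * φ₂ ^ 2 + 12 * φ₂ * (φ₃ - 6 * y * φ₂) * t₀ +
            (72 * φ₂ ^ 2 * y ^ 2 + 5 * φ₃ ^ 2 - 36 * φ₃ * y * φ₂ - 3 * φ₄ * φ₂) * t₀ ^ 2 +
            2 * y * (12 * φ₃ * y * φ₂ + 3 * φ₄ * φ₂ - 5 * φ₃ ^ 2) * t₀ ^ 3 +
            y ^ 2 * (5 * φ₃ ^ 2 - 3 * φ₄ * φ₂) * t₀ ^ 4)) ∧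
    -- the saddle point lies to the left of the pole `1 / y` iff `y < y₀`, iff `x > x₀`
    (∀ θ r p q x y ξ : ℝ, θ ∈ Set.Ioo 0 (Real.pi / 2) → 0 < r →
      p = r * Real.cos θ ^ 2 → q = r * Real.sin θ ^ 2 →
      0 ≤ x → 0 < y → y < 1 → x * y / 2 = r * ξ →
      (NoncentralBeta.saddle θ ξ < 1 / y ↔ y < NoncentralBeta.yTransition p q x) ∧
      (NoncentralBeta.saddle θ ξ < 1 / y ↔ NoncentralBeta.xTransition p q y < x)) ∧
    -- the asymptotic expansion as `r → ∞`, to all orders and uniformly in the other parameters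
    (∀ δ₁ δ₂ δ₃ : ℝ, 0 < δ₁ → 0 < δ₂ → 0 < δ₃ → ∀ N : ℕ,
      ∃ C R : ℝ, 0 < R ∧
        ∀ r θ p q x y ξ : ℝ, R ≤ r → θ ∈ Set.Icc δ₁ (Real.pi / 2 - δ₁) →
          p = r * Real.cos θ ^ 2 → q = r * Real.sin θ ^ 2 →
          0 ≤ x → x * y / 2 = r * ξ →
          1 + δ₂ ≤ NoncentralBeta.saddle θ ξ →
          y ∈ Set.Icc 0 (NoncentralBeta.yTransition p q x - δ₃) →
          |NoncentralBeta.noncentralBeta p q x y -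
              NoncentralBeta.prefactor p q x y θ ξ *
                NoncentralBeta.partialSeries θ ξ y r N| ≤
            C * NoncentralBeta.prefactor p q x y θ ξ / r ^ N) := by
  refine ⟨fun θ ξ hθ hξ => ⟨NoncentralBeta.one_lt_saddle hθ hξ,
    NoncentralBeta.hasDerivAt_phase_saddle hθ hξ, fun t ht => ?_,
    NoncentralBeta.bijOn_wOf hθ hξ⟩, ?_, ?_, ?_⟩
  · rw [NoncentralBeta.wOf_sq hθ hξ ht, mul_div_cancel_left₀ _ two_ne_zero]
  · rintro θ ξ y _ _ _ _ hθ hξ - rfl hy rfl rfl rfl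
    exact ⟨NoncentralBeta.exists_hasSum_amplitude hθ hξ hy, NoncentralBeta.fCoeff_zero hθ hξ y,
      NoncentralBeta.fCoeff_zero_eq_div_sqrt hθ hξ y,
      NoncentralBeta.fCoeff_two hθ hξ rfl hy rfl rfl rfl⟩
  · intro θ r p q x y ξ hθ hr hp hq hx hy hy1 hxy
    have hξ : 0 ≤ ξ := nonneg_of_mul_nonneg_right (show 0 ≤ r * ξ by rw [← hxy]; positivity) hr
    have hpq : 0 < p + q := by rwa [NoncentralBeta.add_eq_of_eq_mul_cos_sq hp hq]
    have hiff := NoncentralBeta.saddle_lt_one_div_iff_lt_yTransition hθ hr hp hq hy hξ hxy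
    exact ⟨hiff, hiff.trans (NoncentralBeta.lt_yTransition_iff_xTransition_lt hpq hx hy1)⟩
  · exact fun _ _ _ hδ₁ hδ₂ hδ₃ N =>
      NoncentralBeta.exists_abs_noncentralBeta_sub_le hδ₁ hδ₂ hδ₃ N
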